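/- **Setting.** Let $K\ge 1$, let $\mathcal X$ be a measurable space, and let $\mathcal H$ be a finite non-empty set of measurable policies $h:\mathcal X\to[K]$. Nature fixes an unknown probability distribution $\mu$ on $\mathcal X$. In round $t=1,2,\dots$ a context $\mathbf x_t\sim\mu$ is drawn independently and shown to the learner; an adaptive adversary, who knows everything that happened before the learner's randomization in round $t$, chooses a cost vector $c_t\in[0,1]^K$; the learner $\Phi$, from its observations so far (and with fresh and remembered internal randomness), selects a probability distribution $q_t$ on $[K]$ and plays $\hat y_t\sim q_t$; only $c_t[\hat y_t]$ is revealed. The hybrid bandit minimax regret over $T$ rounds is $$\tilde r^{\mathsf{bandit}}_T(\mathcal H,\Phi)=\sup_\mu\ \mathbb E_{\mathbf x_1}\sup_{c_1}\mathbb E_{\hat y_1}\cdots\mathbb E_{\mathbf x_T}\sup_{c_T}\mathbb E_{\hat y_T}\Big[\sum_{t=1}^T\langle q_t,c_t\rangle-\inf_{h\in\mathcal H}\sum_{t=1}^T c_t[h(\mathbf x_t)]\Big],$$ where $\mathbb E_{\hat y_t}$ is over the learner's internal randomness in round $t$ and over $\hat y_t\sim q_t$. The learner has access to $\mathcal H$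 and to the contexts only through an ERM oracle, which for a sequence $(\mathbf x_{i_1},\hat c_1),\dots,(\mathbf x_{i_m},\hat c_m)$ of contexts seen so far with vectors $\hat c_j\in\mathbb R^K$ returns $\inf_{h\in\mathcal H}\sum_{j=1}^m\hat c_j[h(\mathbf x_{i_j})]$. The learner is given the numbers $K$ and $|\mathcal H|$. It is *oracle-efficient* if it is computed by a randomized real-RAM program (unit-cost exact real arithmetic, comparisons and coin flips of any computed bias, no real constants in the program, memory kept from round to round) whose number of steps in round $t$, an oracle call counting as one step, is on every history at most a polynomial in $t+K$. **Theorem (contextual $K$-arm bandits).** There are a single program $\Phi$, a polynomial $p$ and an absolute constant $C$ such that for all $\mathcal X$, $K$ and $\mathcal H$ as above, $\Phi$ makes at most $p(t+K)$ steps in each round $t$, and for all $T\ge 0$ $$\tilde r^{\mathsf{bandit}}_T(\mathcal H,\Phi)\le C\left(K^{2/3}(\log|\mathcal H|)^{1/3}+K\sqrt{\log K}\right)T^{4/5}.$$ -/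

import Mathlib

namespace Bandit

/-- A cost vector over the `K` arms. -/
abbrev Cost (K : ℕ) := Fin K → ℝ

/-- The ERM value `inf_{h ∈ H} ∑ᵢ ĉᵢ[h(xᵢ)]` of a sequence of context-cost pairs. -/
noncomputable def erm {X : Type*} {K : ℕ} (H : Finset (X → Fin K)) (D : List (X × Cost K)) : ℝ :=
  ⨅ h : {h // h ∈ H}, (D.map fun d => d.2 (h.1 d.1)).sum

/-! ### The machine: a randomized real RAM with an ERM oracle -/

/-- Memory: arrays of natural numbers (array name, index), two-dimensional arrays of reals
(array name, row, column), and a clock counting executed steps.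
A scalar variable is an array used at index `0`. -/
structure Mem where
  nat : ℕ → ℕ → ℕ
  real : ℕ → ℕ → ℕ → ℝ
  clock : ℕ

namespace Mem

def empty : Mem := ⟨fun _ _ => 0, fun _ _ _ => 0, 0⟩

def tick (m : Mem) : Mem := { m with clock := m.clock + 1 }

def setNat (m : Mem) (a i v : ℕ) : Mem :=
  { m with nat := fun b k => if b = a ∧ k = i then v else m.nat b k }

noncomputable def setReal (m : Mem) (a i j : ℕ) (v : ℝ) : Mem :=
  { m with real := fun b k l => if b = a ∧ k = i ∧ l = j then v else m.real b k l }

end Mem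

/-- Index expressions: constants, cells of natural-number arrays, sum, truncated difference. -/
inductive NExp where
  | const (n : ℕ)
  | cell (a : ℕ) (i : NExp)
  | add (e f : NExp)
  | sub (e f : NExp)

def NExp.eval (m : Mem) : NExp → ℕ
  | const n => n
  | cell a i => m.nat a (i.eval m)
  | add e f => e.eval m + f.eval m
  | sub e f => e.eval m - f.eval m

/-- Real expressions: casts of index expressions, cells of real arrays, field operations. -/
inductive RExp where
  | cast (n : NExp)
  | cell (a : ℕ) (i j : NExp)
  | add (e f : RExp)
  | sub (e f : RExp)
  | mul (e f : RExp)
  | div (e f : RExp)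

noncomputable def RExp.eval (m : Mem) : RExp → ℝ
  | cast n => (n.eval m : ℝ)
  | cell a i j => m.real a (i.eval m) (j.eval m)
  | add e f => e.eval m + f.eval m
  | sub e f => e.eval m - f.eval m
  | mul e f => e.eval m * f.eval m
  | div e f => e.eval m / f.eval m

/-- Tests: comparison of two natural numbers or of two reals. -/
inductive Test where
  | ltNat (e f : NExp)
  | ltReal (e f : RExp)

def Test.holds (m : Mem) : Test → Prop
  | ltNat e f => e.eval m < f.eval m
  | ltReal e f => e.eval m < f.eval m

/-- Programs: finite syntactic objects, in which no real constant occurs. -/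
inductive Prog where
  | skip
  | setNat (a : ℕ) (i : NExp) (e : NExp)
  | setReal (a : ℕ) (i j : NExp) (e : RExp)
  /-- `flip a i p`: store `1` with probability `p` (clipped to `[0,1]`), else `0`. -/
  | flip (a : ℕ) (i : NExp) (p : RExp)
  /-- `ask a i j len hs cs`: one oracle call; see `Mem.query`. -/
  | ask (a : ℕ) (i j : NExp) (len : NExp) (hs cs : ℕ)
  | seq (P Q : Prog)
  | ite (b : Test) (P Q : Prog)
  /-- `loop v n P`: evaluate `n` once, then run `P` that many times, with the scalar `v`
  set to `0, 1, 2, …` before the successive runs. -/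
  | loop (v : ℕ) (n : NExp) (P : Prog)

/-- A coin with success probability `p`, clipped to `[0,1]`. -/
noncomputable def coin (p : ℝ) : PMF Bool :=
  PMF.ofFintype
    (fun b => ENNReal.ofReal (if b then max 0 (min 1 p) else 1 - max 0 (min 1 p))) (by
      have h0 : (0 : ℝ) ≤ max 0 (min 1 p) := le_max_left _ _
      have h1 : max 0 (min 1 p) ≤ (1 : ℝ) := max_le zero_le_one (min_le_left _ _)
      simp only [Fintype.sum_bool, if_true, Bool.false_eq_true, if_false]
      rw [← ENNReal.ofReal_add h0 (sub_nonneg.2 h1)]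
      simp)

/-- The oracle query stored in memory: for `i < len`, the context with number `nat hs i` among
those seen so far (numbered from `0`; a number that is out of range is skipped), together with
the cost vector `(real cs i k)_{k < K}`. Programs refer to contexts only by these numbers. -/
def Mem.query {X : Type*} (K : ℕ) (xs : List X) (m : Mem) (len hs cs : ℕ) : List (X × Cost K) :=
  (List.range len).filterMap fun i =>
    (xs[m.nat hs i]?).map fun x => (x, fun k : Fin K => m.real cs i k)

/-- `n` successive random steps `f 0, …, f (n - 1)`. -/
noncomputable def iterate {S : Type*} (f : ℕ → S → PMF S) : ℕ → S → PMF S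
  | 0, s => PMF.pure s
  | n + 1, s => (iterate f n s).bind (f n)

open Classical in
/-- The law of the memory after running a program when the contexts seen so far are `xs`.
Each assignment, coin flip, oracle call, test and loop entry or iteration takes one step. -/
noncomputable def Prog.exec {X : Type*} {K : ℕ} (H : Finset (X → Fin K)) (xs : List X) :
    Prog → Mem → PMF Mem
  | skip, m => PMF.pure m
  | setNat a i e, m => PMF.pure (m.setNat a (i.eval m) (e.eval m)).tick
  | setReal a i j e, m => PMF.pure (m.setReal a (i.eval m) (j.eval m) (e.eval m)).tick
  | flip a i p, m =>
      (coin (p.eval m)).bind fun b => PMF.pure (m.setNat a (i.eval m) (if b then 1 else 0)).tick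
  | ask a i j len hs cs, m =>
      PMF.pure
        (m.setReal a (i.eval m) (j.eval m) (erm H (m.query K xs (len.eval m) hs cs))).tick
  | seq P Q, m => (P.exec H xs m).bind (Q.exec H xs)
  | ite b P Q, m => if b.holds m then P.exec H xs m.tick else Q.exec H xs m.tick
  | loop v n P, m => iterate (fun i s => P.exec H xs (s.setNat v 0 i).tick) (n.eval m) m.tick

/-! ### The interface between program and game

Scalars `nat 0`, `nat 1`, `nat 2` receive the round number `t`, `K` and `|H|`; scalars `nat 3` and
`real 0` receive the last arm played and its observed cost; row `0` of `real 1` is the output. -/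

/-- Start of round `t = |xs|`: the inputs are written and the clock is reset. -/
def Mem.present {X : Type*} {K : ℕ} (H : Finset (X → Fin K)) (xs : List X) (m : Mem) : Mem :=
  { (((m.setNat 0 0 xs.length).setNat 1 0 K).setNat 2 0 H.card) with clock := 0 }

/-- End of a round: the played arm and its cost are revealed. -/
noncomputable def Mem.observe {K : ℕ} (m : Mem) (k : Fin K) (v : ℝ) : Mem :=
  (m.setNat 3 0 k).setReal 0 0 0 v

/-- The law of the memory when the program has finished its computation in round `t = |xs|`,
started from the memory `m` kept from the previous rounds. -/
noncomputable def Prog.round {X : Type*} {K : ℕ} (P : Prog) (H : Finset (X → Fin K))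
    (xs : List X) (m : Mem) : PMF Mem :=
  P.exec H xs (m.present H xs)

open Classical in
/-- The distribution over the arms that the program has selected. An output which is not a
probability vector is read as the uniform distribution. -/
noncomputable def Mem.act (K : ℕ) (m : Mem) : Fin K → ℝ :=
  if (fun k : Fin K => m.real 1 0 k) ∈ stdSimplex ℝ (Fin K) then fun k => m.real 1 0 k
  else fun _ => 1 / (K : ℝ)

/-! ### Running time -/

/-- `Reach P H xs m`: after the rounds with contexts `xs`, and for some choice of the costs in
`[0,1]`, of the arms played and of the outcomes of the coins, the memory is `m`. -/
inductive Reach {X : Type*} {K : ℕ} (P : Prog) (H : Finset (X → Fin K)) : List X → Mem → Prop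
  | init : Reach P H [] Mem.empty
  | step {xs : List X} {m m' : Mem} (x : X) (k : Fin K) (v : ℝ) :
      Reach P H xs m → m' ∈ (P.round H (xs ++ [x]) m).support → v ∈ Set.Icc (0 : ℝ) 1 →
      Reach P H (xs ++ [x]) (m'.observe k v)

/-- In every round `t`, on every history, the program makes at most `B t` steps, an oracle call
being one step. -/
def RunsWithin {X : Type*} {K : ℕ} (P : Prog) (H : Finset (X → Fin K)) (B : ℕ → ℕ) : Prop :=
  ∀ (xs : List X) (m : Mem) (x : X), Reach P H xs m →
    ∀ m' ∈ (P.round H (xs ++ [x]) m).support, m'.clock ≤ B (xs.length + 1)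

/-! ### Regret -/

/-- Expectation of a real function under a discrete distribution. -/
noncomputable def expect {S : Type*} (p : PMF S) (f : S → ℝ) : ℝ := ∑' s, (p s).toReal * f s

open MeasureTheory in
/-- The value `𝔼_x sup_c 𝔼_ŷ ⋯ 𝔼_x sup_c 𝔼_ŷ [∑ ⟨q_t, c_t⟩ - inf_h ∑ c_t[h(x_t)]]` of the `n`
remaining rounds. Here `past` lists the context-cost pairs of the rounds already played, `m` is the
memory of the program, `L` the loss `∑ ⟨q_t, c_t⟩` accumulated so far, and `𝔼_ŷ` is over the
coins flipped by the program in the round and over the arm `ŷ ∼ q`. -/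
noncomputable def gameValue {X : Type*} [MeasurableSpace X] {K : ℕ} (H : Finset (X → Fin K))
    (P : Prog) (μ : Measure X) : ℕ → List (X × Cost K) → Mem → ℝ → ℝ
  | 0, past, _, L => L - erm H past
  | n + 1, past, m, L =>
      ∫ x, ⨆ c : Fin K → unitInterval,
        expect (P.round H (past.map Prod.fst ++ [x]) m) (fun m' =>
          ∑ k, m'.act K k *
            gameValue H P μ n (past ++ [(x, fun i => (c i : ℝ))]) (m'.observe k (c k))
              (L + ∑ i, m'.act K i * (c i : ℝ))) ∂μ

open MeasureTheory in
/-- The hybrid bandit minimax regret over `T` rounds. -/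
noncomputable def banditRegret {X : Type*} [MeasurableSpace X] {K : ℕ} (H : Finset (X → Fin K))
    (P : Prog) (T : ℕ) : ℝ :=
  ⨆ μ : ProbabilityMeasure X, gameValue H P (μ : Measure X) T [] Mem.empty 0

end Bandit

/-! With rounds counted from zero, the learner uses a scale `a = 2 ^ i` during phase `i`, epochs of
`a ^ 3` rounds, and the first `a ^ 5` contexts as a pool, which serves as a sample of the unknown
law. Once arm `k` was played with probability `q k`, a coin of bias `c k / (q k * M)` decides
whether its estimated cost is `M` or `0`. Hence arm `k` receives the estimate `M` with probability
`c k / M`, whatever `q` was. The bias is at most one because exploration with total probability `γ =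
K / M` gives `q k ≥ 1 / M`.

In each round the rest of the epoch is replaced by hallucinated rounds: contexts drawn from the pool
without replacement, with estimates of the all-ones cost vector. Let `d k` be the normalized
increase of the oracle value caused by a cost `M` of arm `k` on the current context. Then `d ≥ 0`
and `∑ d ≤ 1`; the missing mass is put on the first arm, giving `e ≥ d`, and `e` is mixed with
exploration. From `c ≤ 1` follows `∑ c e - ∑ c d ≤ 1 - ∑ d`: up to `γ`, the worst costs are all
ones, which is what the hallucinated rounds contain (`sum_strategy_mul_le`). So the expected oracle
value on real and hallucinated data is a potential, to which a log-exponential moment is added that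
pays for replacing true costs by estimates. It does not increase on average, except that the current
context follows the true law and the hallucinated one the unused pool (`pot_step_le`,
`sum_pot_step`). It dominates minus the best cost at the end (`neg_erm_le_pot`), and at the start of
an epoch of `n` rounds it is at most `n γ + 2 (log |H| / λ + n λ M)` (`pot_nil_le`). With `λ = γ /
M`, `γ = e / a` and `e` about `(K log |H|) ^ (1/3)`, an epoch costs `O(e a ^ 2)`, that is `O(e / a)`
per round. While `a` is too small for this choice, costs are bounded trivially.

For fixed estimates the unused pool is independent of the other data, so the deviation of its
average from the true mean is subgaussian (`sum_exp_scaled_deviation_le`). The adversary can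
correlate the estimates with the pool; a soft maximum over all `(K + 1) ^ p` sequences of estimates
handles this and costs `2 √(log (K + 1)) / a` per round (`sum_excess_le`, `sum_charge_le`). Since
`a` is of order `s ^ (1/5)` in round `s`, the sum of `1 / a` is `O(T ^ (4/5))`.

This is carried out on a finite context space. In general a context matters only through the vector
of values of the policies on it (`gameValue_map`, `erm_evaluations`). The program is tied to the
analysis by `expect_round_le`, proved with a weakest-precondition calculus. -/

namespace Bandit

/-! ### Expectations under finitely supported distributions -/

section Expect

variable {S S' : Type*}

theorem expect_eq_sum {p : PMF S} (hp : p.support.Finite) (f : S → ℝ) :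
    expect p f = ∑ s ∈ hp.toFinset, (p s).toReal * f s := by
  unfold expect
  refine tsum_eq_sum fun s hs => ?_
  have : p s = 0 := by simpa [PMF.mem_support_iff] using hs
  simp [this]

theorem sum_toReal_of_subset {p : PMF S} {F : Finset S} (hF : p.support ⊆ F) :
    ∑ s ∈ F, (p s).toReal = 1 := by
  rw [← ENNReal.toReal_sum fun s _ => p.apply_ne_top s]
  have h : ∑' s, p s = ∑ s ∈ F, p s := tsum_eq_sum fun s hs => by
    by_contra h
    exact hs (hF ((PMF.mem_support_iff _ _).2 h))
  rw [← h, p.tsum_coe]; rfl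

theorem expect_eq_sum_of_subset {p : PMF S} {F : Finset S} (hF : p.support ⊆ F) (f : S → ℝ) :
    expect p f = ∑ s ∈ F, (p s).toReal * f s := by
  unfold expect
  refine tsum_eq_sum fun s hs => ?_
  have : p s = 0 := by
    by_contra h
    exact hs (hF ((PMF.mem_support_iff _ _).2 h))
  simp [this]

theorem expect_pure (s : S) (f : S → ℝ) : expect (PMF.pure s) f = f s := by
  rw [expect_eq_sum_of_subset (F := {s}) (by simp [PMF.support_pure])]
  simp

theorem expect_mono {p : PMF S} (hp : p.support.Finite) {f g : S → ℝ}
    (h : ∀ s ∈ p.support, f s ≤ g s) : expect p f ≤ expect p g := by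
  rw [expect_eq_sum hp, expect_eq_sum hp]
  refine Finset.sum_le_sum fun s hs => mul_le_mul_of_nonneg_left (h s ?_) ENNReal.toReal_nonneg
  simpa using hs

theorem expect_const {p : PMF S} (hp : p.support.Finite) (c : ℝ) : expect p (fun _ => c) = c := by
  rw [expect_eq_sum hp, ← Finset.sum_mul, sum_toReal_of_subset (by simp), one_mul]

theorem expect_le {p : PMF S} (hp : p.support.Finite) {f : S → ℝ} {c : ℝ}
    (h : ∀ s ∈ p.support, f s ≤ c) : expect p f ≤ c :=
  (expect_mono hp h).trans_eq (expect_const hp c)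

theorem support_bind_finite {p : PMF S} {k : S → PMF S'} (hp : p.support.Finite)
    (hk : ∀ s, (k s).support.Finite) : (p.bind k).support.Finite := by
  rw [PMF.support_bind]
  exact hp.biUnion fun s _ => hk s

theorem expect_bind {p : PMF S} {k : S → PMF S'} (hp : p.support.Finite)
    (hk : ∀ s, (k s).support.Finite) (f : S' → ℝ) :
    expect (p.bind k) f = expect p fun s => expect (k s) f := by
  have hb := support_bind_finite hp hk
  rw [expect_eq_sum hb, expect_eq_sum hp]
  have h1 : ∀ s ∈ hp.toFinset, (p s).toReal * expect (k s) f
      = ∑ u ∈ hb.toFinset, (p s).toReal * ((k s u).toReal * f u) := by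
    intro s hs
    rw [expect_eq_sum_of_subset (F := hb.toFinset), Finset.mul_sum]
    intro u hu
    simp only [Set.Finite.coe_toFinset, PMF.support_bind, Set.mem_iUnion]
    exact ⟨s, by simpa using hs, hu⟩
  rw [Finset.sum_congr rfl h1, Finset.sum_comm]
  refine Finset.sum_congr rfl fun u _ => ?_
  rw [PMF.bind_apply, tsum_eq_sum (s := hp.toFinset), ENNReal.toReal_sum, Finset.sum_mul]
  · exact Finset.sum_congr rfl fun s _ => by rw [ENNReal.toReal_mul, mul_assoc]
  · exact fun s _ => ENNReal.mul_ne_top (p.apply_ne_top s) ((k s).apply_ne_top u)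
  · intro s hs
    have : p s = 0 := by simpa [PMF.mem_support_iff] using hs
    simp [this]

theorem expect_coin {p : ℝ} (h0 : 0 ≤ p) (h1 : p ≤ 1) (f : Bool → ℝ) :
    expect (coin p) f = p * f true + (1 - p) * f false := by
  rw [expect_eq_sum_of_subset (F := Finset.univ) fun b _ => Finset.mem_coe.2 (Finset.mem_univ b)]
  have e : max 0 (min 1 p) = p := by rw [min_eq_right h1, max_eq_right h0]
  simp [coin, e, ENNReal.toReal_ofReal h0, ENNReal.toReal_ofReal (sub_nonneg.2 h1)]

end Expect

/-! ### Weakest-precondition calculus for programs -/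

section Calculus

variable {X : Type*} {K : ℕ} (H : Finset (X → Fin K)) (xs : List X)

theorem iterate_support_finite {S : Type*} {f : ℕ → S → PMF S}
    (hf : ∀ i s, (f i s).support.Finite) (n : ℕ) (s : S) : (iterate f n s).support.Finite := by
  induction n with
  | zero => simp [iterate]
  | succ n ih => exact support_bind_finite ih fun s => hf n s

theorem exec_support_finite (P : Prog) (m : Mem) : (P.exec H xs m).support.Finite := by
  induction P generalizing m with
  | skip => simp [Prog.exec]
  | setNat => simp [Prog.exec]
  | setReal => simp [Prog.exec]
  | ask => simp [Prog.exec]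
  | flip a i p => exact support_bind_finite (Set.toFinite _) fun b => by simp
  | seq P Q hP hQ => exact support_bind_finite (hP m) hQ
  | ite b P Q hP hQ =>
    rw [Prog.exec]; split_ifs
    · exact hP _
    · exact hQ _
  | loop v n P hP => exact iterate_support_finite (fun i s => hP _) _ _

/-- Expected value of `f` in the memory after running `P` from `m`. -/
noncomputable def wp (P : Prog) (f : Mem → ℝ) (m : Mem) : ℝ := expect (P.exec H xs m) f

/-- Every possible memory after running `P` from `m` satisfies `Q`. -/
def Always (P : Prog) (m : Mem) (Q : Mem → Prop) : Prop := ∀ m' ∈ (P.exec H xs m).support, Q m'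

variable {H xs}

theorem wp_mono {P : Prog} {f g : Mem → ℝ} {m : Mem} {Q : Mem → Prop} (hQ : Always H xs P m Q)
    (h : ∀ m', Q m' → f m' ≤ g m') : wp H xs P f m ≤ wp H xs P g m :=
  expect_mono (exec_support_finite H xs P m) fun s hs => h s (hQ s hs)

theorem wp_le_of_always {P : Prog} {f : Mem → ℝ} {m : Mem} {Q : Mem → Prop} {c : ℝ}
    (hQ : Always H xs P m Q) (h : ∀ m', Q m' → f m' ≤ c) : wp H xs P f m ≤ c :=
  expect_le (exec_support_finite H xs P m) fun s hs => h s (hQ s hs)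

theorem wp_seq (P Q : Prog) (f : Mem → ℝ) (m : Mem) :
    wp H xs (.seq P Q) f m = wp H xs P (wp H xs Q f) m :=
  expect_bind (exec_support_finite H xs P m) (exec_support_finite H xs Q) f

theorem wp_skip (f : Mem → ℝ) (m : Mem) : wp H xs .skip f m = f m := expect_pure _ _

theorem wp_setNat (a : ℕ) (i e : NExp) (f : Mem → ℝ) (m : Mem) :
    wp H xs (.setNat a i e) f m = f (m.setNat a (i.eval m) (e.eval m)).tick := expect_pure _ _

theorem wp_flip {a : ℕ} {i : NExp} {p : RExp} {f : Mem → ℝ} {m : Mem} (h0 : 0 ≤ p.eval m)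
    (h1 : p.eval m ≤ 1) : wp H xs (.flip a i p) f m =
      p.eval m * f (m.setNat a (i.eval m) 1).tick
        + (1 - p.eval m) * f (m.setNat a (i.eval m) 0).tick := by
  unfold wp
  rw [Prog.exec, expect_bind (Set.toFinite _) (fun b => by simp), expect_coin h0 h1]
  simp [expect_pure]

theorem wp_ite_pos {b : Test} {P Q : Prog} {f : Mem → ℝ} {m : Mem} (hb : b.holds m) :
    wp H xs (.ite b P Q) f m = wp H xs P f m.tick := by
  unfold wp; rw [Prog.exec, if_pos hb]

theorem wp_ite_neg {b : Test} {P Q : Prog} {f : Mem → ℝ} {m : Mem} (hb : ¬ b.holds m) :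
    wp H xs (.ite b P Q) f m = wp H xs Q f m.tick := by
  unfold wp; rw [Prog.exec, if_neg hb]

/-- A supermartingale argument: the one-step inequality for `F` is needed only in states satisfying
the invariant, and every reachable state does. -/
theorem expect_iterate_le {S : Type*} {f : ℕ → S → PMF S} (hf : ∀ i s, (f i s).support.Finite)
    {I : ℕ → S → Prop} {F : ℕ → S → ℝ} (n : ℕ) (s : S) (h0 : I 0 s)
    (hI : ∀ i < n, ∀ s, I i s → ∀ s' ∈ (f i s).support, I (i + 1) s')
    (hF : ∀ i < n, ∀ s, I i s → expect (f i s) (F (i + 1)) ≤ F i s) :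
    (∀ s' ∈ (iterate f n s).support, I n s') ∧ expect (iterate f n s) (F n) ≤ F 0 s := by
  induction n with
  | zero => simp [iterate, expect_pure, h0]
  | succ n ih =>
    have ih := ih (fun i hi => hI i (by omega)) (fun i hi => hF i (by omega))
    have hfin := iterate_support_finite hf n s
    refine ⟨fun s' hs' => ?_, ?_⟩
    · rw [iterate, PMF.support_bind] at hs'
      obtain ⟨u, hu, hs'⟩ := Set.mem_iUnion₂.1 hs'
      exact hI n (by omega) u (ih.1 u hu) s' hs'
    · rw [iterate, expect_bind hfin (hf n)]
      exact (expect_mono hfin fun u hu => hF n (by omega) u (ih.1 u hu)).trans ih.2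

theorem wp_loop_le {v : ℕ} {n : NExp} {P : Prog} {m : Mem} {I : ℕ → Mem → Prop}
    {F : ℕ → Mem → ℝ} {N : ℕ} (hN : n.eval m = N) (h0 : I 0 m.tick)
    (hI : ∀ i < N, ∀ s, I i s → Always H xs P (s.setNat v 0 i).tick (I (i + 1)))
    (hF : ∀ i < N, ∀ s, I i s → wp H xs P (F (i + 1)) (s.setNat v 0 i).tick ≤ F i s) :
    wp H xs (.loop v n P) (F N) m ≤ F 0 m.tick := by
  subst hN
  exact (expect_iterate_le (fun i s => exec_support_finite H xs _ _) _ m.tick h0 hI hF).2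

theorem Always.loop {v : ℕ} {n : NExp} {P : Prog} {m : Mem} (I : ℕ → Mem → Prop) {N : ℕ}
    (hN : n.eval m = N) (h0 : I 0 m.tick)
    (hI : ∀ i < N, ∀ s, I i s → Always H xs P (s.setNat v 0 i).tick (I (i + 1))) :
    Always H xs (.loop v n P) m (I N) := by
  subst hN
  exact (expect_iterate_le (F := fun _ _ => 0) (fun i s => exec_support_finite H xs _ _) _
    m.tick h0 hI fun i hi s hs => (expect_const (exec_support_finite H xs _ _) _).le).1

theorem Always.mono {P : Prog} {m : Mem} {Q Q' : Mem → Prop} (h : Always H xs P m Q)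
    (hQ : ∀ m', Q m' → Q' m') : Always H xs P m Q' := fun m' hm => hQ m' (h m' hm)

theorem Always.and {P : Prog} {m : Mem} {Q Q' : Mem → Prop} (h : Always H xs P m Q)
    (h' : Always H xs P m Q') : Always H xs P m fun m' => Q m' ∧ Q' m' :=
  fun m' hm => ⟨h m' hm, h' m' hm⟩

theorem Always.seq {P P' : Prog} {m : Mem} {Q R : Mem → Prop} (h : Always H xs P m Q)
    (h' : ∀ m', Q m' → Always H xs P' m' R) : Always H xs (.seq P P') m R := by
  intro m' hm
  rw [Prog.exec, PMF.support_bind] at hm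
  obtain ⟨u, hu, hm⟩ := Set.mem_iUnion₂.1 hm
  exact h' u (h u hu) m' hm

theorem always_seq {P P' : Prog} {m : Mem} {R : Mem → Prop} :
    Always H xs (.seq P P') m R ↔ Always H xs P m fun m' => Always H xs P' m' R := by
  refine ⟨fun h u hu m' hm => h m' ?_, fun h => h.seq fun _ => id⟩
  rw [Prog.exec, PMF.support_bind]
  exact Set.mem_iUnion₂.2 ⟨u, hu, hm⟩

theorem always_skip {m : Mem} {Q : Mem → Prop} : Always H xs .skip m Q ↔ Q m := by
  simp [Always, Prog.exec]

theorem always_setNat {a : ℕ} {i e : NExp} {m : Mem} {Q : Mem → Prop} :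
    Always H xs (.setNat a i e) m Q ↔ Q (m.setNat a (i.eval m) (e.eval m)).tick := by
  simp [Always, Prog.exec]

theorem always_setReal {a : ℕ} {i j : NExp} {e : RExp} {m : Mem} {Q : Mem → Prop} :
    Always H xs (.setReal a i j e) m Q
      ↔ Q (m.setReal a (i.eval m) (j.eval m) (e.eval m)).tick := by
  simp [Always, Prog.exec]

theorem always_ask {a : ℕ} {i j len : NExp} {hs cs : ℕ} {m : Mem} {Q : Mem → Prop} :
    Always H xs (.ask a i j len hs cs) m Q ↔
      Q (m.setReal a (i.eval m) (j.eval m) (erm H (m.query K xs (len.eval m) hs cs))).tick := by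
  simp [Always, Prog.exec]

theorem always_flip {a : ℕ} {i : NExp} {p : RExp} {m : Mem} {Q : Mem → Prop}
    (h : ∀ b, Q (m.setNat a (i.eval m) b).tick) : Always H xs (.flip a i p) m Q := by
  intro m' hm
  rw [Prog.exec, PMF.support_bind] at hm
  obtain ⟨u, -, hm⟩ := Set.mem_iUnion₂.1 hm
  rw [PMF.support_pure, Set.mem_singleton_iff] at hm
  exact hm ▸ h _

theorem always_ite {b : Test} {P Q : Prog} {m : Mem} {R : Mem → Prop} :
    Always H xs (.ite b P Q) m R ↔ (b.holds m → Always H xs P m.tick R) ∧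
      (¬ b.holds m → Always H xs Q m.tick R) := by
  by_cases hb : b.holds m <;> simp [Always, Prog.exec, hb]

/-! ### Frames and running time -/

/-- The arrays of natural numbers that a program may write. -/
def Prog.natWrites : Prog → Finset ℕ
  | skip => ∅
  | setNat a _ _ => {a}
  | setReal _ _ _ _ => ∅
  | flip a _ _ => {a}
  | ask _ _ _ _ _ _ => ∅
  | seq P Q => P.natWrites ∪ Q.natWrites
  | ite _ P Q => P.natWrites ∪ Q.natWrites
  | loop v _ P => insert v P.natWrites

/-- The arrays of reals that a program may write. -/
def Prog.realWrites : Prog → Finset ℕ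
  | skip => ∅
  | setNat _ _ _ => ∅
  | setReal a _ _ _ => {a}
  | flip _ _ _ => ∅
  | ask a _ _ _ _ _ => {a}
  | seq P Q => P.realWrites ∪ Q.realWrites
  | ite _ P Q => P.realWrites ∪ Q.realWrites
  | loop _ _ P => P.realWrites

/-- The memories `m`, `m'` agree except on the listed arrays. -/
def Frame (A B : Finset ℕ) (m m' : Mem) : Prop :=
  (∀ a ∉ A, m'.nat a = m.nat a) ∧ ∀ b ∉ B, m'.real b = m.real b

theorem Frame.trans {A B : Finset ℕ} {m m' m'' : Mem} (h : Frame A B m m')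
    (h' : Frame A B m' m'') : Frame A B m m'' :=
  ⟨fun a ha => (h'.1 a ha).trans (h.1 a ha), fun b hb => (h'.2 b hb).trans (h.2 b hb)⟩

theorem Frame.mono {A B A' B' : Finset ℕ} {m m' : Mem} (h : Frame A B m m') (hA : A ⊆ A')
    (hB : B ⊆ B') : Frame A' B' m m' :=
  ⟨fun a ha => h.1 a fun h => ha (hA h), fun b hb => h.2 b fun h => hb (hB h)⟩

theorem Frame.refl {A B : Finset ℕ} (m : Mem) : Frame A B m m := ⟨fun _ _ => rfl, fun _ _ => rfl⟩

theorem Frame.tick {A B : Finset ℕ} (m : Mem) : Frame A B m m.tick :=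
  ⟨fun _ _ => rfl, fun _ _ => rfl⟩

theorem Frame.setNat {A B : Finset ℕ} {m : Mem} {a i v : ℕ} (ha : a ∈ A) :
    Frame A B m (m.setNat a i v).tick := by
  refine ⟨fun b hb => ?_, fun _ _ => rfl⟩
  have : b ≠ a := fun h => hb (h ▸ ha)
  funext k; simp [Mem.setNat, Mem.tick, this]

theorem Frame.setReal {A B : Finset ℕ} {m : Mem} {a i j : ℕ} {v : ℝ} (ha : a ∈ B) :
    Frame A B m (m.setReal a i j v).tick := by
  refine ⟨fun _ _ => rfl, fun b hb => ?_⟩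
  have : b ≠ a := fun h => hb (h ▸ ha)
  funext k l; simp [Mem.setReal, Mem.tick, this]

/-- Carries values past code that does not touch them. The written arrays are computed from the
syntax, so the side conditions are decidable. -/
theorem always_frame (P : Prog) (m : Mem) :
    Always H xs P m (Frame P.natWrites P.realWrites m) := by
  induction P generalizing m with
  | skip => exact always_skip.2 (.refl _)
  | setNat => exact always_setNat.2 (.setNat (by simp [Prog.natWrites]))
  | setReal => exact always_setReal.2 (.setReal (by simp [Prog.realWrites]))
  | ask => exact always_ask.2 (.setReal (by simp [Prog.realWrites]))
  | flip => exact always_flip fun b => .setNat (by simp [Prog.natWrites])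
  | seq P Q hP hQ =>
    exact (hP m).seq fun m' h => (hQ m').mono fun m'' h' =>
      (h.mono Finset.subset_union_left Finset.subset_union_left).trans
        (h'.mono Finset.subset_union_right Finset.subset_union_right)
  | ite b P Q hP hQ =>
    refine always_ite.2 ⟨fun _ => (hP _).mono fun m' h => ?_, fun _ => (hQ _).mono fun m' h => ?_⟩
    · exact (Frame.tick m).trans (h.mono Finset.subset_union_left Finset.subset_union_left)
    · exact (Frame.tick m).trans (h.mono Finset.subset_union_right Finset.subset_union_right)
  | loop v n P hP =>
    refine Always.loop (fun _ => Frame _ _ m) rfl (.tick m) fun i _ s hs => ?_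
    exact (hP _).mono fun m' h => (hs.trans (Frame.setNat (by simp [Prog.natWrites]))).trans
      (h.mono (Finset.subset_insert _ _) subset_rfl)

/-- The arrays that an index expression reads. -/
def NExp.reads : NExp → Finset ℕ
  | const _ => ∅
  | cell a i => insert a i.reads
  | add e f => e.reads ∪ f.reads
  | sub e f => e.reads ∪ f.reads

theorem NExp.eval_congr {m m' : Mem} (e : NExp) (h : ∀ a ∈ e.reads, m'.nat a = m.nat a) :
    e.eval m' = e.eval m := by
  induction e with
  | const => rfl
  | cell a i ih =>
    simp only [reads, Finset.mem_insert, forall_eq_or_imp] at h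
    simp [eval, h.1, ih h.2]
  | add e f he hf | sub e f he hf =>
    simp only [reads, Finset.mem_union] at h
    simp [eval, he fun a ha => h a (.inl ha), hf fun a ha => h a (.inr ha)]

/-- The loop bounds occurring in a program. -/
def Prog.loopBounds : Prog → List NExp
  | seq P Q => P.loopBounds ++ Q.loopBounds
  | ite _ P Q => P.loopBounds ++ Q.loopBounds
  | loop _ n P => n :: P.loopBounds
  | _ => []

/-- The number of steps of a program, as a polynomial in a common bound for its loops. -/
noncomputable def Prog.timePoly : Prog → Polynomial ℕ
  | skip => 0
  | seq P Q => P.timePoly + Q.timePoly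
  | ite _ P Q => 1 + (P.timePoly + Q.timePoly)
  | loop _ _ P => 1 + .X * (1 + P.timePoly)
  | _ => 1

/-- Loop bounds are evaluated at different times. Bounding them in the initial memory suffices
because the arrays they read are never written by `P`, so they keep their values. -/
theorem always_clock (P : Prog) (B : ℕ) (A : Finset ℕ) (m : Mem)
    (hA : ∀ e ∈ P.loopBounds, e.reads ⊆ A) (hw : Disjoint A P.natWrites)
    (hB : ∀ e ∈ P.loopBounds, e.eval m ≤ B) :
    Always H xs P m fun m' => m'.clock ≤ m.clock + P.timePoly.eval B := by
  induction P generalizing m with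
  | skip => exact always_skip.2 (by simp)
  | setNat => exact always_setNat.2 (by simp [Prog.timePoly, Mem.tick, Mem.setNat])
  | setReal => exact always_setReal.2 (by simp [Prog.timePoly, Mem.tick, Mem.setReal])
  | ask => exact always_ask.2 (by simp [Prog.timePoly, Mem.tick, Mem.setReal])
  | flip => exact always_flip fun b => by simp [Prog.timePoly, Mem.tick, Mem.setNat]
  | seq P Q hP hQ =>
    simp only [Prog.loopBounds, List.mem_append, or_imp, forall_and] at hA hB
    simp only [Prog.natWrites, Finset.disjoint_union_right] at hw
    refine ((hP m hA.1 hw.1 hB.1).and (always_frame P m)).seq fun m' h => ?_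
    refine (hQ m' hA.2 hw.2 fun e he => ?_).mono fun m'' h' => ?_
    · rw [e.eval_congr fun a ha => h.2.1 a fun h =>
        Finset.disjoint_left.1 hw.1 (hA.2 e he ha) h]
      exact hB.2 e he
    · simp only [Prog.timePoly, Polynomial.eval_add]; have := h.1; omega
  | ite b P Q hP hQ =>
    simp only [Prog.loopBounds, List.mem_append, or_imp, forall_and] at hA hB
    simp only [Prog.natWrites, Finset.disjoint_union_right] at hw
    refine always_ite.2 ⟨fun _ => (hP _ hA.1 hw.1 fun e he => ?_).mono fun m' h => ?_,
      fun _ => (hQ _ hA.2 hw.2 fun e he => ?_).mono fun m' h => ?_⟩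
    · exact (e.eval_congr (m := m) (m' := m.tick) fun _ _ => rfl).trans_le (hB.1 e he)
    · simp only [Prog.timePoly, Polynomial.eval_add, Polynomial.eval_one, Mem.tick] at h ⊢; omega
    · exact (e.eval_congr (m := m) (m' := m.tick) fun _ _ => rfl).trans_le (hB.2 e he)
    · simp only [Prog.timePoly, Polynomial.eval_add, Polynomial.eval_one, Mem.tick] at h ⊢; omega
  | loop v n P hP =>
    simp only [Prog.loopBounds, List.mem_cons, forall_eq_or_imp] at hA hB
    simp only [Prog.natWrites, Finset.disjoint_insert_right] at hw
    refine (Always.loop (fun i s => s.clock ≤ m.clock + 1 + i * (1 + P.timePoly.eval B) ∧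
      ∀ a ∈ A, s.nat a = m.nat a) rfl ⟨by simp [Mem.tick], fun _ _ => rfl⟩
      fun i hi s hs => ?_).mono fun m' h => ?_
    · have hs' : ∀ a ∈ A, (s.setNat v 0 i).tick.nat a = m.nat a := fun a ha =>
        ((Frame.setNat (B := ∅) (Finset.mem_singleton_self v)).1 a
          (by simp; rintro rfl; exact hw.1 ha)).trans (hs.2 a ha)
      refine ((hP _ hA.2 hw.2 fun e he => ?_).and (always_frame P _)).mono fun m' h => ⟨?_, ?_⟩
      · exact (e.eval_congr fun a ha => hs' a (hA.2 e he ha)).trans_le (hB.2 e he)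
      · have h1 := h.1
        have h2 := hs.1
        simp only [Mem.tick, Mem.setNat] at h1
        rw [add_mul, one_mul]; omega
      · exact fun a ha => (h.2.1 a fun h => Finset.disjoint_left.1 hw.2 ha h).trans (hs' a ha)
    · have h1 := h.1
      have h2 := Nat.mul_le_mul_right (1 + P.timePoly.eval B) hB.1
      simp only [Prog.timePoly, Polynomial.eval_add, Polynomial.eval_one, Polynomial.eval_mul,
        Polynomial.eval_X]
      omega

end Calculus

-- Evaluation rules for expressions and memories.

attribute [simp] NExp.eval RExp.eval Test.holds

@[simp] theorem Mem.tick_nat (m : Mem) : m.tick.nat = m.nat := rfl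
@[simp] theorem Mem.tick_real (m : Mem) : m.tick.real = m.real := rfl
@[simp] theorem Mem.setNat_real (m : Mem) (a i v : ℕ) : (m.setNat a i v).real = m.real := rfl
@[simp] theorem Mem.setReal_nat (m : Mem) (a i j : ℕ) (v : ℝ) :
    (m.setReal a i j v).nat = m.nat := rfl
@[simp] theorem Mem.setNat_nat (m : Mem) (a i v b k : ℕ) :
    (m.setNat a i v).nat b k = if b = a ∧ k = i then v else m.nat b k := rfl
@[simp] theorem Mem.setReal_real (m : Mem) (a i j : ℕ) (v : ℝ) (b k l : ℕ) :
    (m.setReal a i j v).real b k l = if b = a ∧ k = i ∧ l = j then v else m.real b k l := rfl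

/-! ### The program -/

/-- A scalar variable. -/
def nv (a : ℕ) : NExp := .cell a (.const 0)

@[simp] theorem nv_eval (m : Mem) (a : ℕ) : (nv a).eval m = m.nat a 0 := rfl

/-- Twice an index expression. -/
def dbl (e : NExp) : NExp := .add e e

@[simp] theorem dbl_eval (m : Mem) (e : NExp) : (dbl e).eval m = 2 * e.eval m := by
  simp [dbl, two_mul]

/-- Assignment to a scalar variable. -/
def assign (a : ℕ) (e : NExp) : Prog := .setNat a (.const 0) e

/-- Computes the scale `2 ^ i` of the round (cell `4`), the epoch length `8 ^ i` (cell `5`), the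
pool size `32 ^ i` (cell `6`) and the position in the epoch (cell `7`). -/
def schedule : Prog :=
  .seq (assign 4 (.const 1)) <| .seq (assign 5 (.const 1)) <| .seq (assign 6 (.const 1)) <|
  .seq (.loop 11 (nv 0) <|
    -- With `t = s + 1` the test says `32 * pool ≤ s`, so the exponent stops at the base-`32`
    -- logarithm of `s`.
    .ite (.ltNat (dbl (dbl (dbl (dbl (dbl (nv 6)))))) (nv 0))
      (.seq (assign 4 (dbl (nv 4))) <| .seq (assign 5 (dbl (dbl (dbl (nv 5))))) <|
        assign 6 (dbl (dbl (dbl (dbl (dbl (nv 6)))))))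
      .skip) <|
  .seq (assign 7 (.sub (nv 0) (.const 1))) <|
  -- The remainder of `s` modulo the epoch length, by repeated subtraction.
  .loop 11 (nv 0) <| .ite (.ltNat (nv 7) (nv 5)) .skip (assign 7 (.sub (nv 7) (nv 5)))

/-- Computes the exploration parameter (cell `10`) and the scale of the estimates
(real cell `2`). -/
def exploration : Prog :=
  .seq (assign 8 (.const 0)) <| .seq (assign 9 (.const 1)) <|
  -- Binary logarithm of `|H|`, rounded up but capped at the epoch length: the cap keeps the running
  -- time independent of `|H|`.
  .seq (.loop 11 (nv 5) <|
    .ite (.ltNat (nv 9) (nv 2))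
      (.seq (assign 9 (dbl (nv 9))) (assign 8 (.add (nv 8) (.const 1)))) .skip) <|
  .seq (assign 10 (.const 1)) <|
  -- At most `scale - 1` increments starting from `1`, so that the exploration probability is at
  -- most one.
  .seq (.loop 11 (.sub (nv 4) (.const 1)) <|
    .ite (.ltReal (.mul (.cast (nv 10)) (.mul (.cast (nv 10)) (.cast (nv 10))))
        (.mul (.cast (nv 1)) (.cast (nv 8))))
      (assign 10 (.add (nv 10) (.const 1))) .skip) <|
  .setReal 2 (.const 0) (.const 0)
    (.div (.mul (.cast (nv 1)) (.cast (nv 4))) (.cast (nv 10)))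

/-- The scale of the estimates. -/
def scaleExp : RExp := .cell 2 (.const 0) (.const 0)

/-- Flips the coin that turns the last observation into an estimate, and stores it in the row of
the last round. -/
def resolve : Prog :=
  .seq (.flip 15 (.const 0) (.mul (.cell 0 (.const 0) (.const 0)) (.cell 6 (.const 0) (nv 3)))) <|
  -- The last round has number `t - 2` counted from zero. At position `0` truncated subtraction
  -- makes this write to row `0`, which is overwritten before the oracle is called.
  .seq (.setNat 20 (.sub (nv 7) (.const 1)) (.sub (nv 0) (.const 2))) <|
  .ite (.ltNat (.const 0) (nv 15))
    (.setNat 21 (.sub (nv 7) (.const 1)) (.add (nv 3) (.const 1)))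
    (.setNat 21 (.sub (nv 7) (.const 1)) (.const 0))

/-- Cell `14` receives a uniformly random member of the pool without a current mark. -/
def pickContext : Prog :=
  .seq (assign 13 (.const 0)) <| .seq (assign 14 (.const 0)) <|
  .loop 12 (nv 6) <|
    -- A mark is the number of the round in which it was set, so old marks expire without being
    -- erased.
    .ite (.ltNat (.cell 22 (nv 12)) (nv 0))
      (.seq (assign 13 (.add (nv 13) (.const 1))) <|
        -- Reservoir sampling: the `j`-th admissible member replaces the current choice with
        -- probability `1 / j`.
        .seq (.flip 15 (.const 0) (.div (.cast (.const 1)) (.cast (nv 13)))) <|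
        .ite (.ltNat (.const 0) (nv 15)) (assign 14 (nv 12)) .skip)
      .skip

/-- Cell `16` receives the number of an arm plus one, or zero. -/
def pickArm : Prog :=
  .seq (assign 16 (.const 0)) <|
  .loop 12 (nv 1) <|
    -- Reservoir sampling in which "no arm" starts with weight `M - K`; in the end each arm has
    -- probability `1 / M`.
    .seq (.flip 15 (.const 0) (.div (.cast (.const 1))
      (.add (.sub scaleExp (.cast (nv 1))) (.cast (.add (nv 12) (.const 1)))))) <|
    .ite (.ltNat (.const 0) (nv 15)) (assign 16 (.add (nv 12) (.const 1))) .skip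

/-- One hallucinated round. -/
def hallucinate : Prog :=
  .seq pickContext <| .seq (.setNat 22 (nv 14) (nv 0)) <|
  .seq (.setNat 20 (.add (nv 7) (nv 11)) (nv 14)) <|
  .seq pickArm <| .setNat 21 (.add (nv 7) (nv 11)) (nv 16)

/-- The number of hallucinated rounds. -/
def restExp : NExp := .sub (.sub (nv 5) (.const 1)) (nv 7)

/-- All hallucinated rounds. -/
def sample : Prog := .loop 11 restExp hallucinate

/-- Writes the cost rows of the query. -/
def fill : Prog :=
  -- The last row is the current context with zero estimate.
  .seq (.setNat 20 (.sub (nv 5) (.const 1)) (.sub (nv 0) (.const 1))) <|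
  .seq (.setNat 21 (.sub (nv 5) (.const 1)) (.const 0)) <|
  .loop 11 (nv 5) <| .loop 12 (nv 1) <|
    .ite (.ltNat (.cell 21 (nv 11)) (.add (nv 12) (.const 1)))
      (.setReal 3 (nv 11) (nv 12) (.cast (.const 0)))
      (.ite (.ltNat (.add (nv 12) (.const 1)) (.cell 21 (nv 11)))
        (.setReal 3 (nv 11) (nv 12) (.cast (.const 0)))
        (.setReal 3 (nv 11) (nv 12) scaleExp))

/-- The oracle calls: row `0` of array `4` at `0` is the base value, row `1` at `k` the value with
an additional cost of arm `k` on the current context. -/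
def calls : Prog :=
  .seq (.ask 4 (.const 0) (.const 0) (nv 5) 20 3) <|
  .loop 11 (nv 1) <|
    .seq (.setReal 3 (.sub (nv 5) (.const 1)) (nv 11) scaleExp) <|
    .seq (.ask 4 (.const 1) (nv 11) (nv 5) 20 3) <|
    .setReal 3 (.sub (nv 5) (.const 1)) (nv 11) (.cast (.const 0))

/-- The normalized oracle difference of arm `cell 11`. -/
def diffExp : RExp :=
  .div (.sub (.cell 4 (.const 1) (nv 11)) (.cell 4 (.const 0) (.const 0))) scaleExp

/-- The probability of not exploring. -/
def exploitExp : RExp := .sub (.cast (.const 1)) (.div (.cast (nv 10)) (.cast (nv 4)))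

/-- Computes the output distribution and the coefficients of the next estimate. -/
def output : Prog :=
  .seq (.setReal 5 (.const 0) (.const 0) (.cast (.const 0))) <|
  .seq (.loop 11 (nv 1) <|
    .setReal 5 (.const 0) (.const 0) (.add (.cell 5 (.const 0) (.const 0)) diffExp)) <|
  .seq (.loop 11 (nv 1) <| .setReal 1 (.const 0) (nv 11)
    (.add (.mul exploitExp diffExp) (.div (.cast (.const 1)) scaleExp))) <|
  -- The mass missing from the oracle differences goes to the first arm.
  .seq (.setReal 1 (.const 0) (.const 0) (.add (.cell 1 (.const 0) (.const 0))
    (.mul exploitExp (.sub (.cast (.const 1)) (.cell 5 (.const 0) (.const 0)))))) <|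
  .loop 11 (nv 1) <| .setReal 6 (.const 0) (nv 11)
    (.div (.cast (.const 1)) (.mul (.cell 1 (.const 0) (nv 11)) scaleExp))

/-- The learner. -/
def learner : Prog :=
  .seq schedule <| .seq exploration <| .seq resolve <| .seq sample <|
  .seq fill <| .seq calls output

/-! ### Parameters of a round -/

/-- The exponent of the scale in round `s`. -/
def phase (s : ℕ) : ℕ := Nat.log 32 s

/-- The scale in round `s`. -/
def scale (s : ℕ) : ℕ := 2 ^ phase s

/-- The epoch length in round `s`. -/
def len (s : ℕ) : ℕ := 8 ^ phase s

/-- The pool size in round `s`. -/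
def pool (s : ℕ) : ℕ := 32 ^ phase s

/-- The position of round `s` in its epoch. -/
def pos (s : ℕ) : ℕ := s % len s

theorem len_pos (s : ℕ) : 0 < len s := by unfold len; positivity

theorem pos_lt (s : ℕ) : pos s < len s := Nat.mod_lt _ (len_pos s)

theorem scale_pos (s : ℕ) : 0 < scale s := by unfold scale; positivity

theorem scale_le_len (s : ℕ) : scale s ≤ len s := Nat.pow_le_pow_left (by norm_num) _

theorem len_le_pool (s : ℕ) : len s ≤ pool s := Nat.pow_le_pow_left (by norm_num) _

theorem pool_le (s : ℕ) : pool s ≤ s + 1 := by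
  unfold pool phase
  rcases Nat.eq_zero_or_pos s with rfl | h
  · simp
  · exact (Nat.pow_log_le_self 32 h.ne').trans (Nat.le_succ s)

/-- `j` steps of the search for the least `g ≥ 1` with `B ≤ g ^ 3`. -/
def cubeRoot (B : ℕ) : ℕ → ℕ
  | 0 => 1
  | j + 1 => if cubeRoot B j ^ 3 < B then cubeRoot B j + 1 else cubeRoot B j

/-- The exploration probability in round `s` is this number divided by the scale. -/
def explore (K c s : ℕ) : ℕ := cubeRoot (K * min (len s) (Nat.clog 2 c)) (scale s - 1)

/-- The scale of the estimates in round `s`. -/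
noncomputable def mag (K c s : ℕ) : ℝ := K * scale s / explore K c s

variable {X : Type*} {K : ℕ} {H : Finset (X → Fin K)} {xs : List X}

theorem always_schedule (m : Mem) (s : ℕ) (h : m.nat 0 0 = s + 1) :
    Always H xs schedule m fun m' => m'.nat 4 0 = scale s ∧ m'.nat 5 0 = len s ∧
      m'.nat 6 0 = pool s ∧ m'.nat 7 0 = pos s := by
  unfold schedule assign
  simp only [always_seq, always_setNat]
  refine (Always.loop (fun j m' => m'.nat 0 0 = s + 1 ∧ m'.nat 4 0 = 2 ^ min j (phase s) ∧
    m'.nat 5 0 = 8 ^ min j (phase s) ∧ m'.nat 6 0 = 32 ^ min j (phase s)) (N := s + 1)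
    (by simp [h]) (by simp [h]) ?_).mono ?_
  · intro j hj m' hm
    refine always_ite.2 ⟨fun hb => ?_, fun hb => ?_⟩
    · simp [hm] at hb
      have hjp : j < phase s := by
        by_contra hjp
        have := Nat.lt_pow_succ_log_self (b := 32) (by norm_num) s
        rw [min_eq_right (by omega), phase] at hb
        rw [pow_succ] at this
        omega
      simp only [always_seq, always_setNat]
      simp [hm, min_eq_left hjp.le, min_eq_left (Nat.succ_le_of_lt hjp), pow_succ]
      omega
    · simp [hm] at hb
      have hjp : phase s ≤ j := by
        by_contra hjp
        have hs : s ≠ 0 := by rintro rfl; simp [phase] at hjp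
        have h1 := Nat.pow_log_le_self 32 hs
        have h2 : 32 ^ (j + 1) ≤ 32 ^ phase s := Nat.pow_le_pow_right (by norm_num) (by omega)
        rw [min_eq_left (by omega)] at hb
        rw [pow_succ] at h2
        unfold phase at h2
        omega
      rw [always_skip]
      simp [hm, min_eq_right hjp, min_eq_right (hjp.trans (Nat.le_succ j))]
  · intro m' hm
    have hp : phase s ≤ s + 1 := (Nat.log_le_self _ _).trans (Nat.le_succ s)
    rw [min_eq_right hp] at hm
    refine (Always.loop (fun j u => (u.nat 0 0 = s + 1 ∧ u.nat 4 0 = scale s ∧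
      u.nat 5 0 = len s ∧ u.nat 6 0 = pool s) ∧ u.nat 7 0 % len s = s % len s ∧
      (u.nat 7 0 < len s ∨ u.nat 7 0 + j ≤ s)) (N := s + 1) ?_ ?_ ?_).mono ?_
    · simp [hm]
    · simp [hm, scale, len, pool]
    · intro j hj u hu
      have := len_pos s
      refine always_ite.2 ⟨fun hb => ?_, fun hb => ?_⟩
      · simp [hu] at hb
        rw [always_skip]
        simp [hu, hb]
      · simp [hu] at hb
        simp only [always_setNat]
        simp [hu, ← Nat.mod_eq_sub_mod hb]
        omega
    · rintro u ⟨⟨-, h1, h2, h3⟩, h4, h5⟩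
      refine ⟨h1, h2, h3, ?_⟩
      rw [pos, ← h4, Nat.mod_eq_of_lt (by omega)]

theorem always_exploration (m : Mem) (s c : ℕ) (h1 : m.nat 1 0 = K) (h2 : m.nat 2 0 = c)
    (h4 : m.nat 4 0 = scale s) (h5 : m.nat 5 0 = len s) :
    Always H xs exploration m fun m' => m'.nat 10 0 = explore K c s ∧
      m'.real 2 0 0 = mag K c s := by
  unfold exploration assign
  simp only [always_seq, always_setNat]
  refine (Always.loop (fun j m' => (m'.nat 1 0 = K ∧ m'.nat 2 0 = c ∧ m'.nat 4 0 = scale s) ∧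
    m'.nat 8 0 = min j (Nat.clog 2 c) ∧ m'.nat 9 0 = 2 ^ min j (Nat.clog 2 c)) (N := len s)
    (by simp [h5]) (by simp [h1, h2, h4]) ?_).mono ?_
  · intro j hj m' hm
    have key : 2 ^ min j (Nat.clog 2 c) < c ↔ j < Nat.clog 2 c := by
      rw [← Nat.lt_clog_iff_pow_lt (by norm_num)]; omega
    refine always_ite.2 ⟨fun hb => ?_, fun hb => ?_⟩
    · simp only [Test.holds, nv_eval, Mem.tick_nat, Mem.setNat_nat] at hb
      simp [hm, key] at hb
      simp only [always_seq, always_setNat]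
      simp [hm, min_eq_left hb.le, min_eq_left (Nat.succ_le_of_lt hb), pow_succ, mul_comm]
    · simp only [Test.holds, nv_eval, Mem.tick_nat, Mem.setNat_nat] at hb
      simp [hm, key] at hb
      rw [always_skip]
      simp [hm, min_eq_right hb, min_eq_right (hb.trans (Nat.le_succ j))]
  · intro m' hm
    refine (Always.loop (fun j u => (u.nat 1 0 = K ∧ u.nat 4 0 = scale s ∧
      u.nat 8 0 = min (len s) (Nat.clog 2 c)) ∧
      u.nat 10 0 = cubeRoot (K * min (len s) (Nat.clog 2 c)) j) (N := scale s - 1)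
      ?_ ?_ ?_).mono ?_
    · simp [hm]
    · simp [hm, cubeRoot]
    · intro j hj u hu
      have key : ((u.nat 10 0 : ℝ) * (u.nat 10 0 * u.nat 10 0) < u.nat 1 0 * u.nat 8 0) ↔
          cubeRoot (K * min (len s) (Nat.clog 2 c)) j ^ 3 < K * min (len s) (Nat.clog 2 c) := by
        rw [hu.1.1, hu.1.2.2, hu.2]
        norm_cast
        rw [pow_succ', sq]
      refine always_ite.2 ⟨fun hb => ?_, fun hb => ?_⟩
      · simp at hb
        rw [key] at hb
        simp only [always_setNat]
        simp [hu, cubeRoot, hb]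
      · simp at hb
        rw [← not_lt, key] at hb
        rw [always_skip]
        simp [hu, cubeRoot, hb]
    · intro u hu
      rw [always_setReal]
      simp [hu, explore, mag]

/-! ### Running time -/

/-- Section by section: the loop bounds of each section read only inputs or cells fixed by earlier
sections, and all are at most `s + 1 + K`. -/
theorem always_learner_clock (m : Mem) (s : ℕ) (h0 : m.nat 0 0 = s + 1) (h1 : m.nat 1 0 = K) :
    Always H xs learner m fun m' =>
      m'.clock ≤ m.clock + learner.timePoly.eval (s + 1 + K) := by
  have b1 := pool_le s
  have b2 := len_le_pool s
  have b3 := scale_le_len s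
  unfold learner
  refine (((always_schedule m s h0).and (always_frame _ m)).and
    (always_clock _ (s + 1 + K) {0} m (by decide) (by decide) ?_)).seq ?_
  · simp [schedule, assign, Prog.loopBounds, h0]
  rintro m1 ⟨⟨⟨a4, a5, a6, a7⟩, f1⟩, c1⟩
  have k1 : m1.nat 1 0 = K := by rw [f1.1 1 (by decide), h1]
  refine ((always_frame _ m1).and
    (always_clock _ (s + 1 + K) {4, 5} m1 (by decide) (by decide) ?_)).seq ?_
  · simp [exploration, assign, Prog.loopBounds, a4, a5]; omega
  rintro m2 ⟨f2, c2⟩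
  refine (((always_frame _ m2)).and
    (always_clock _ (s + 1 + K) ∅ m2 (by decide) (by decide) ?_)).seq ?_
  · simp [resolve, Prog.loopBounds]
  rintro m3 ⟨f3, c3⟩
  have e : ∀ a ∈ ({1, 5, 6, 7} : Finset ℕ), m3.nat a = m1.nat a := fun a ha => by
    rw [f3.1 a (by revert a; decide), f2.1 a (by revert a; decide)]
  have e1 : m3.nat 1 0 = K := by rw [e 1 (by decide), k1]
  have e5 : m3.nat 5 0 = len s := by rw [e 5 (by decide), a5]
  have e6 : m3.nat 6 0 = pool s := by rw [e 6 (by decide), a6]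
  refine (((always_frame _ m3)).and
    (always_clock _ (s + 1 + K) {1, 5, 6, 7} m3 (by decide) (by decide) ?_)).seq ?_
  · simp [sample, hallucinate, pickContext, pickArm, assign, restExp, Prog.loopBounds, e1, e5, e6]
    omega
  rintro m4 ⟨f4, c4⟩
  refine (((always_frame _ m4)).and
    (always_clock _ (s + 1 + K) {1, 5} m4 (by decide) (by decide) ?_)).seq ?_
  · simp [fill, Prog.loopBounds, f4.1 1 (by decide), f4.1 5 (by decide), e1, e5]
    omega
  rintro m5 ⟨f5, c5⟩
  refine (((always_frame _ m5)).and
    (always_clock _ (s + 1 + K) {1, 5} m5 (by decide) (by decide) ?_)).seq ?_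
  · simp [calls, Prog.loopBounds, f5.1 1 (by decide), f4.1 1 (by decide), e1]
  rintro m6 ⟨f6, c6⟩
  refine (always_clock _ (s + 1 + K) {1, 5} m6 (by decide) (by decide) ?_).mono ?_
  · simp [output, Prog.loopBounds, f6.1 1 (by decide), f5.1 1 (by decide), f4.1 1 (by decide), e1]
  intro m7 c7
  simp only [Prog.timePoly, Polynomial.eval_add]
  omega

theorem learner_runsWithin (H : Finset (X → Fin K)) :
    RunsWithin learner H fun t => learner.timePoly.eval (t + K) := by
  intro xs m x _ m' hm
  have := always_learner_clock (H := H) (xs := xs ++ [x]) (m.present H (xs ++ [x])) xs.length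
    (by simp [Mem.present]) (by simp [Mem.present]) m' hm
  simpa [Mem.present] using this

/-! ### Estimates, hallucinated rounds and the strategy -/

section Strategy

variable {X : Type*} {K : ℕ}

/-- The cost vector with entry `M` at one arm, if any, and `0` elsewhere. -/
noncomputable def vec (M : ℝ) (o : Option (Fin K)) : Cost K := fun k => if o = some k then M else 0

/-- The context-cost pairs encoded by estimates and numbers of contexts. -/
noncomputable def look (M : ℝ) (xs : List X) (l : List (Option (Fin K) × ℕ)) :
    List (X × Cost K) :=
  l.filterMap fun p => (xs[p.2]?).map fun x => (x, vec M p.1)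

/-- Expectation over the estimate of the cost vector `c`: arm `k` with probability `c k / M`. -/
noncomputable def avgArm (M : ℝ) (c : Cost K) (F : Option (Fin K) → ℝ) : ℝ :=
  ∑ k, c k / M * F (some k) + (1 - ∑ k, c k / M) * F none

/-- The members of the pool which do not occur in a list of hallucinated rounds. -/
def free (N : ℕ) (l : List (Option (Fin K) × ℕ)) : Finset ℕ :=
  (Finset.range N).filter fun i => i ∉ l.map Prod.snd

/-- Expectation over `r` more hallucinated rounds. -/
noncomputable def hallu (M : ℝ) (N : ℕ) :
    ℕ → List (Option (Fin K) × ℕ) → (List (Option (Fin K) × ℕ) → ℝ) → ℝ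
  | 0, l, F => F l
  | r + 1, l, F =>
    (∑ i ∈ free N l, avgArm M (fun _ => 1) fun z => hallu M N r (l ++ [(z, i)]) F) /
      (free N l).card

/-- Normalized increase of the oracle value caused by a cost of arm `k` on the context `x`. -/
noncomputable def diff (H : Finset (X → Fin K)) (M : ℝ) (D : List (X × Cost K)) (x : X)
    (k : Fin K) : ℝ := (erm H (D ++ [(x, vec M (some k))]) - erm H D) / M

/-- The distribution played on the context `x` when the data are `D`. -/
noncomputable def strategy (H : Finset (X → Fin K)) (M γ : ℝ) (D : List (X × Cost K)) (x : X)
    (k : Fin K) : ℝ :=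
  (1 - γ) * (diff H M D x k + if (k : ℕ) = 0 then 1 - ∑ j, diff H M D x j else 0) + 1 / M

/-- The estimate stored as a natural number. -/
def decode (K z : ℕ) : Option (Fin K) :=
  if h : 0 < z ∧ z - 1 < K then some ⟨z - 1, h.2⟩ else none

@[simp] theorem decode_zero : decode K 0 = none := by simp [decode]

@[simp] theorem decode_succ (k : Fin K) : decode K (k + 1) = some k := by simp [decode]

/-- `r` rows of the memory, from row `b` on. -/
def rows (K : ℕ) (m : Mem) (b r : ℕ) : List (Option (Fin K) × ℕ) :=
  (List.range' b r).map fun i => (decode K (m.nat 21 i), m.nat 20 i)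

@[simp] theorem rows_zero (m : Mem) (b : ℕ) : rows K m b 0 = [] := rfl

theorem rows_succ (m : Mem) (b r : ℕ) :
    rows K m b (r + 1) = rows K m b r ++ [(decode K (m.nat 21 (b + r)), m.nat 20 (b + r))] := by
  simp [rows, List.range'_1_concat]

theorem rows_add (m : Mem) (b r r' : ℕ) :
    rows K m b (r + r') = rows K m b r ++ rows K m (b + r) r' := by
  simp [rows, ← List.range'_append_1]

theorem rows_congr {m m' : Mem} {b r : ℕ} (h : ∀ i, b ≤ i → i < b + r →
    m'.nat 20 i = m.nat 20 i ∧ m'.nat 21 i = m.nat 21 i) : rows K m' b r = rows K m b r := by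
  refine List.map_congr_left fun i hi => ?_
  have := List.mem_range'_1.1 hi
  obtain ⟨h1, h2⟩ := h i this.1 this.2
  rw [h1, h2]

@[simp] theorem rows_length (m : Mem) (b r : ℕ) : (rows K m b r).length = r := by simp [rows]

end Strategy

/-! ### Correctness of the random parts of the program -/

section RandomParts

variable {X : Type*} {K : ℕ} {H : Finset (X → Fin K)} {xs : List X}

theorem wp_resolve_le {m : Mem} {f : Mem → ℝ} {π A B : ℝ}
    (hπ : m.real 0 0 0 * m.real 6 0 (m.nat 3 0) = π) (h0 : 0 ≤ π) (h1 : π ≤ 1)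
    (h : ∀ m', Frame {15, 20, 21} ∅ m m' →
      (∀ i, m'.nat 20 i = if i = m.nat 7 0 - 1 then m.nat 0 0 - 2 else m.nat 20 i) →
      ((∀ i, m'.nat 21 i = if i = m.nat 7 0 - 1 then m.nat 3 0 + 1 else m.nat 21 i) → f m' ≤ A) ∧
      ((∀ i, m'.nat 21 i = if i = m.nat 7 0 - 1 then 0 else m.nat 21 i) → f m' ≤ B)) :
    wp H xs resolve f m ≤ π * A + (1 - π) * B := by
  have e : (RExp.mul (.cell 0 (.const 0) (.const 0)) (.cell 6 (.const 0) (nv 3))).eval m = π := by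
    simpa using hπ
  rw [resolve, wp_seq, wp_flip (by rwa [e]) (by rwa [e]), e]
  refine add_le_add (mul_le_mul_of_nonneg_left ?_ h0)
    (mul_le_mul_of_nonneg_left ?_ (sub_nonneg.2 h1))
  · rw [wp_seq, wp_setNat, wp_ite_pos (by simp), wp_setNat]
    refine (h _ ⟨fun a ha => ?_, fun b _ => by simp⟩ fun i => ?_).1 fun i => ?_
    · simp at ha; funext i; simp [ha]
    · simp
    · simp
  · rw [wp_seq, wp_setNat, wp_ite_neg (by simp), wp_setNat]
    refine (h _ ⟨fun a ha => ?_, fun b _ => by simp⟩ fun i => ?_).2 fun i => ?_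
    · simp at ha; funext i; simp [ha]
    · simp
    · simp

theorem wp_pickContext_le {m : Mem} {f : Mem → ℝ} {G : ℕ → ℝ} {A : Finset ℕ} {t N : ℕ}
    (ht : m.nat 0 0 = t) (hN : m.nat 6 0 = N)
    (hA : A = (Finset.range N).filter fun i => m.nat 22 i < t) (hne : A.Nonempty)
    (h : ∀ m' w, Frame {12, 13, 14, 15} ∅ m m' → m'.nat 14 0 = w → f m' ≤ G w) :
    wp H xs pickContext f m ≤ (∑ i ∈ A, G i) / A.card := by
  have hcard : (0 : ℝ) < A.card := by exact_mod_cast hne.card_pos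
  -- The conditional mean of `G` at the final choice: the current choice carries the weight of all
  -- admissible members already seen, each later one has weight one.
  set F : ℕ → Mem → ℝ := fun i u =>
    (u.nat 13 0 * G (u.nat 14 0) + ∑ j ∈ A.filter (i ≤ ·), G j) / A.card with hF
  set I : ℕ → Mem → Prop := fun i u => Frame {12, 13, 14, 15} ∅ m u ∧
    u.nat 13 0 = (A.filter (· < i)).card with hI
  have hstep : ∀ i < N, i ∈ A → (A.filter (· < i + 1)).card = (A.filter (· < i)).card + 1 ∧
      ∑ j ∈ A.filter (i ≤ ·), G j = G i + ∑ j ∈ A.filter (i + 1 ≤ ·), G j := by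
    intro i _ hi
    constructor
    · have : A.filter (· < i + 1) = insert i (A.filter (· < i)) := by
        ext j; simp; constructor
        · rintro ⟨h1, h2⟩; by_cases h : j = i
          · exact .inl h
          · exact .inr ⟨h1, by omega⟩
        · rintro (rfl | ⟨h1, h2⟩)
          · exact ⟨hi, le_rfl⟩
          · exact ⟨h1, h2.le⟩
      rw [this, Finset.card_insert_of_notMem (by simp)]
    · have : A.filter (i ≤ ·) = insert i (A.filter (i + 1 ≤ ·)) := by
        ext j; simp; constructor
        · rintro ⟨h1, h2⟩; by_cases h : j = i
          · exact .inl h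
          · exact .inr ⟨h1, by omega⟩
        · rintro (rfl | ⟨h1, h2⟩)
          · exact ⟨hi, le_rfl⟩
          · exact ⟨h1, by omega⟩
      rw [this, Finset.sum_insert (by simp)]
  have hskip : ∀ i, i ∉ A → A.filter (· < i + 1) = A.filter (· < i) ∧
      A.filter (i ≤ ·) = A.filter (i + 1 ≤ ·) := by
    intro i hi
    constructor <;> refine Finset.filter_congr fun j hj => ?_ <;>
      have : j ≠ i := (fun h => hi (h ▸ hj)) <;> omega
  have hmem : ∀ i < N, i ∈ A ↔ m.nat 22 i < t := by
    intro i hi; subst hA; simp [hi]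
  have hcell : ∀ u, Frame {12, 13, 14, 15} ∅ m u → u.nat 22 = m.nat 22 ∧ u.nat 0 0 = t := by
    intro u hu
    exact ⟨hu.1 22 (by decide), by rw [hu.1 0 (by decide), ht]⟩
  have fr : ∀ {u : Mem} {a i v : ℕ}, Frame {12, 13, 14, 15} ∅ m u →
      a ∈ ({12, 13, 14, 15} : Finset ℕ) → Frame {12, 13, 14, 15} ∅ m (u.setNat a i v).tick :=
    fun hu ha => hu.trans (Frame.setNat ha)
  have hIstep : ∀ i < N, ∀ u, I i u → Always H xs (.ite (.ltNat (.cell 22 (nv 12)) (nv 0))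
      (.seq (assign 13 (.add (nv 13) (.const 1))) <|
        .seq (.flip 15 (.const 0) (.div (.cast (.const 1)) (.cast (nv 13)))) <|
        .ite (.ltNat (.const 0) (nv 15)) (assign 14 (nv 12)) .skip)
      .skip) (u.setNat 12 0 i).tick (I (i + 1)) := by
    rintro i hi u ⟨hu, hc⟩
    obtain ⟨h22, h00⟩ := hcell u hu
    refine always_ite.2 ⟨fun hb => ?_, fun hb => ?_⟩
    · have hiA : i ∈ A := by rw [hmem i hi]; simpa [h22, h00] using hb
      rw [assign, always_seq, always_setNat, always_seq]
      refine always_flip fun b => always_ite.2 ⟨fun _ => ?_, fun _ => ?_⟩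
      · rw [assign, always_setNat]
        refine ⟨fr (Frame.trans (fr (fr (Frame.trans (fr hu (by decide)) (.tick _)) (by decide))
          (by decide)) (.tick _)) (by decide), ?_⟩
        rw [(hstep i hi hiA).1]; simp [hc]
      · rw [always_skip]
        refine ⟨Frame.trans (fr (fr (Frame.trans (fr hu (by decide)) (.tick _)) (by decide))
          (by decide)) (.tick _), ?_⟩
        rw [(hstep i hi hiA).1]; simp [hc]
    · have hiA : i ∉ A := by rw [hmem i hi]; simpa [h22, h00] using hb
      rw [always_skip]
      refine ⟨Frame.trans (fr hu (by decide)) (.tick _), ?_⟩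
      rw [(hskip i hiA).1]; simp [hc]
  have hFstep : ∀ i < N, ∀ u, I i u → wp H xs (.ite (.ltNat (.cell 22 (nv 12)) (nv 0))
      (.seq (assign 13 (.add (nv 13) (.const 1))) <|
        .seq (.flip 15 (.const 0) (.div (.cast (.const 1)) (.cast (nv 13)))) <|
        .ite (.ltNat (.const 0) (nv 15)) (assign 14 (nv 12)) .skip)
      .skip) (F (i + 1)) (u.setNat 12 0 i).tick ≤ F i u := by
    rintro i hi u ⟨hu, hc⟩
    obtain ⟨h22, h00⟩ := hcell u hu
    by_cases hiA : i ∈ A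
    · have hb := (hmem i hi).1 hiA
      rw [wp_ite_pos (by simpa [h22, h00] using hb), wp_seq, assign, wp_setNat, wp_seq, wp_flip]
      · rw [wp_ite_pos (by simp), wp_ite_neg (by simp), assign, wp_setNat, wp_skip]
        have hpos : (0 : ℝ) < (u.nat 13 0 : ℝ) + 1 := by positivity
        simp only [hF, (hstep i hi hiA).2]
        simp
        field_simp
        ring_nf
        rfl
      · simp; positivity
      · simp
        refine inv_le_one_of_one_le₀ ?_
        have : (0 : ℝ) ≤ u.nat 13 0 := by positivity
        linarith
    · have hb := fun h => hiA ((hmem i hi).2 h)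
      rw [wp_ite_neg (by simpa [h22, h00] using hb), wp_skip]
      simp [hF, (hskip i hiA).2]
  rw [pickContext, wp_seq, assign, wp_setNat, wp_seq, assign, wp_setNat]
  set m0 := ((m.setNat 13 ((NExp.const 0).eval m) ((NExp.const 0).eval m)).tick.setNat 14
    ((NExp.const 0).eval (m.setNat 13 ((NExp.const 0).eval m) ((NExp.const 0).eval m)).tick)
    ((NExp.const 0).eval (m.setNat 13 ((NExp.const 0).eval m)
      ((NExp.const 0).eval m)).tick)).tick with hm0
  have hf0 : Frame {12, 13, 14, 15} ∅ m m0 := fr (fr (.refl m) (by decide)) (by decide)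
  have hI0 : I 0 m0.tick := ⟨hf0.trans (.tick _), by simp [hm0]⟩
  have hNe : (nv 6).eval m0 = N := by simp [hm0, hN]
  refine (wp_mono (Always.loop I hNe hI0 hIstep) (g := F N) ?_).trans
    ((wp_loop_le hNe hI0 hIstep hFstep).trans (le_of_eq ?_))
  · rintro u ⟨hu, hc⟩
    have e1 : A.filter (· < N) = A := Finset.filter_true_of_mem fun j hj => by
      subst hA; simp at hj; exact hj.1
    have e2 : A.filter (N ≤ ·) = ∅ := Finset.filter_false_of_mem fun j hj => by
      subst hA; simp at hj; omega
    refine (h u _ hu rfl).trans (le_of_eq ?_)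
    rw [hF]; simp only [e2, hc, e1]
    field_simp; simp
  · simp [hF, hm0]

theorem avgArm_one (M : ℝ) (F : Option (Fin K) → ℝ) :
    avgArm M (fun _ => 1) F = ((M - K) * F none + ∑ k, F (some k)) / M + (1 - M / M) * F none := by
  simp [avgArm, ← Finset.mul_sum]; ring

theorem wp_pickArm_le {m : Mem} {f : Mem → ℝ} {G : ℕ → ℝ} {M : ℝ} (hK : m.nat 1 0 = K)
    (hM : m.real 2 0 0 = M) (hKM : K ≤ M) (hM0 : 0 < M)
    (h : ∀ m' z, Frame {12, 15, 16} ∅ m m' → m'.nat 16 0 = z → f m' ≤ G z) :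
    wp H xs pickArm f m ≤
      avgArm M (fun _ => 1) fun o : Option (Fin K) => G (o.elim 0 fun k => k + 1) := by
  -- As for contexts, but the current choice carries the additional weight `M - K` of "no arm".
  set F : ℕ → Mem → ℝ := fun i u =>
    ((M - K + i) * G (u.nat 16 0) + ∑ j ∈ Finset.Ico i K, G (j + 1)) / M with hF
  set I : ℕ → Mem → Prop := fun _ u => Frame {12, 15, 16} ∅ m u with hI
  have fr : ∀ {u : Mem} {a i v : ℕ}, Frame {12, 15, 16} ∅ m u →
      a ∈ ({12, 15, 16} : Finset ℕ) → Frame {12, 15, 16} ∅ m (u.setNat a i v).tick :=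
    fun hu ha => hu.trans (Frame.setNat ha)
  rw [pickArm, wp_seq, assign, wp_setNat]
  set m0 := (m.setNat 16 ((NExp.const 0).eval m) ((NExp.const 0).eval m)).tick with hm0
  set body : Prog := .seq (.flip 15 (.const 0) (.div (.cast (.const 1))
      (.add (.sub scaleExp (.cast (nv 1))) (.cast (.add (nv 12) (.const 1)))))) <|
    .ite (.ltNat (.const 0) (nv 15)) (assign 16 (.add (nv 12) (.const 1))) .skip with hbody
  have hf0 : Frame {12, 15, 16} ∅ m m0 := fr (.refl m) (by decide)
  have hI0 : I 0 m0.tick := hf0.trans (.tick _)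
  have hIstep : ∀ i < K, ∀ u, I i u → Always H xs body (u.setNat 12 0 i).tick (I (i + 1)) :=
    fun i _ u hu => (always_frame _ _).mono fun u' hu' =>
      (fr hu (by decide)).trans (hu'.mono (by decide) (by decide))
  have hFstep : ∀ i < K, ∀ u, I i u → wp H xs body (F (i + 1)) (u.setNat 12 0 i).tick ≤ F i u := by
    intro i hi u hu
    have h1 : u.nat 1 0 = K := by rw [hu.1 1 (by decide), hK]
    have h2 : u.real 2 0 0 = M := by rw [hu.2 2 (by simp), hM]
    have hpos : (1 : ℝ) ≤ M - K + (i + 1) := by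
      have : (0 : ℝ) ≤ i := by positivity
      linarith
    have hp0 : (0 : ℝ) < M - K + (i + 1) := by linarith
    have e : (RExp.div (.cast (.const 1)) (.add (.sub scaleExp (.cast (nv 1)))
        (.cast (.add (nv 12) (.const 1))))).eval (u.setNat 12 0 i).tick
        = 1 / (M - K + (i + 1)) := by
      simp [scaleExp, h1, h2]
    rw [hbody, wp_seq, wp_flip, e]
    · rw [wp_ite_pos (by simp), wp_ite_neg (by simp), assign, wp_setNat, wp_skip]
      simp only [hF, Finset.sum_eq_sum_Ico_succ_bot hi]
      simp
      field_simp
      ring_nf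
      rfl
    · rw [e]; positivity
    · rw [e, div_le_one hp0]; exact hpos
  have hNe : (nv 1).eval m0 = K := by simp [hm0, hK]
  refine (wp_mono (Always.loop I hNe hI0 hIstep) (g := F K) ?_).trans
    ((wp_loop_le hNe hI0 hIstep hFstep).trans (le_of_eq ?_))
  · intro u hu
    refine (h u _ hu rfl).trans (le_of_eq ?_)
    simp [hF]; field_simp
  · rw [avgArm_one, div_self hM0.ne']
    simp [hF, hm0, Finset.sum_range, add_comm]

/-- The invariant of the hallucination loop that started in `m`. -/
def HalluInv (K : ℕ) (m : Mem) (t p j : ℕ) (u : Mem) : Prop :=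
  Frame {11, 12, 13, 14, 15, 16, 20, 21, 22} ∅ m u ∧
  (∀ i < p, u.nat 20 i = m.nat 20 i ∧ u.nat 21 i = m.nat 21 i) ∧
  (∀ i, u.nat 22 i ≤ t) ∧ ∀ i, u.nat 22 i = t ↔ i ∈ (rows K u p j).map Prod.snd

theorem rows_extend {u w : Mem} {p j : ℕ} {z i : ℕ}
    (h20 : ∀ b, w.nat 20 b = if b = p + j then i else u.nat 20 b)
    (h21 : ∀ b, w.nat 21 b = if b = p + j then z else u.nat 21 b) :
    rows K w p (j + 1) = rows K u p j ++ [(decode K z, i)] := by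
  rw [rows_succ, h20, h21, if_pos rfl, if_pos rfl]
  congr 1
  refine rows_congr fun b _ hb => ?_
  rw [h20, h21, if_neg hb.ne, if_neg hb.ne]; exact ⟨rfl, rfl⟩

theorem always_hallucinate {m u : Mem} {t p j : ℕ} (ht : m.nat 0 0 = t) (hp : m.nat 7 0 = p)
    (hu : HalluInv K m t p j u) :
    Always H xs hallucinate (u.setNat 11 0 j).tick (HalluInv K m t p (j + 1)) := by
  obtain ⟨hf, hpre, hle, hmark⟩ := hu
  rw [hallucinate, always_seq]
  refine (always_frame _ _).mono fun u1 f1 => ?_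
  replace f1 : Frame {12, 13, 14, 15} ∅ (u.setNat 11 0 j).tick u1 :=
    f1.mono (by decide) (by decide)
  rw [always_seq, always_setNat, always_seq, always_setNat, always_seq]
  refine (always_frame _ _).mono fun u2 f2 => ?_
  replace f2 := f2.mono (A' := {12, 15, 16}) (B' := ∅) (by decide) (by decide)
  rw [always_setNat]
  have c7 : u1.nat 7 0 = p := by
    rw [f1.1 7 (by decide)]; simp [hf.1 7 (by decide), hp]
  have c0 : u1.nat 0 0 = t := by
    rw [f1.1 0 (by decide)]; simp [hf.1 0 (by decide), ht]
  have c11 : u1.nat 11 0 = j := by rw [f1.1 11 (by decide)]; simp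
  have d7 : u2.nat 7 0 = p := by rw [f2.1 7 (by decide)]; simp [c7]
  have d11 : u2.nat 11 0 = j := by rw [f2.1 11 (by decide)]; simp [c11]
  have d20 : ∀ b, u2.nat 20 b = if b = p + j then u1.nat 14 0 else u.nat 20 b := fun b => by
    rw [f2.1 20 (by decide)]; simp [c7, c11, f1.1 20 (by decide)]
  have d21 : u2.nat 21 = u.nat 21 := by
    rw [f2.1 21 (by decide)]; funext b; simp [f1.1 21 (by decide)]
  have d22 : ∀ b, u2.nat 22 b = if b = u1.nat 14 0 then t else u.nat 22 b := fun b => by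
    rw [f2.1 22 (by decide)]; simp [c0, f1.1 22 (by decide)]
  refine ⟨⟨fun a ha => ?_, fun b hb => ?_⟩, fun i hi => ⟨?_, ?_⟩, fun i => ?_, fun i => ?_⟩
  · simp only [Finset.mem_insert, Finset.mem_singleton, not_or] at ha
    funext b
    simp only [Mem.tick_nat, Mem.setNat_nat, ha, false_and, if_false]
    rw [f2.1 a (by simp [ha])]
    simp only [Mem.tick_nat, Mem.setNat_nat, ha, false_and, if_false]
    rw [f1.1 a (by simp [ha])]
    simp only [Mem.tick_nat, Mem.setNat_nat, ha, false_and, if_false]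
    rw [hf.1 a (by simp [ha])]
  · simp only [Mem.tick_real, Mem.setNat_real]
    rw [f2.2 b hb]; simp only [Mem.tick_real, Mem.setNat_real]
    rw [f1.2 b hb]; simp only [Mem.tick_real, Mem.setNat_real]
    exact hf.2 b hb
  · simp [d20, (hpre i hi).1]; intro h; omega
  · simp [d21, d7, d11, (hpre i hi).2]; intro h; omega
  · simp [d22]; split_ifs
    · exact le_rfl
    · exact hle i
  · rw [rows_extend (u := u) (z := u2.nat 16 0) (i := u1.nat 14 0)
      (by intro b; simp [d20]) (by intro b; simp [d21, d7, d11])]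
    simp only [Mem.tick_nat, Mem.setNat_nat, d22, List.map_append, List.mem_append, ← hmark]
    simp
    by_cases h : i = u1.nat 14 0
    · simp [h]
    · simp [h]

theorem card_free_ge (N : ℕ) (l : List (Option (Fin K) × ℕ)) :
    N - l.length ≤ (free N l).card := by
  have h1 : free N l = Finset.range N \ (l.map Prod.snd).toFinset := by
    ext i; simp [free]
  rw [h1]
  have h2 := Finset.le_card_sdiff (l.map Prod.snd).toFinset (Finset.range N)
  have h3 := List.toFinset_card_le (l.map Prod.snd)
  simp only [Finset.card_range, List.length_map] at h2 h3
  omega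

theorem wp_hallucinate_le {m u : Mem} {t p j N r : ℕ} {M : ℝ}
    {G : List (Option (Fin K) × ℕ) → ℝ} (ht : m.nat 0 0 = t) (hp : m.nat 7 0 = p)
    (hN : m.nat 6 0 = N) (hK : m.nat 1 0 = K) (hM : m.real 2 0 0 = M) (hKM : K ≤ M) (hM0 : 0 < M)
    (hjN : j < N) (hu : HalluInv K m t p j u) :
    wp H xs hallucinate (fun w => hallu M N r (rows K w p (j + 1)) G) (u.setNat 11 0 j).tick
      ≤ hallu M N (r + 1) (rows K u p j) G := by
  obtain ⟨hf, hpre, hle, hmark⟩ := hu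
  set l := rows K u p j with hl
  have hu0 : (u.setNat 11 0 j).tick.nat 0 0 = t := by simp [hf.1 0 (by decide), ht]
  have hu6 : (u.setNat 11 0 j).tick.nat 6 0 = N := by simp [hf.1 6 (by decide), hN]
  have hA : free N l = (Finset.range N).filter fun i => (u.setNat 11 0 j).tick.nat 22 i < t := by
    refine Finset.filter_congr fun i _ => ?_
    rw [← hmark]; simp [lt_iff_le_and_ne, hle i]
  have hne : (free N l).Nonempty := by
    rw [← Finset.card_pos]
    have := card_free_ge N l
    have : l.length = j := rows_length _ _ _
    omega
  rw [hallucinate, wp_seq, hallu]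
  refine wp_pickContext_le hu0 hu6 hA hne fun u1 w f1 hw => ?_
  have c7 : u1.nat 7 0 = p := by
    rw [f1.1 7 (by decide)]; simp [hf.1 7 (by decide), hp]
  have c1 : u1.nat 1 0 = K := by
    rw [f1.1 1 (by decide)]; simp [hf.1 1 (by decide), hK]
  have c11 : u1.nat 11 0 = j := by rw [f1.1 11 (by decide)]; simp
  have cM : u1.real 2 0 0 = M := by rw [f1.2 2 (by decide)]; simp [hf.2 2 (by decide), hM]
  rw [wp_seq, wp_setNat, wp_seq, wp_setNat, wp_seq]
  refine (wp_pickArm_le (G := fun z => hallu M N r (l ++ [(decode K z, w)]) G)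
    (by simp [c1]) (by simp [cM]) hKM hM0 fun u2 z f2 hz => ?_).trans (le_of_eq ?_)
  · have d7 : u2.nat 7 0 = p := by rw [f2.1 7 (by decide)]; simp [c7]
    have d11 : u2.nat 11 0 = j := by rw [f2.1 11 (by decide)]; simp [c11]
    have d20 : ∀ b, u2.nat 20 b = if b = p + j then u1.nat 14 0 else u.nat 20 b := fun b => by
      rw [f2.1 20 (by decide)]; simp [c7, c11, f1.1 20 (by decide)]
    have d21 : u2.nat 21 = u.nat 21 := by
      rw [f2.1 21 (by decide)]; funext b; simp [f1.1 21 (by decide)]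
    rw [wp_setNat]
    rw [rows_extend (u := u) (z := z) (i := w)
      (by intro b; simp [d20, hw]) (by intro b; simp [d21, d7, d11, hz])]
  · congr 1
    funext o
    cases o <;> simp

theorem wp_sample_le {m : Mem} {f : Mem → ℝ} {t p n N : ℕ} {M : ℝ}
    {G : List (Option (Fin K) × ℕ) → ℝ} (ht : m.nat 0 0 = t) (hp : m.nat 7 0 = p)
    (hn : m.nat 5 0 = n) (hN : m.nat 6 0 = N) (hK : m.nat 1 0 = K) (hM : m.real 2 0 0 = M)
    (hKM : K ≤ M) (hM0 : 0 < M) (hnN : n ≤ N) (hmark : ∀ i, m.nat 22 i < t)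
    (h : ∀ m', HalluInv K m t p (n - 1 - p) m' → f m' ≤ G (rows K m' p (n - 1 - p))) :
    wp H xs sample f m ≤ hallu M N (n - 1 - p) [] G := by
  set r := n - 1 - p with hr
  have hI0 : HalluInv K m t p 0 m.tick :=
    ⟨.tick _, fun _ _ => ⟨rfl, rfl⟩, fun i => (hmark i).le, fun i => by
      simpa using (hmark i).ne⟩
  have hNe : restExp.eval m = r := by simp [restExp, hn, hp, hr]
  have hIs : ∀ j < r, ∀ u, HalluInv K m t p j u →
      Always H xs hallucinate (u.setNat 11 0 j).tick (HalluInv K m t p (j + 1)) :=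
    fun j _ u hu => always_hallucinate ht hp hu
  refine (wp_mono (Always.loop _ hNe hI0 hIs)
    (g := (fun (j : ℕ) (u : Mem) => hallu M N (r - j) (rows K u p j) G) r) ?_).trans
    ((wp_loop_le hNe hI0 hIs (F := fun j u => hallu M N (r - j) (rows K u p j) G) ?_).trans
      (le_of_eq ?_))
  · intro u hu
    simpa [hallu] using h u hu
  · intro j hj u hu
    have e : r - j = (r - (j + 1)) + 1 := by omega
    rw [e]
    exact wp_hallucinate_le ht hp hN hK hM hKM hM0 (by omega) hu
  · simp

end RandomParts

/-! ### The oracle value -/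

section Oracle

variable {X : Type*} {K : ℕ} {H : Finset (X → Fin K)}

/-- The total cost of a policy. -/
def cost (h : X → Fin K) (D : List (X × Cost K)) : ℝ := (D.map fun d => d.2 (h d.1)).sum

@[simp] theorem cost_nil (h : X → Fin K) : cost h [] = 0 := rfl

@[simp] theorem cost_append (h : X → Fin K) (D E : List (X × Cost K)) :
    cost h (D ++ E) = cost h D + cost h E := by simp [cost]

@[simp] theorem cost_singleton (h : X → Fin K) (d : X × Cost K) : cost h [d] = d.2 (h d.1) := by
  simp [cost]

theorem erm_le {h : X → Fin K} (hh : h ∈ H) (D : List (X × Cost K)) : erm H D ≤ cost h D :=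
  ciInf_le (Set.finite_range fun h : {h // h ∈ H} => cost h.1 D).bddBelow ⟨h, hh⟩

theorem exists_erm_eq (hH : H.Nonempty) (D : List (X × Cost K)) : ∃ h ∈ H, erm H D = cost h D := by
  have : Nonempty {h // h ∈ H} := hH.to_subtype
  obtain ⟨h, hh⟩ := exists_eq_ciInf_of_finite (f := fun h : {h // h ∈ H} => cost h.1 D)
  exact ⟨h.1, h.2, hh.symm⟩

theorem le_erm (hH : H.Nonempty) {D : List (X × Cost K)} {c : ℝ} (h : ∀ h ∈ H, c ≤ cost h D) :
    c ≤ erm H D := by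
  obtain ⟨h', hh, e⟩ := exists_erm_eq hH D
  exact e ▸ h h' hh

theorem erm_congr {D E : List (X × Cost K)} (h : ∀ h ∈ H, cost h D = cost h E) :
    erm H D = erm H E := by
  unfold erm
  exact congrArg _ (funext fun g => h g.1 g.2)

@[simp] theorem erm_nil (hH : H.Nonempty) : erm H [] = 0 := by
  obtain ⟨h, -, e⟩ := exists_erm_eq hH []
  simpa using e

theorem vec_nonneg {M : ℝ} (hM : 0 ≤ M) (o : Option (Fin K)) (k : Fin K) : 0 ≤ vec M o k := by
  unfold vec; split_ifs <;> simp [hM]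

@[simp] theorem vec_none (M : ℝ) (k : Fin K) : vec M none k = 0 := by simp [vec]

theorem erm_append_none (M : ℝ) (D : List (X × Cost K)) (x : X) :
    erm H (D ++ [(x, vec M none)]) = erm H D := erm_congr fun h _ => by simp

theorem diff_nonneg (hH : H.Nonempty) {M : ℝ} (hM : 0 < M) (D : List (X × Cost K)) (x : X)
    (k : Fin K) : 0 ≤ diff H M D x k := by
  refine div_nonneg (sub_nonneg.2 (le_erm hH fun h hh => ?_)) hM.le
  rw [cost_append, cost_singleton]
  exact (erm_le hh D).trans (le_add_of_nonneg_right (vec_nonneg hM.le _ _))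

/-- A minimizer `h` for `D` is affected only by a cost of the arm `h x`. So the difference of every
other arm is at most zero, and that of `h x` is at most one. -/
theorem sum_diff_le_one (hH : H.Nonempty) {M : ℝ} (hM : 0 < M) (D : List (X × Cost K)) (x : X) :
    ∑ k, diff H M D x k ≤ 1 := by
  obtain ⟨h, hh, e⟩ := exists_erm_eq hH D
  have : ∀ k, diff H M D x k ≤ if h x = k then 1 else 0 := by
    intro k
    have h1 := erm_le hh (D ++ [(x, vec M (some k))])
    rw [cost_append, cost_singleton, ← e] at h1
    rw [diff, div_le_iff₀ hM]
    refine (sub_left_le_of_le_add h1).trans ?_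
    simp only [vec, Option.some.injEq, eq_comm]
    split_ifs <;> simp
  exact (Finset.sum_le_sum fun k _ => this k).trans (by simp)

theorem sum_ite_first {K : ℕ} (hK : 1 ≤ K) (c : ℝ) :
    ∑ k : Fin K, (if (k : ℕ) = 0 then c else 0) = c := by
  obtain ⟨n, rfl⟩ := Nat.exists_eq_add_of_le' hK
  rw [Fin.sum_univ_succ]; simp

theorem diff_le_exploit (hH : H.Nonempty) {M : ℝ} (hM : 0 < M) (D : List (X × Cost K)) (x : X)
    (k : Fin K) : diff H M D x k ≤
      diff H M D x k + if (k : ℕ) = 0 then 1 - ∑ j, diff H M D x j else 0 := by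
  have := sum_diff_le_one hH hM D x
  split_ifs <;> linarith

theorem strategy_ge (hH : H.Nonempty) {M γ : ℝ} (hM : 0 < M) (hγ : γ ≤ 1)
    (D : List (X × Cost K)) (x : X) (k : Fin K) : 1 / M ≤ strategy H M γ D x k :=
  le_add_of_nonneg_left (mul_nonneg (sub_nonneg.2 hγ)
    ((diff_nonneg hH hM D x k).trans (diff_le_exploit hH hM D x k)))

theorem strategy_mem (hK : 1 ≤ K) (hH : H.Nonempty) {M γ : ℝ} (hM : 0 < M) (hγ : γ ≤ 1)
    (hKM : K / M = γ) (D : List (X × Cost K)) (x : X) :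
    strategy H M γ D x ∈ stdSimplex ℝ (Fin K) := by
  refine ⟨fun k => (by positivity : (0 : ℝ) ≤ 1 / M).trans (strategy_ge hH hM hγ D x k), ?_⟩
  simp only [strategy, Finset.sum_add_distrib, ← Finset.mul_sum, sum_ite_first hK]
  simp
  rw [← div_eq_mul_inv, hKM]; ring

theorem look_append (M : ℝ) (xs : List X) (l l' : List (Option (Fin K) × ℕ)) :
    look M xs (l ++ l') = look M xs l ++ look M xs l' := by simp [look]

theorem look_last (M : ℝ) (xs : List X) (x : X) (l : List (Option (Fin K) × ℕ))
    (o : Option (Fin K)) :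
    look M (xs ++ [x]) (l ++ [(o, xs.length)]) = look M (xs ++ [x]) l ++ [(x, vec M o)] := by
  simp [look]

/-! ### The exploration probability and the scale of the estimates. -/

theorem one_le_cubeRoot (B j : ℕ) : 1 ≤ cubeRoot B j := by
  induction j with
  | zero => exact le_rfl
  | succ j ih => rw [cubeRoot]; split_ifs <;> omega

theorem cubeRoot_le (B j : ℕ) : cubeRoot B j ≤ j + 1 := by
  induction j with
  | zero => exact le_rfl
  | succ j ih => rw [cubeRoot]; split_ifs <;> omega

theorem one_le_explore (K c s : ℕ) : 1 ≤ explore K c s := one_le_cubeRoot _ _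

theorem explore_le (K c s : ℕ) : explore K c s ≤ scale s :=
  (cubeRoot_le _ _).trans (by have := scale_pos s; omega)

/-- The exploration probability. -/
noncomputable def rate (K c s : ℕ) : ℝ := (explore K c s : ℝ) / scale s

theorem rate_pos (K c s : ℕ) : 0 < rate K c s :=
  div_pos (by exact_mod_cast one_le_explore K c s) (by exact_mod_cast scale_pos s)

theorem rate_le_one (K c s : ℕ) : rate K c s ≤ 1 :=
  div_le_one_of_le₀ (by exact_mod_cast explore_le K c s) (by positivity)

theorem mag_eq (K c s : ℕ) : mag K c s = K / rate K c s := by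
  rw [mag, rate, div_div_eq_mul_div]

theorem mag_pos (hK : 1 ≤ K) (c s : ℕ) : 0 < mag K c s := by
  rw [mag_eq]; exact div_pos (by exact_mod_cast hK) (rate_pos _ _ _)

theorem le_mag (K c s : ℕ) : K ≤ mag K c s := by
  rw [mag_eq, le_div_iff₀ (rate_pos _ _ _)]
  exact mul_le_of_le_one_right (by positivity) (rate_le_one _ _ _)

theorem div_mag (hK : 1 ≤ K) (c s : ℕ) : K / mag K c s = rate K c s := by
  rw [mag_eq, div_div_cancel₀]
  exact_mod_cast (by omega : K ≠ 0)

end Oracle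

/-! ### Correctness of the deterministic parts of the program -/

section Deterministic

variable {X : Type*} {K : ℕ} {H : Finset (X → Fin K)} {xs : List X}

theorem vec_decode (M : ℝ) (z : ℕ) (k : Fin K) :
    vec M (decode K z) k = if z = k + 1 then M else 0 := by
  have : decode K z = some k ↔ z = k + 1 := by
    unfold decode
    split_ifs with h
    · simp [Fin.ext_iff]; omega
    · simp; have := k.2; omega
  simp [vec, this]

theorem always_fill {m : Mem} {s n : ℕ} {M : ℝ} (ht : m.nat 0 0 = s + 1) (hn : m.nat 5 0 = n)
    (hn0 : 1 ≤ n) (hK : m.nat 1 0 = K) (hM : m.real 2 0 0 = M) :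
    Always H xs fill m fun m' => rows K m' 0 n = rows K m 0 (n - 1) ++ [(none, s)] ∧
      ∀ i < n, ∀ k : Fin K, m'.real 3 i k = vec M (decode K (m'.nat 21 i)) k := by
  rw [fill, always_seq, always_setNat, always_seq, always_setNat]
  set m1 := ((m.setNat 20 (((nv 5).sub (NExp.const 1)).eval m)
    (((nv 0).sub (NExp.const 1)).eval m)).tick.setNat 21 _ _).tick with hm1
  have h20 : ∀ i, m1.nat 20 i = if i = n - 1 then s else m.nat 20 i := fun i => by
    simp [hm1, ht, hn]
  have h21 : ∀ i, m1.nat 21 i = if i = n - 1 then 0 else m.nat 21 i := fun i => by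
    simp [hm1, hn]
  have h1 : m1.nat 1 0 = K := by simp [hm1, hK]
  have h5 : m1.nat 5 0 = n := by simp [hm1, hn]
  have h2 : m1.real 2 0 0 = M := by simp [hm1, hM]
  have hrows : rows K m1 0 n = rows K m 0 (n - 1) ++ [(none, s)] := by
    obtain ⟨n', rfl⟩ := Nat.exists_eq_add_of_le' hn0
    rw [rows_extend (u := m) (p := 0) (j := n') (z := 0) (i := s)] <;> simp [h20, h21]
  clear_value m1
  refine (Always.loop (fun j u => Frame {11, 12} {3} m1 u ∧ ∀ i < j, ∀ k : Fin K,
    u.real 3 i k = vec M (decode K (m1.nat 21 i)) k) (N := n) (by simp [h5])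
    ⟨.tick _, by simp⟩ ?_).mono ?_
  · rintro j hj u ⟨fu, hu⟩
    refine (Always.loop (fun q w => Frame {11, 12} {3} m1 w ∧ w.nat 11 0 = j ∧ (∀ i < j,
      ∀ k : Fin K, w.real 3 i k = vec M (decode K (m1.nat 21 i)) k) ∧ ∀ k : Fin K, (k : ℕ) < q →
        w.real 3 j k = vec M (decode K (m1.nat 21 j)) k) (N := K) ?_ ?_ ?_).mono ?_
    · simp [fu.1 1 (by decide), h1]
    · exact ⟨(fu.trans (.setNat (by decide))).trans (.tick _), by simp, by simpa using hu,
        by simp⟩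
    · rintro q hq w ⟨fw, w11, hw, hw'⟩
      have w21 : w.nat 21 = m1.nat 21 := fw.1 21 (by decide)
      have w2 : w.real 2 0 0 = M := by rw [fw.2 2 (by decide), h2]
      have fw' := fw.trans (Frame.setNat (A := {11, 12}) (B := {3}) (m := w) (a := 12) (i := 0)
        (v := q) (by decide))
      -- The three branches differ only in the value written and in the clock.
      have post : ∀ (w' : Mem) (v : ℝ), Frame {11, 12} {3} m1 w' → w'.nat = (w.setNat 12 0 q).nat →
          w'.real = w.real → v = (if m1.nat 21 j = q + 1 then M else 0) →
          Frame {11, 12} {3} m1 (w'.setReal 3 j q v).tick ∧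
          (w'.setReal 3 j q v).tick.nat 11 0 = j ∧ (∀ i < j, ∀ k : Fin K,
            (w'.setReal 3 j q v).tick.real 3 i k = vec M (decode K (m1.nat 21 i)) k) ∧
          ∀ k : Fin K, (k : ℕ) < q + 1 →
            (w'.setReal 3 j q v).tick.real 3 j k = vec M (decode K (m1.nat 21 j)) k := by
        intro w' v f' hn' hr' hv
        refine ⟨f'.trans (.setReal (by decide)), by simp [hn', w11], fun i hi k => ?_,
          fun k hk => ?_⟩
        · simp [hr', hi.ne, hw i hi k]
        · by_cases hkq : (k : ℕ) = q
          · simp [hkq, hv, vec_decode]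
          · simp [hkq, hr', hw' k (by omega)]
      rw [always_ite]
      refine ⟨fun hb => ?_, fun hb => ?_⟩
      · simp [w11, w21] at hb
        rw [always_setReal]
        simpa [w11] using post (w.setNat 12 0 q).tick.tick 0 (fw'.trans (.tick _)) rfl rfl
          (by rw [if_neg (by omega)])
      · simp [w11, w21] at hb
        rw [always_ite]
        refine ⟨fun hb' => ?_, fun hb' => ?_⟩
        · simp [w11, w21] at hb'
          rw [always_setReal]
          simpa [w11] using post (w.setNat 12 0 q).tick.tick.tick 0
            ((fw'.trans (.tick _)).trans (.tick _)) rfl rfl (by rw [if_neg (by omega)])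
        · simp [w11, w21] at hb'
          rw [always_setReal]
          simpa [w11, scaleExp, w2] using post (w.setNat 12 0 q).tick.tick.tick M
            ((fw'.trans (.tick _)).trans (.tick _)) rfl rfl (by rw [if_pos (by omega)])
    · rintro w ⟨fw, w11, hw, hw'⟩
      refine ⟨fw, fun i hi k => ?_⟩
      rcases Nat.lt_succ_iff_lt_or_eq.1 hi with h | rfl
      · exact hw i h k
      · exact hw' k k.2
  · rintro u ⟨fu, hu⟩
    refine ⟨?_, fun i hi k => ?_⟩
    · rw [← hrows]
      exact rows_congr fun i _ _ => ⟨by rw [fu.1 20 (by decide)], by rw [fu.1 21 (by decide)]⟩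
    · rw [hu i hi k, fu.1 21 (by decide)]

theorem query_eq {m : Mem} {n : ℕ} {M : ℝ} {E : ℕ → Option (Fin K) × ℕ}
    (h20 : ∀ i < n, m.nat 20 i = (E i).2)
    (h3 : ∀ i < n, ∀ k : Fin K, m.real 3 i k = vec M (E i).1 k) :
    m.query K xs n 20 3 = look M xs ((List.range n).map E) := by
  rw [Mem.query, look, List.filterMap_map]
  refine List.filterMap_congr fun i hi => ?_
  have hi := List.mem_range.1 hi
  have e : (fun k : Fin K => m.real 3 i k) = vec M (E i).1 := funext (h3 i hi)
  simp [h20 i hi, e]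

theorem rows_zero_eq (m : Mem) (r : ℕ) :
    rows K m 0 r = (List.range r).map fun i => (decode K (m.nat 21 i), m.nat 20 i) := by
  rw [rows, List.range_eq_range']

theorem always_calls {m : Mem} {n s : ℕ} {M : ℝ} {l : List (Option (Fin K) × ℕ)}
    (hn : m.nat 5 0 = n) (hn0 : 1 ≤ n) (hK : m.nat 1 0 = K) (hM : m.real 2 0 0 = M)
    (hrows : rows K m 0 n = l ++ [(none, s)])
    (h3 : ∀ i < n, ∀ k : Fin K, m.real 3 i k = vec M (decode K (m.nat 21 i)) k) :
    Always H xs calls m fun m' => m'.real 4 0 0 = erm H (look M xs (l ++ [(none, s)])) ∧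
      ∀ k : Fin K, m'.real 4 1 k = erm H (look M xs (l ++ [(some k, s)])) := by
  obtain ⟨n, rfl⟩ := Nat.exists_eq_add_of_le' hn0
  have hs := hrows
  rw [rows_succ, List.append_singleton_inj] at hs
  obtain ⟨hl, hs⟩ := hs
  simp only [zero_add, Prod.mk.injEq] at hs
  have hbase : erm H (m.query K xs (n + 1) 20 3) = erm H (look M xs (l ++ [(none, s)])) := by
    rw [query_eq (E := fun i => (decode K (m.nat 21 i), m.nat 20 i)) (fun _ _ => rfl) h3,
      ← rows_zero_eq, hrows]
  rw [calls, always_seq, always_ask]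
  -- Every iteration restores the zero that it overwrote, so the cost rows are those of `m` at the
  -- start of each iteration.
  refine (Always.loop (fun j u => Frame {11} {3, 4} m u ∧
    (∀ i < n + 1, ∀ k : Fin K, u.real 3 i k = m.real 3 i k) ∧
    u.real 4 0 0 = erm H (look M xs (l ++ [(none, s)])) ∧
    ∀ k : Fin K, (k : ℕ) < j → u.real 4 1 k = erm H (look M xs (l ++ [(some k, s)])))
    (N := K) ?_ ?_ ?_).mono ?_
  · simp [hK]
  · exact ⟨(Frame.setReal (by decide)).trans (.tick _), by simp, by simp [hn, hbase], by simp⟩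
  · rintro j hj u ⟨fu, hu3, hu0, hu1⟩
    have c5 : u.nat 5 0 = n + 1 := by rw [fu.1 5 (by decide), hn]
    have c20 : u.nat 20 = m.nat 20 := fu.1 20 (by decide)
    have cM : u.real 2 0 0 = M := by rw [fu.2 2 (by decide), hM]
    rw [always_seq, always_setReal, always_seq, always_ask, always_setReal]
    set w := (((u.setNat 11 0 j).tick).setReal 3 (((nv 5).sub (NExp.const 1)).eval
      (u.setNat 11 0 j).tick) ((nv 11).eval (u.setNat 11 0 j).tick)
      (scaleExp.eval (u.setNat 11 0 j).tick)).tick with hw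
    have w3 : ∀ i k, w.real 3 i k = if i = n ∧ k = j then M else u.real 3 i k := fun i k => by
      simp [hw, c5, scaleExp, cM]
    have w4 : w.real 4 = u.real 4 := by funext i k; simp [hw]
    have w5 : w.nat 5 0 = n + 1 := by simp [hw, c5]
    have w11 : w.nat 11 0 = j := by simp [hw]
    have w20 : w.nat 20 = m.nat 20 := by funext i; simp [hw, c20]
    have fw : Frame {11} {3, 4} m w :=
      (fu.trans (.setNat (by decide))).trans (.setReal (by decide))
    have hq : w.query K xs (n + 1) 20 3 = look M xs (l ++ [(some ⟨j, hj⟩, s)]) := by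
      rw [query_eq (E := fun i => if i = n then (some ⟨j, hj⟩, s)
        else (decode K (m.nat 21 i), m.nat 20 i)) (M := M)]
      · congr 1
        rw [List.range_succ, List.map_append]
        congr 1
        · rw [← hl, rows_zero_eq]
          refine List.map_congr_left fun i hi => ?_
          rw [if_neg (List.mem_range.1 hi).ne]
        · simp
      · intro i hi
        rw [w20]; split_ifs with h
        · rw [h, hs.2]
        · rfl
      · intro i hi k
        rw [w3]
        by_cases h : i = n
        · subst h
          have : u.real 3 i k = 0 := by rw [hu3 i hi k, h3 i hi k, hs.1, vec_none]
          simp [vec, Fin.ext_iff, this, eq_comm]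
        · simp [h, hu3 i hi k, h3 i hi k]
    clear_value w
    refine ⟨(fw.trans (.setReal (by decide))).trans (.setReal (by decide)),
      fun i hi k => ?_, ?_, fun k hk => ?_⟩
    · by_cases h : i = n ∧ (k : ℕ) = j
      · have : m.real 3 i k = 0 := by rw [h3 i hi k, h.1, hs.1, vec_none]
        simp [w5, w11, h]; rw [← this, h.1, h.2]
      · simp [w5, w11, h, w3, hu3 i hi k]
    · simp [w4, hu0]
    · by_cases h : (k : ℕ) = j
      · have : k = ⟨j, hj⟩ := Fin.ext h
        subst this
        simp [w11, w5, hq]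
      · simp [w11, h, w4, hu1 k (by omega)]
  · rintro u ⟨-, -, h0, h1⟩
    exact ⟨h0, fun k => h1 k k.2⟩

theorem always_output {m : Mem} {M γ b : ℝ} {e : Fin K → ℝ} (hK0 : 1 ≤ K) (hK : m.nat 1 0 = K)
    (hM : m.real 2 0 0 = M) (hγ : (m.nat 10 0 : ℝ) / m.nat 4 0 = γ) (hb : m.real 4 0 0 = b)
    (he : ∀ k : Fin K, m.real 4 1 k = e k) :
    Always H xs output m fun m' => ∀ k : Fin K, m'.real 1 0 k = (1 - γ) * ((e k - b) / M +
        if (k : ℕ) = 0 then 1 - ∑ j, (e j - b) / M else 0) + 1 / M ∧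
      m'.real 6 0 k = 1 / (m'.real 1 0 k * M) := by
  set d : ℕ → ℝ := fun k => (m.real 4 1 k - b) / M with hd
  have hsum : ∑ j : Fin K, (e j - b) / M = ∑ j ∈ Finset.range K, d j := by
    rw [Finset.sum_range]; exact Finset.sum_congr rfl fun j _ => by rw [hd, ← he]
  have fr : ∀ {u : Mem}, Frame {11} {1, 5, 6} m u → u.nat 1 0 = K ∧ u.real 2 0 0 = M ∧
      u.real 4 = m.real 4 ∧ (u.nat 10 0 : ℝ) / u.nat 4 0 = γ := fun {u} fu => by
    rw [fu.1 1 (by decide), fu.2 2 (by decide), fu.2 4 (by decide), fu.1 10 (by decide),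
      fu.1 4 (by decide)]
    exact ⟨hK, hM, rfl, hγ⟩
  rw [output, always_seq, always_setReal, always_seq]
  refine (Always.loop (fun j u => Frame {11} {1, 5, 6} m u ∧
    u.real 5 0 0 = ∑ k ∈ Finset.range j, d k) (N := K) (by simp [hK])
    ⟨(Frame.setReal (by decide)).trans (.tick _), by simp⟩ ?_).mono ?_
  · rintro j hj u ⟨fu, hu⟩
    obtain ⟨f1, f2, f4, f10⟩ := fr fu
    rw [always_setReal]
    refine ⟨(fu.trans (.setNat (by decide))).trans (.setReal (by decide)), ?_⟩
    simp [diffExp, scaleExp, f2, f4, hu, hb, Finset.sum_range_succ, hd]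
  rintro m1 ⟨fm1, hm1⟩
  obtain ⟨a1, a2, a4, a10⟩ := fr fm1
  rw [always_seq]
  refine (Always.loop (fun j u => Frame {11} {1, 5, 6} m u ∧
    u.real 5 0 0 = ∑ k ∈ Finset.range K, d k ∧
    ∀ k < j, u.real 1 0 k = (1 - γ) * d k + 1 / M) (N := K) (by simp [a1])
    ⟨fm1.trans (.tick _), by simp [hm1], by simp⟩ ?_).mono ?_
  · rintro j hj u ⟨fu, hu5, hu⟩
    obtain ⟨f1, f2, f4, f10⟩ := fr fu
    rw [always_setReal]
    refine ⟨(fu.trans (.setNat (by decide))).trans (.setReal (by decide)), by simp [hu5],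
      fun k hk => ?_⟩
    by_cases h : k = j
    · simp [h, diffExp, scaleExp, exploitExp, f2, f4, hb, hd, f10]
    · simp [h, hu k (by omega)]
  rintro m2 ⟨fm2, hm5, hm2⟩
  obtain ⟨b1, b2, b4, b10⟩ := fr fm2
  rw [always_seq, always_setReal]
  refine (Always.loop (fun j u => Frame {11} {1, 5, 6} m u ∧
    (∀ k < K, u.real 1 0 k = (1 - γ) * (d k +
        if k = 0 then 1 - ∑ j ∈ Finset.range K, d j else 0) + 1 / M) ∧
    ∀ k < j, u.real 6 0 k = 1 / (u.real 1 0 k * M)) (N := K) (by simp [b1])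
    ⟨(fm2.trans (.setReal (by decide))).trans (.tick _), fun k hk => ?_, by simp⟩ ?_).mono ?_
  · by_cases h : k = 0
    · simp [h, hm2 0 (by omega), hm5, exploitExp, b10]; ring
    · simp [h, hm2 k hk]
  · rintro j hj u ⟨fu, hu1, hu⟩
    obtain ⟨f1, f2, f4, f10⟩ := fr fu
    rw [always_setReal]
    refine ⟨(fu.trans (.setNat (by decide))).trans (.setReal (by decide)),
      fun k hk => by simp [hu1 k hk], fun k hk => ?_⟩
    by_cases h : k = j
    · simp [h, scaleExp, f2]
    · simp [h, hu k (by omega)]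
  · rintro u ⟨-, hu1, hu⟩ k
    refine ⟨?_, hu k k.2⟩
    rw [hu1 k k.2, hsum, hd]
    simp only [he]

end Deterministic

/-! ### One round of the learner -/

section Round

variable {X : Type*} {K : ℕ} {H : Finset (X → Fin K)}

/-- The memory `m` before round `s` stores the estimates `v` of the current epoch, except that the
estimate of the last round still has to be drawn: it is `some k` with probability `π`. -/
structure Stores (s : ℕ) (m : Mem) (v : List (Option (Fin K))) (k : Fin K) (π : ℝ) : Prop where
  marks : ∀ i, m.nat 22 i ≤ s
  prob : m.real 0 0 0 * m.real 6 0 (m.nat 3 0) = π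
  prob_nonneg : 0 ≤ π
  prob_le_one : π ≤ 1
  history : pos s ≠ 0 → rows K m 0 (pos s - 1) = v.zipIdx (s - pos s) ∧ m.nat 3 0 = k

/-- Expectation over the estimate which is still to be drawn. -/
noncomputable def pending (s : ℕ) (v : List (Option (Fin K))) (k : Fin K) (π : ℝ)
    (F : List (Option (Fin K)) → ℝ) : ℝ :=
  if pos s = 0 then F [] else π * F (v ++ [some k]) + (1 - π) * F (v ++ [none])

/-- The memory `m` at the end of round `s`, for the estimates `v` and the hallucinated rounds
`l`. -/
structure Played (H : Finset (X → Fin K)) (xs : List X) (x : X) (m : Mem)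
    (v : List (Option (Fin K))) (l : List (Option (Fin K) × ℕ)) : Prop where
  marks : ∀ i, m.nat 22 i ≤ xs.length + 1
  history : rows K m 0 (pos xs.length) = v.zipIdx (xs.length - pos xs.length)
  act : m.act K = strategy H (mag K H.card xs.length) (rate K H.card xs.length)
    (look (mag K H.card xs.length) (xs ++ [x]) (v.zipIdx (xs.length - pos xs.length) ++ l)) x
  coeff : ∀ k : Fin K, m.real 6 0 k = 1 / (m.act K k * mag K H.card xs.length)

theorem pos_le (s : ℕ) : pos s ≤ s := Nat.mod_le _ _

/-- The interface between machine and analysis: a round draws the pending estimate, then fresh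
hallucinated rounds, and the rest is a deterministic function of these data. -/
theorem expect_round_le {xs : List X} {x : X} {m : Mem} {v : List (Option (Fin K))} {k : Fin K}
    {π : ℝ} (hH : H.Nonempty) (hm : Stores xs.length m v k π) {f : Mem → ℝ}
    {G : List (Option (Fin K)) → List (Option (Fin K) × ℕ) → ℝ}
    (h : ∀ m' v' l, Played H xs x m' v' l → f m' ≤ G v' l) :
    expect (learner.round H (xs ++ [x]) m) f ≤ pending xs.length v k π fun v' =>
      hallu (mag K H.card xs.length) (pool xs.length) (len xs.length - 1 - pos xs.length) []
        (G v') := by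
  have hK : 1 ≤ K := k.pos
  set s := xs.length with hs
  set M := mag K H.card s with hM
  set p := pos s with hp
  set ys := xs ++ [x] with hys
  have hM0 : 0 < M := mag_pos hK _ _
  have hKM : K ≤ M := le_mag _ _ _
  have hn0 := len_pos s
  have hpn := pos_lt s
  have hps := pos_le s
  rw [Prog.round, ← wp]
  set m0 := m.present H ys with hm0
  have e0 : m0.nat 0 0 = s + 1 := by simp [hm0, Mem.present, hys, hs]
  have e1 : m0.nat 1 0 = K := by simp [hm0, Mem.present]
  have e2 : m0.nat 2 0 = H.card := by simp [hm0, Mem.present]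
  have ea : ∀ a, 3 ≤ a → m0.nat a = m.nat a := fun a ha => by
    funext i
    simp [hm0, Mem.present, show a ≠ 0 by omega, show a ≠ 1 by omega, show a ≠ 2 by omega]
  have er : m0.real = m.real := rfl
  clear_value m0
  rw [learner, wp_seq]
  refine wp_le_of_always ((always_schedule m0 s e0).and (always_frame _ m0)) ?_
  rintro m1 ⟨⟨a4, a5, a6, a7⟩, f1⟩
  replace f1 := f1.mono (A' := {4, 5, 6, 7, 11}) (B' := ∅) (by decide) (by decide)
  rw [wp_seq]
  refine wp_le_of_always ((always_exploration m1 s H.card (by rw [f1.1 1 (by decide), e1])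
    (by rw [f1.1 2 (by decide), e2]) a4 a5).and (always_frame _ m1)) ?_
  rintro m2 ⟨⟨a10, aM⟩, f2⟩
  replace f2 := f2.mono (A' := {8, 9, 10, 11}) (B' := {2}) (by decide) (by decide)
  have g2 : m2.nat 0 0 = s + 1 ∧ m2.nat 1 0 = K ∧ m2.nat 4 0 = scale s ∧ m2.nat 5 0 = len s ∧
      m2.nat 6 0 = pool s ∧ m2.nat 7 0 = p := by
    refine ⟨?_, ?_, ?_, ?_, ?_, ?_⟩
    · rw [f2.1 0 (by decide), f1.1 0 (by decide), e0]
    · rw [f2.1 1 (by decide), f1.1 1 (by decide), e1]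
    · rw [f2.1 4 (by decide), a4]
    · rw [f2.1 5 (by decide), a5]
    · rw [f2.1 6 (by decide), a6]
    · rw [f2.1 7 (by decide), a7]
  have keep : ∀ a ∉ ({0, 1, 2, 4, 5, 6, 7, 8, 9, 10, 11} : Finset ℕ), m2.nat a = m.nat a := by
    intro a ha
    simp only [Finset.mem_insert, Finset.mem_singleton, not_or] at ha
    rw [f2.1 a (by simp [ha]), f1.1 a (by simp [ha]), ea a (by omega)]
  have keepr : ∀ a ≠ 2, m2.real a = m.real a := fun a ha => by
    rw [f2.2 a (by simp [ha]), f1.2 a (by simp), er]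
  obtain ⟨b0, b1, b4, b5, b6, b7⟩ := g2
  -- the part after the pending estimate has been drawn
  have rest : ∀ (m3 : Mem) (v' : List (Option (Fin K))), Frame {15, 20, 21} ∅ m2 m3 →
      rows K m3 0 p = v'.zipIdx (s - p) →
      wp H ys (.seq sample <| .seq fill <| .seq calls output) f m3 ≤
        hallu M (pool s) (len s - 1 - p) [] (G v') := by
    intro m3 v' f3 hv
    have c0 : m3.nat 0 0 = s + 1 := by rw [f3.1 0 (by decide), b0]
    have c1 : m3.nat 1 0 = K := by rw [f3.1 1 (by decide), b1]
    have c5 : m3.nat 5 0 = len s := by rw [f3.1 5 (by decide), b5]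
    have c6 : m3.nat 6 0 = pool s := by rw [f3.1 6 (by decide), b6]
    have c7 : m3.nat 7 0 = p := by rw [f3.1 7 (by decide), b7]
    have cM : m3.real 2 0 0 = M := by rw [f3.2 2 (by decide), aM]
    rw [wp_seq]
    refine wp_sample_le c0 c7 c5 c6 c1 cM hKM hM0 (len_le_pool s) (fun i => ?_) ?_
    · rw [f3.1 22 (by decide), keep 22 (by decide)]
      exact Nat.lt_succ_of_le (hm.marks i)
    rintro m4 ⟨f4, hpre, hle, -⟩
    set l := rows K m4 p (len s - 1 - p) with hl
    have d0 : m4.nat 0 0 = s + 1 := by rw [f4.1 0 (by decide), c0]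
    have d1 : m4.nat 1 0 = K := by rw [f4.1 1 (by decide), c1]
    have d5 : m4.nat 5 0 = len s := by rw [f4.1 5 (by decide), c5]
    have dM : m4.real 2 0 0 = M := by rw [f4.2 2 (by decide), cM]
    have d4 : m4.nat 4 0 = scale s := by rw [f4.1 4 (by decide), f3.1 4 (by decide), b4]
    have d10 : m4.nat 10 0 = explore K H.card s := by
      rw [f4.1 10 (by decide), f3.1 10 (by decide), a10]
    have hv4 : rows K m4 0 p = v'.zipIdx (s - p) := by
      rw [← hv]
      exact rows_congr fun i _ hi => hpre i (by omega)
    have hv5 : rows K m4 0 (len s - 1) = v'.zipIdx (s - p) ++ l := by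
      have e : len s - 1 = p + (len s - 1 - p) := by omega
      rw [← hv4, hl]
      conv_lhs => rw [e]
      rw [rows_add, zero_add]
    rw [wp_seq]
    refine wp_le_of_always ((always_fill d0 d5 hn0 d1 dM).and (always_frame _ m4)) ?_
    rintro m5 ⟨⟨hr, h3⟩, f5⟩
    replace f5 := f5.mono (A' := {11, 12, 20, 21}) (B' := {3}) (by decide) (by decide)
    rw [hv5] at hr
    have g1 : m5.nat 1 0 = K := by rw [f5.1 1 (by decide), d1]
    rw [wp_seq]
    refine wp_le_of_always ((always_calls (H := H) (xs := ys) (by rw [f5.1 5 (by decide), d5]) hn0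
      g1 (by rw [f5.2 2 (by decide), dM]) hr h3).and (always_frame _ m5)) ?_
    rintro m6 ⟨⟨h40, h41⟩, f6⟩
    replace f6 := f6.mono (A' := {11}) (B' := {3, 4}) (by decide) (by decide)
    refine wp_le_of_always ((always_output (γ := rate K H.card s) hK
      (by rw [f6.1 1 (by decide), g1])
      (by rw [f6.2 2 (by decide), f5.2 2 (by decide), dM])
      (by rw [f6.1 10 (by decide), f5.1 10 (by decide), d10, f6.1 4 (by decide),
        f5.1 4 (by decide), d4, rate])
      h40 h41).and (always_frame _ m6)) ?_
    rintro m7 ⟨hout, f7⟩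
    replace f7 := f7.mono (A' := {11}) (B' := {1, 5, 6}) (by decide) (by decide)
    have hq : (fun k : Fin K => m7.real 1 0 k) = strategy H M (rate K H.card s)
        (look M ys (v'.zipIdx (s - p) ++ l)) x := by
      funext k
      rw [(hout k).1, strategy]
      simp only [hys, hs, look_last, erm_append_none, diff]
    have hact : m7.act K = strategy H M (rate K H.card s)
        (look M ys (v'.zipIdx (s - p) ++ l)) x := by
      rw [Mem.act, hq, if_pos (strategy_mem hK hH hM0 (rate_le_one _ _ _) (div_mag hK _ _) _ _)]
    refine h m7 v' l ⟨fun i => ?_, ?_, hact, fun k => ?_⟩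
    · rw [f7.1 22 (by decide), f6.1 22 (by decide), f5.1 22 (by decide)]
      exact hle i
    · have e : rows K m7 0 p = rows K m5 0 p := rows_congr fun i _ _ => by
        rw [f7.1 20 (by decide), f6.1 20 (by decide), f7.1 21 (by decide), f6.1 21 (by decide)]
        exact ⟨rfl, rfl⟩
      rw [e]
      have e5 : rows K m5 0 (len s) = rows K m5 0 p ++ rows K m5 p (len s - p) := by
        have e : len s = p + (len s - p) := by omega
        conv_lhs => rw [e]
        rw [rows_add, zero_add]
      rw [e5, List.append_assoc, ← hv4] at hr
      rw [(List.append_inj hr (by simp)).1, hv4]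
    · rw [(hout k).2, hact, ← hq]
  rw [wp_seq]
  have hprob : m2.real 0 0 0 * m2.real 6 0 (m2.nat 3 0) = π := by
    rw [keepr 0 (by decide), keepr 6 (by decide), keep 3 (by decide), hm.prob]
  by_cases hp0 : p = 0
  -- At the start of an epoch the coin is still flipped, but both outcomes are discarded.
  · refine (wp_resolve_le hprob hm.prob_nonneg hm.prob_le_one (A := hallu M (pool s)
      (len s - 1 - p) [] (G [])) (B := hallu M (pool s) (len s - 1 - p) [] (G []))
      fun m3 f3 _ => ⟨fun _ => rest m3 [] f3 (by simp [hp0]),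
        fun _ => rest m3 [] f3 (by simp [hp0])⟩).trans (le_of_eq ?_)
    rw [pending, if_pos hp0]; ring
  · rw [pending, if_neg hp0]
    obtain ⟨hrow, harm⟩ := hm.history hp0
    have hlen : v.length = p - 1 := by
      have := congrArg List.length hrow
      simpa using this.symm
    refine wp_resolve_le hprob hm.prob_nonneg hm.prob_le_one fun m3 f3 h20 => ?_
    have key : ∀ z, (∀ i, m3.nat 21 i = if i = m2.nat 7 0 - 1 then z else m2.nat 21 i) →
        rows K m3 0 p = (v ++ [decode K z]).zipIdx (s - p) := by
      intro z h21
      rw [b7] at h21 h20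
      obtain ⟨p', hp'⟩ : ∃ p', p = p' + 1 := ⟨p - 1, by omega⟩
      have e := rows_extend (K := K) (u := m2) (w := m3) (p := 0) (j := p') (z := z) (i := s - 1)
        (fun b => by simp [h20, hp', b0]) (fun b => by simp [h21, hp'])
      rw [hp', e, List.zipIdx_append, ← hp']
      congr 1
      · rw [← hrow, ← hp, show p' = p - 1 by omega]
        exact rows_congr fun i _ _ => by
          rw [keep 20 (by decide), keep 21 (by decide)]; exact ⟨rfl, rfl⟩
      · simp [hlen]; omega
    refine ⟨fun h21 => ?_, fun h21 => ?_⟩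
    · refine rest m3 _ f3 ((key _ h21).trans ?_)
      rw [keep 3 (by decide), harm, decode_succ]
    · refine rest m3 _ f3 ((key _ h21).trans ?_)
      rw [decode_zero]

end Round

/-! ### Expectation functionals -/

/-- A normalized monotone linear functional. -/
structure IsExp {A : Type*} (E : (A → ℝ) → ℝ) : Prop where
  add : ∀ f g, E (fun a => f a + g a) = E f + E g
  smul : ∀ (c : ℝ) f, E (fun a => c * f a) = c * E f
  mono : ∀ f g, (∀ a, f a ≤ g a) → E f ≤ E g
  one : E (fun _ => 1) = 1

namespace IsExp

variable {A : Type*} {E : (A → ℝ) → ℝ} (hE : IsExp E)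

include hE

theorem const (c : ℝ) : E (fun _ => c) = c := by
  have := hE.smul c fun _ => 1
  simpa [hE.one] using this

theorem add_const (f : A → ℝ) (c : ℝ) : E (fun a => f a + c) = E f + c := by
  rw [hE.add, hE.const]

theorem sum {ι : Type*} (s : Finset ι) (f : ι → A → ℝ) :
    E (fun a => ∑ i ∈ s, f i a) = ∑ i ∈ s, E (f i) := by
  classical
  induction s using Finset.induction_on with
  | empty => simpa using hE.const 0
  | insert i s hi ih => simp only [Finset.sum_insert hi, hE.add, ih]

/-- Jensen's inequality, from the tangent of `exp` at `E f`. -/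
theorem exp_le (f : A → ℝ) : Real.exp (E f) ≤ E fun a => Real.exp (f a) := by
  have h1 : ∀ a, Real.exp (E f) * f a + Real.exp (E f) * (1 - E f) ≤ Real.exp (f a) := by
    intro a
    have h := Real.add_one_le_exp (f a - E f)
    have h2 := mul_le_mul_of_nonneg_left h (Real.exp_pos (E f)).le
    rw [← Real.exp_add] at h2
    have e : E f + (f a - E f) = f a := by ring
    rw [e] at h2
    linarith
  have h2 := hE.mono _ _ h1
  rw [hE.add_const, hE.smul] at h2
  linarith

/-- Jensen's inequality, from the tangent of `log` at `exp c`. -/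
theorem log_le {f : A → ℝ} (hf : ∀ a, 0 < f a) {c : ℝ} (hc : E f ≤ Real.exp c) :
    E (fun a => Real.log (f a)) ≤ c := by
  have h1 : ∀ a, Real.log (f a) ≤ Real.exp (-c) * f a + (c - 1) := by
    intro a
    have h := Real.log_le_sub_one_of_pos (mul_pos (Real.exp_pos (-c)) (hf a))
    rw [Real.log_mul (Real.exp_pos _).ne' (hf a).ne', Real.log_exp] at h
    linarith
  have h2 := hE.mono _ _ h1
  rw [hE.add_const, hE.smul] at h2
  have h3 := mul_le_mul_of_nonneg_left hc (Real.exp_pos (-c)).le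
  rw [← Real.exp_add, neg_add_cancel, Real.exp_zero] at h3
  linarith

end IsExp

/-! ### Finite product weights -/

section Product

variable {X : Type*} {w : X → ℝ}

theorem prod_weight_nonneg (h0 : ∀ x, 0 ≤ w x) {ι : Type*} [Fintype ι] (u : ι → X) :
    0 ≤ ∏ i, w (u i) := Finset.prod_nonneg fun _ _ => h0 _

variable [Fintype X]

theorem isExp_weight (h0 : ∀ x, 0 ≤ w x) (h1 : ∑ x, w x = 1) :
    IsExp fun f : X → ℝ => ∑ x, w x * f x where
  add f g := by simp [mul_add, Finset.sum_add_distrib]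
  smul c f := by simp only [Finset.mul_sum]; exact Finset.sum_congr rfl fun x _ => by ring
  mono f g h := Finset.sum_le_sum fun x _ => mul_le_mul_of_nonneg_left (h x) (h0 x)
  one := by simpa using h1

theorem sum_prod_weight (h1 : ∑ x, w x = 1) (ι : Type*) [Fintype ι] [DecidableEq ι] :
    ∑ u : ι → X, ∏ i, w (u i) = 1 := by
  have := Finset.prod_univ_sum (fun _ : ι => (Finset.univ : Finset X)) fun _ x => w x
  simpa [h1, Fintype.piFinset_univ] using this.symm

/-- Swapping a coordinate with an independent copy is an involution that preserves the product
weight. -/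
theorem sum_resample (h1 : ∑ x, w x = 1) {ι : Type*} [Fintype ι] [DecidableEq ι] (i : ι)
    (F : (ι → X) → ℝ) : ∑ u : ι → X, (∏ j, w (u j)) * F u =
      ∑ u : ι → X, (∏ j, w (u j)) * ∑ y, w y * F (Function.update u i y) := by
  have e1 : ∑ u : ι → X, (∏ j, w (u j)) * F u =
      ∑ q : (ι → X) × X, (∏ j, w (q.1 j)) * w q.2 * F q.1 := by
    rw [Fintype.sum_prod_type]
    refine Finset.sum_congr rfl fun u _ => ?_
    simp only
    rw [← Finset.sum_mul, ← Finset.mul_sum, h1, mul_one]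
  have e2 : ∑ u : ι → X, (∏ j, w (u j)) * ∑ y, w y * F (Function.update u i y) =
      ∑ q : (ι → X) × X, (∏ j, w (q.1 j)) * w q.2 * F (Function.update q.1 i q.2) := by
    rw [Fintype.sum_prod_type]
    refine Finset.sum_congr rfl fun u _ => ?_
    rw [Finset.mul_sum]
    exact Finset.sum_congr rfl fun y _ => by ring
  rw [e1, e2]
  have hinv : Function.Involutive fun q : (ι → X) × X => (Function.update q.1 i q.2, q.1 i) := by
    intro q; simp
  refine (Equiv.sum_comp hinv.toPerm _).symm.trans (Finset.sum_congr rfl fun q _ => ?_)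
  have hw : (∏ j, w (Function.update q.1 i q.2 j)) * w (q.1 i) = (∏ j, w (q.1 j)) * w q.2 := by
    rw [← Finset.mul_prod_erase _ _ (Finset.mem_univ i),
      ← Finset.mul_prod_erase Finset.univ (fun j => w (q.1 j)) (Finset.mem_univ i)]
    have : ∏ j ∈ Finset.univ.erase i, w (Function.update q.1 i q.2 j) =
        ∏ j ∈ Finset.univ.erase i, w (q.1 j) :=
      Finset.prod_congr rfl fun j hj => by
        rw [Function.update_of_ne (Finset.ne_of_mem_erase hj)]
    rw [this, Function.update_self]; ring
  simp only [Function.Involutive.coe_toPerm]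
  rw [hw]

/-- Symmetrization: Jensen replaces the mean by an independent copy; exchanging the two copies turns
`exp` into `cosh`, and `cosh z ≤ exp (z ^ 2 / 2)`. -/
theorem sum_exp_centered_le (h0 : ∀ x, 0 ≤ w x) (h1 : ∑ x, w x = 1) (f : X → ℝ)
    (hf : ∀ x y, |f x - f y| ≤ 1) (b : ℝ) :
    ∑ x, w x * Real.exp (b * (f x - ∑ y, w y * f y)) ≤ Real.exp (b ^ 2 / 2) := by
  have hE := isExp_weight h0 h1
  have a1 : ∀ x, Real.exp (b * (f x - ∑ y, w y * f y)) ≤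
      ∑ y, w y * Real.exp (b * (f x - f y)) := by
    intro x
    refine le_trans (le_of_eq ?_) (hE.exp_le fun y => b * (f x - f y))
    congr 1
    have e : (fun y => b * (f x - f y)) = fun y => (-b) * f y + b * f x := by funext y; ring
    rw [e, hE.add_const, hE.smul]; ring
  have a2 := hE.mono _ _ a1
  refine a2.trans ?_
  have sw : ∑ x, w x * ∑ y, w y * Real.exp (b * (f x - f y)) =
      ∑ x, w x * ∑ y, w y * Real.exp (-(b * (f x - f y))) := by
    simp only [Finset.mul_sum]
    rw [Finset.sum_comm]
    refine Finset.sum_congr rfl fun x _ => Finset.sum_congr rfl fun y _ => ?_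
    have e : -(b * (f x - f y)) = b * (f y - f x) := by ring
    rw [e]; ring
  have a3 : ∑ x, w x * ∑ y, w y * Real.exp (b * (f x - f y)) =
      ∑ x, w x * ∑ y, w y * Real.cosh (b * (f x - f y)) := by
    have : ∑ x, w x * ∑ y, w y * Real.cosh (b * (f x - f y)) =
        (∑ x, w x * ∑ y, w y * Real.exp (b * (f x - f y)) +
          ∑ x, w x * ∑ y, w y * Real.exp (-(b * (f x - f y)))) / 2 := by
      rw [← Finset.sum_add_distrib, Finset.sum_div]
      refine Finset.sum_congr rfl fun x _ => ?_
      rw [← mul_add, ← Finset.sum_add_distrib, mul_div_assoc, Finset.sum_div]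
      congr 1
      refine Finset.sum_congr rfl fun y _ => ?_
      rw [Real.cosh_eq]; ring
    rw [this, ← sw]; ring
  rw [a3]
  have a4 : ∀ x y, Real.cosh (b * (f x - f y)) ≤ Real.exp (b ^ 2 / 2) := by
    intro x y
    refine (Real.cosh_le_exp_half_sq _).trans (Real.exp_le_exp.2 ?_)
    have : (f x - f y) ^ 2 ≤ 1 := by
      rw [← sq_abs]; exact pow_le_one₀ (abs_nonneg _) (hf x y)
    nlinarith [sq_nonneg b]
  calc _ ≤ ∑ x, w x * Real.exp (b ^ 2 / 2) := hE.mono _ _ fun x =>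
        (hE.mono _ _ fun y => a4 x y).trans_eq (hE.const _)
    _ = _ := hE.const _

/-- The random function `f u` ignores the coordinates in `J`, so these are independent samples for
it and can be integrated out one at a time. -/
theorem sum_exp_deviation_le (h0 : ∀ x, 0 ≤ w x) (h1 : ∑ x, w x = 1) {ι : Type*} [Fintype ι]
    [DecidableEq ι] (J : Finset ι) (f : (ι → X) → X → ℝ)
    (hf : ∀ u x y, |f u x - f u y| ≤ 1) (hJ : ∀ i ∈ J, ∀ u y, f (Function.update u i y) = f u)
    (b : ℝ) : ∑ u : ι → X, (∏ j, w (u j)) *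
      Real.exp (b * ∑ i ∈ J, (f u (u i) - ∑ y, w y * f u y)) ≤ Real.exp (b ^ 2 / 2 * J.card) := by
  induction J using Finset.induction_on with
  | empty => simp [sum_prod_weight h1]
  | insert i J hi ih =>
    have ih := ih fun j hj => hJ j (Finset.mem_insert_of_mem hj)
    rw [sum_resample h1 i]
    have key : ∀ u : ι → X, ∑ y, w y * Real.exp (b * ∑ j ∈ insert i J,
        (f (Function.update u i y) (Function.update u i y j) -
          ∑ z, w z * f (Function.update u i y) z)) ≤
        Real.exp (b ^ 2 / 2) * Real.exp (b * ∑ j ∈ J, (f u (u j) - ∑ y, w y * f u y)) := by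
      intro u
      have e : ∀ y, Real.exp (b * ∑ j ∈ insert i J,
          (f (Function.update u i y) (Function.update u i y j) -
            ∑ z, w z * f (Function.update u i y) z)) =
          Real.exp (b * (f u y - ∑ z, w z * f u z)) *
            Real.exp (b * ∑ j ∈ J, (f u (u j) - ∑ y, w y * f u y)) := by
        intro y
        rw [← Real.exp_add, ← mul_add, Finset.sum_insert hi, hJ i (Finset.mem_insert_self i J),
          Function.update_self]
        congr 3
        refine Finset.sum_congr rfl fun j hj => ?_
        rw [Function.update_of_ne (show j ≠ i from fun h => hi (h ▸ hj))]
      simp only [e, ← mul_assoc]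
      rw [← Finset.sum_mul]
      exact mul_le_mul_of_nonneg_right (sum_exp_centered_le h0 h1 _ (hf u) b) (Real.exp_pos _).le
    calc _ ≤ ∑ u : ι → X, (∏ j, w (u j)) * (Real.exp (b ^ 2 / 2) *
          Real.exp (b * ∑ j ∈ J, (f u (u j) - ∑ y, w y * f u y))) :=
          Finset.sum_le_sum fun u _ =>
            mul_le_mul_of_nonneg_left (key u) (prod_weight_nonneg h0 u)
      _ = Real.exp (b ^ 2 / 2) * ∑ u : ι → X, (∏ j, w (u j)) *
          Real.exp (b * ∑ j ∈ J, (f u (u j) - ∑ y, w y * f u y)) := by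
          rw [Finset.mul_sum]; exact Finset.sum_congr rfl fun u _ => by ring
      _ ≤ Real.exp (b ^ 2 / 2) * Real.exp (b ^ 2 / 2 * J.card) :=
          mul_le_mul_of_nonneg_left ih (Real.exp_pos _).le
      _ = _ := by
          rw [← Real.exp_add, Finset.card_insert_of_notMem hi]; push_cast; ring_nf

end Product

/-! ### The functionals of the analysis -/

section Functionals

variable {K : ℕ} {M : ℝ}

theorem avgArm_eq (M : ℝ) (c : Cost K) (F : Option (Fin K) → ℝ) :
    avgArm M c F = F none + ∑ k, c k / M * (F (some k) - F none) := by
  simp only [avgArm, mul_sub, Finset.sum_sub_distrib, ← Finset.sum_mul]; ring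

theorem avgArm_vec (c : Cost K) (y : Fin K) (g : ℝ → ℝ) :
    avgArm M c (fun o => g (vec M o y)) = g 0 + c y / M * (g M - g 0) := by
  rw [avgArm_eq, Finset.sum_eq_single y]
  · simp [vec]
  · intro k _ hk; simp [vec, hk]
  · simp

theorem isExp_avgArm (hM : 0 < M) (hKM : K ≤ M) {c : Cost K} (h0 : ∀ k, 0 ≤ c k)
    (h1 : ∀ k, c k ≤ 1) : IsExp (avgArm M c) where
  add f g := by simp only [avgArm, mul_add, Finset.sum_add_distrib]; ring
  smul a f := by
    simp only [avgArm, mul_add, Finset.mul_sum]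
    congr 1
    · exact Finset.sum_congr rfl fun k _ => by ring
    · ring
  mono f g h := by
    refine add_le_add (Finset.sum_le_sum fun k _ =>
      mul_le_mul_of_nonneg_left (h _) (div_nonneg (h0 k) hM.le)) (mul_le_mul_of_nonneg_left (h _) ?_)
    rw [sub_nonneg, ← Finset.sum_div, div_le_one hM]
    refine (Finset.sum_le_sum fun k _ => h1 k).trans ?_
    simpa using hKM
  one := by simp [avgArm]

theorem isExp_avgOne (hM : 0 < M) (hKM : K ≤ M) :
    IsExp (avgArm (K := K) M fun _ => 1) :=
  isExp_avgArm hM hKM (fun _ => zero_le_one) fun _ => le_rfl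

theorem IsExp.bind {A B : Type*} {E : (A → ℝ) → ℝ} {E' : A → (B → ℝ) → ℝ} (hE : IsExp E)
    (hE' : ∀ a, IsExp (E' a)) : IsExp fun f => E fun a => E' a f where
  add f g := by simp only [(hE' _).add, hE.add]
  smul c f := by simp only [(hE' _).smul, hE.smul]
  mono f g h := hE.mono _ _ fun a => (hE' a).mono _ _ h
  one := by simp only [(hE' _).one, hE.one]

/-- Expectation over the next hallucinated round. -/
noncomputable def hstep (M : ℝ) (N : ℕ) (l : List (Option (Fin K) × ℕ))
    (F : Option (Fin K) × ℕ → ℝ) : ℝ :=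
  (∑ i ∈ free N l, avgArm M (fun _ => 1) fun z => F (z, i)) / (free N l).card

theorem hallu_succ (M : ℝ) (N r : ℕ) (l : List (Option (Fin K) × ℕ))
    (F : List (Option (Fin K) × ℕ) → ℝ) :
    hallu M N (r + 1) l F = hstep M N l fun p => hallu M N r (l ++ [p]) F := rfl

/-- The definition splits off the first hallucinated round; the comparison with the actual round
needs the last one. -/
theorem hallu_succ_right (M : ℝ) (N r : ℕ) (l : List (Option (Fin K) × ℕ))
    (F : List (Option (Fin K) × ℕ) → ℝ) :
    hallu M N (r + 1) l F = hallu M N r l fun l' => hstep M N l' fun p => F (l' ++ [p]) := by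
  induction r generalizing l with
  | zero => rfl
  | succ r ih =>
    rw [hallu_succ, hallu_succ]
    congr 1
    funext p
    exact ih _

theorem isExp_hstep (hM : 0 < M) (hKM : K ≤ M) {N : ℕ} {l : List (Option (Fin K) × ℕ)}
    (hl : l.length < N) : IsExp (hstep M N l) := by
  have hpos : (0 : ℝ) < (free N l).card := by
    have := card_free_ge N l
    exact_mod_cast (by omega : 0 < (free N l).card)
  have hE := isExp_avgOne (K := K) hM hKM
  refine ⟨fun f g => ?_, fun c f => ?_, fun f g h => ?_, ?_⟩
  · simp only [hstep, hE.add, Finset.sum_add_distrib, add_div]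
  · simp only [hstep, hE.smul, ← Finset.mul_sum, mul_div_assoc]
  · exact div_le_div_of_nonneg_right (Finset.sum_le_sum fun i _ =>
      hE.mono _ _ fun z => h _) hpos.le
  · simp [hstep, hE.one, hpos.ne']

theorem isExp_hallu (hM : 0 < M) (hKM : K ≤ M) {N r : ℕ} {l : List (Option (Fin K) × ℕ)}
    (hl : l.length + r ≤ N) : IsExp (hallu M N r l) := by
  induction r generalizing l with
  | zero => exact ⟨fun _ _ => rfl, fun _ _ => rfl, fun _ _ h => h _, rfl⟩
  | succ r ih =>
    have h := (isExp_hstep hM hKM (by omega : l.length < N)).bind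
      (E' := fun p => hallu M N r (l ++ [p])) fun p => ih (by simp; omega)
    have e : hallu M N (r + 1) l = fun f => hstep M N l fun p => hallu M N r (l ++ [p]) f :=
      funext fun f => hallu_succ M N r l f
    rwa [e]

/-- Stronger than the monotonicity in `isExp_hallu`: only lists of the right length with numbers
from the pool have to be compared. -/
theorem hallu_mono (hM : 0 < M) (hKM : K ≤ M) {N r : ℕ} {l : List (Option (Fin K) × ℕ)}
    {F G : List (Option (Fin K) × ℕ) → ℝ} (hl : ∀ p ∈ l, p.2 < N)
    (h : ∀ l' : List (Option (Fin K) × ℕ), (∀ p ∈ l', p.2 < N) → l'.length = l.length + r →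
      F l' ≤ G l') :
    hallu M N r l F ≤ hallu M N r l G := by
  induction r generalizing l with
  | zero => exact h l hl rfl
  | succ r ih =>
    refine div_le_div_of_nonneg_right (Finset.sum_le_sum fun i hi =>
      (isExp_avgOne hM hKM).mono _ _ fun z => ih ?_ ?_) (Nat.cast_nonneg _)
    · intro p hp
      rcases List.mem_append.1 hp with hp | hp
      · exact hl p hp
      · rw [List.mem_singleton.1 hp]
        exact Finset.mem_range.1 (Finset.mem_filter.1 hi).1
    · intro l' h1 h2
      exact h l' h1 (by rw [h2]; simp; omega)

end Functionals

/-! ### The potential -/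

section Potential

variable {X : Type*} {K : ℕ} {H : Finset (X → Fin K)} {M : ℝ}

theorem look_concat_of_lt (M : ℝ) {xs : List X} {l : List (Option (Fin K) × ℕ)}
    (hl : ∀ p ∈ l, p.2 < xs.length) (ys : List X) : look M (xs ++ ys) l = look M xs l :=
  List.filterMap_congr fun p hp => by rw [List.getElem?_append_left (hl p hp)]

theorem erm_look_perm {xs : List X} {l l' : List (Option (Fin K) × ℕ)} (h : l.Perm l') :
    erm H (look M xs l) = erm H (look M xs l') :=
  erm_congr fun _ _ => ((h.filterMap _).map _).sum_eq

theorem zipIdx_lt {s₀ s : ℕ} {v : List (Option (Fin K))} (hv : s₀ + v.length = s) :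
    ∀ p ∈ v.zipIdx s₀, p.2 < s := fun p hp => by
  have := List.snd_lt_add_of_mem_zipIdx hp; omega

theorem zipIdx_concat {s₀ s : ℕ} {v : List (Option (Fin K))} (hv : s₀ + v.length = s)
    (o : Option (Fin K)) : (v ++ [o]).zipIdx s₀ = v.zipIdx s₀ ++ [(o, s)] := by
  simp [List.zipIdx_append, hv]

/-- The heart of the strategy. The expected oracle value is `erm H D + ∑ c d`, and `∑ c (e - d) ≤ ∑
(e - d)` because `d ≤ e` and `c ≤ 1`. Hence the right side no longer depends on the adversary's `c`;
exploration costs at most `K / M = γ`. -/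
theorem sum_strategy_mul_le (hK : 1 ≤ K) (hH : H.Nonempty) (hM : 0 < M) {γ : ℝ} (hγ0 : 0 ≤ γ)
    (hKM : K / M = γ) (D : List (X × Cost K)) (x : X) {c : Cost K}
    (h0 : ∀ k, 0 ≤ c k) (h1 : ∀ k, c k ≤ 1) :
    ∑ k, strategy H M γ D x k * c k - avgArm M c (fun o => erm H (D ++ [(x, vec M o)])) ≤
      1 + γ - avgArm M (fun _ => 1) (fun o => erm H (D ++ [(x, vec M o)])) := by
  set d := diff H M D x with hd
  set e : Fin K → ℝ := fun k => d k + if (k : ℕ) = 0 then 1 - ∑ j, d j else 0 with he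
  have hde : ∀ k, d k ≤ e k := diff_le_exploit hH hM D x
  have hd0 : ∀ k, 0 ≤ d k := diff_nonneg hH hM D x
  have hsum : ∑ k, e k = 1 := by
    simp only [he, Finset.sum_add_distrib, sum_ite_first hK]; ring
  have avg : ∀ c : Cost K, avgArm M c (fun o => erm H (D ++ [(x, vec M o)])) =
      erm H D + ∑ k, c k * d k := by
    intro c
    rw [avgArm_eq, erm_append_none]
    congr 1
    refine Finset.sum_congr rfl fun k _ => ?_
    rw [hd, diff]; ring
  rw [avg, avg]
  have a1 : ∑ k, strategy H M γ D x k * c k ≤ ∑ k, c k * e k + γ := by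
    have : ∑ k, c k * e k + γ = ∑ k, (c k * e k + 1 / M) := by
      simp [Finset.sum_add_distrib, ← hKM, div_eq_mul_inv]
    rw [this]
    refine Finset.sum_le_sum fun k _ => ?_
    have p1 : 0 ≤ e k * c k := mul_nonneg ((hd0 k).trans (hde k)) (h0 k)
    have p2 : 1 / M * c k ≤ 1 / M := mul_le_of_le_one_right (by positivity) (h1 k)
    have p3 : strategy H M γ D x k = (1 - γ) * e k + 1 / M := rfl
    rw [p3]
    nlinarith
  have a2 : ∑ k, c k * e k - ∑ k, c k * d k ≤ ∑ k, e k - ∑ k, d k := by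
    rw [← Finset.sum_sub_distrib, ← Finset.sum_sub_distrib]
    refine Finset.sum_le_sum fun k _ => ?_
    rw [← mul_sub]
    exact mul_le_of_le_one_left (sub_nonneg.2 (hde k)) (h1 k)
  rw [hsum] at a2
  simp only [one_mul]
  linarith

theorem exp_sub_one_le {u : ℝ} (h0 : 0 ≤ u) (h1 : u ≤ 1) : Real.exp u - 1 ≤ u + u ^ 2 := by
  have := (abs_le.1 (Real.abs_exp_sub_one_sub_id_le (x := u) (by rwa [abs_of_nonneg h0]))).2
  linarith

theorem exp_neg_sub_one_le {u : ℝ} (h0 : 0 ≤ u) (h1 : u ≤ 1) :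
    Real.exp (-u) - 1 ≤ -u + u ^ 2 := by
  have := (abs_le.1 (Real.abs_exp_sub_one_sub_id_le (x := -u)
    (by rwa [abs_neg, abs_of_nonneg h0]))).2
  rw [neg_sq] at this
  linarith

/-- The estimate has mean `c y` and second moment `M * c y`, and `exp u ≤ 1 + u + u ^ 2` applies at
`u = lam * M ≤ 1`. -/
theorem avgArm_exp_le (hM : 0 < M) {lam : ℝ} (hl0 : 0 ≤ lam) (hl1 : lam * M ≤ 1) {c : Cost K}
    (h0 : ∀ k, 0 ≤ c k) (h1 : ∀ k, c k ≤ 1) (y : Fin K) :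
    avgArm M c (fun o => Real.exp (lam * (vec M o y - c y))) ≤ Real.exp (lam ^ 2 * M) := by
  rw [avgArm_vec c y fun z => Real.exp (lam * (z - c y))]
  have e1 : ∀ z, Real.exp (lam * (z - c y)) = Real.exp (-(lam * c y)) * Real.exp (lam * z) := by
    intro z; rw [← Real.exp_add]; ring_nf
  have e2 : Real.exp (lam * (0 - c y)) + c y / M * (Real.exp (lam * (M - c y)) -
      Real.exp (lam * (0 - c y))) =
      Real.exp (-(lam * c y)) * (1 + c y / M * (Real.exp (lam * M) - 1)) := by
    rw [e1, e1 M]; simp; ring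
  rw [e2]
  have b1 := exp_sub_one_le (mul_nonneg hl0 hM.le) hl1
  have b2 : 1 + c y / M * (Real.exp (lam * M) - 1) ≤ Real.exp (lam * c y + lam ^ 2 * M * c y) := by
    refine le_trans ?_ (Real.add_one_le_exp _)
    have := mul_le_mul_of_nonneg_left b1 (div_nonneg (h0 y) hM.le)
    have e : c y / M * (lam * M + (lam * M) ^ 2) = lam * c y + lam ^ 2 * M * c y := by
      field_simp
    rw [e] at this; linarith
  calc _ ≤ Real.exp (-(lam * c y)) * Real.exp (lam * c y + lam ^ 2 * M * c y) :=
        mul_le_mul_of_nonneg_left b2 (Real.exp_pos _).le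
    _ = Real.exp (lam ^ 2 * M * c y) := by rw [← Real.exp_add]; ring_nf
    _ ≤ _ := Real.exp_le_exp.2 (mul_le_of_le_one_right (by positivity) (h1 y))

theorem avgArm_exp_neg_le (hM : 0 < M) {lam : ℝ} (hl0 : 0 ≤ lam) (hl1 : lam * M ≤ 1)
    (y : Fin K) : avgArm M (fun _ => 1) (fun o => Real.exp (-(lam * vec M o y))) ≤
      Real.exp (-lam + lam ^ 2 * M) := by
  rw [avgArm_vec _ y fun z => Real.exp (-(lam * z))]
  refine le_trans ?_ (Real.add_one_le_exp _)
  have := mul_le_mul_of_nonneg_left (exp_neg_sub_one_le (mul_nonneg hl0 hM.le) hl1)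
    (by positivity : 0 ≤ 1 / M)
  have e : 1 / M * (-(lam * M) + (lam * M) ^ 2) = -lam + lam ^ 2 * M := by field_simp
  rw [e] at this
  simp only [mul_zero, neg_zero, Real.exp_zero]
  linarith

/-- Expected oracle value of the estimates `v` of the epoch starting in round `s₀` together with
`r` hallucinated rounds. -/
noncomputable def dataPot (H : Finset (X → Fin K)) (M : ℝ) (N s₀ r : ℕ) (xs : List X)
    (v : List (Option (Fin K))) : ℝ :=
  hallu M N r [] fun l => erm H (look M xs (v.zipIdx s₀ ++ l))

/-- Exponential moment of the difference of estimated and actual costs. -/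
noncomputable def expPot (H : Finset (X → Fin K)) (M lam : ℝ) (s₀ : ℕ) (xs : List X)
    (pe : List (X × Cost K)) (v : List (Option (Fin K))) : ℝ :=
  ∑ h ∈ H, Real.exp (lam * (cost h (look M xs (v.zipIdx s₀)) - cost h pe))

/-- The potential of an epoch with `r` remaining rounds. -/
noncomputable def pot (H : Finset (X → Fin K)) (M γ lam : ℝ) (N s₀ r : ℕ) (xs : List X)
    (pe : List (X × Cost K)) (v : List (Option (Fin K))) : ℝ :=
  r * (1 + γ + lam * M) + Real.log (expPot H M lam s₀ xs pe v) / lam - dataPot H M N s₀ r xs v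

theorem expPot_pos (hH : H.Nonempty) (M lam : ℝ) (s₀ : ℕ) (xs : List X)
    (pe : List (X × Cost K)) (v : List (Option (Fin K))) : 0 < expPot H M lam s₀ xs pe v :=
  Finset.sum_pos (fun _ _ => Real.exp_pos _) hH

theorem cost_look_concat (h : X → Fin K) (M : ℝ) (xs : List X) (l : List (Option (Fin K) × ℕ))
    (p : Option (Fin K) × ℕ) : cost h (look M xs (l ++ [p])) =
      cost h (look M xs l) + (xs[p.2]?).elim 0 fun x => vec M p.1 (h x) := by
  rw [look_append, cost_append]
  congr 1
  rcases hx : xs[p.2]? with _ | x <;> simp [look, hx]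

/-- A hallucinated round costs every policy one on average, or nothing if its context number is out
of range. -/
theorem hallu_cost_le (hM : 0 < M) (hKM : K ≤ M) (h : X → Fin K) (xs : List X) {N r : ℕ}
    {l : List (Option (Fin K) × ℕ)} (hl : l.length + r ≤ N) :
    hallu M N r l (fun l' => cost h (look M xs l')) ≤ cost h (look M xs l) + r := by
  have hE := isExp_avgOne (K := K) hM hKM
  induction r generalizing l with
  | zero => simp [hallu]
  | succ r ih =>
    rw [hallu_succ]
    refine ((isExp_hstep hM hKM (by omega)).mono _ _ fun p =>
      ih (l := l ++ [p]) (by simp; omega)).trans ?_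
    have hpos : (0 : ℝ) < (free N l).card := by
      have := card_free_ge N l
      exact_mod_cast (by omega : 0 < (free N l).card)
    rw [hstep, div_le_iff₀' hpos, ← nsmul_eq_mul (free N l).card]
    refine Finset.sum_le_card_nsmul (free N l) _ _ fun i _ => ?_
    simp only [cost_look_concat]
    rcases xs[i]? with _ | x
    · simp only [Option.elim_none, add_zero, hE.const]; push_cast; linarith
    · simp only [Option.elim_some]
      have e : (fun z : Option (Fin K) => cost h (look M xs l) + vec M z (h x) + (r : ℝ)) =
          fun z => vec M z (h x) + (cost h (look M xs l) + r) := by funext z; ring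
      rw [e, hE.add_const, avgArm_vec _ _ fun z => z]
      push_cast
      have : 1 / M * (M - 0) = 1 := by field_simp; ring
      rw [this]; linarith

/-- Let `h` be the best policy for the true costs. It bounds the oracle value of the data; its
hallucinated cost is paid by the term `r`, and the excess of its estimated over its true cost by one
summand of the exponential moment. As `r` is arbitrary, the game may stop inside an epoch. -/
theorem neg_erm_le_pot (hH : H.Nonempty) (hM : 0 < M) (hKM : K ≤ M) {γ lam : ℝ} (hγ : 0 ≤ γ)
    (hlam : 0 < lam) {N s₀ r : ℕ} (hr : r ≤ N) (xs : List X) (pe : List (X × Cost K))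
    (v : List (Option (Fin K))) : -erm H pe ≤ pot H M γ lam N s₀ r xs pe v := by
  obtain ⟨h, hh, e⟩ := exists_erm_eq hH pe
  have hE := isExp_hallu (K := K) (l := []) hM hKM (by simpa using hr)
  have a1 : dataPot H M N s₀ r xs v ≤ cost h (look M xs (v.zipIdx s₀)) + r := by
    have a := hE.mono (fun l => erm H (look M xs (v.zipIdx s₀ ++ l)))
      (fun l => cost h (look M xs l) + cost h (look M xs (v.zipIdx s₀))) fun l => by
        refine (erm_le hh _).trans (le_of_eq ?_)
        rw [look_append, cost_append, add_comm]
    rw [hE.add_const] at a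
    have b := hallu_cost_le hM hKM h xs (l := []) (N := N) (r := r) (by simpa using hr)
    simp only [look, List.filterMap_nil, cost_nil, zero_add] at b
    exact a.trans (by simp only [look] at *; linarith)
  have a2 : cost h (look M xs (v.zipIdx s₀)) - cost h pe ≤
      Real.log (expPot H M lam s₀ xs pe v) / lam := by
    rw [le_div_iff₀ hlam, mul_comm, Real.le_log_iff_exp_le (expPot_pos hH _ _ _ _ _ _)]
    exact Finset.single_le_sum (f := fun h => Real.exp (lam * (cost h (look M xs (v.zipIdx s₀)) -
      cost h pe))) (fun _ _ => (Real.exp_pos _).le) hh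
  have a3 : (0 : ℝ) ≤ r * (γ + lam * M) := by positivity
  rw [pot, e]
  linarith

/-- The loss together with the change of the oracle term is handled by `sum_strategy_mul_le`,
averaged over the hallucinated rounds. The exponential moment grows by a factor of at most `exp (lam
^ 2 * M)` on average, which costs `lam * M` after division by `lam`. -/
theorem pot_step_le (hK : 1 ≤ K) (hH : H.Nonempty) (hM : 0 < M) (hKM : K ≤ M) {γ lam : ℝ}
    (hγ0 : 0 ≤ γ) (hγM : K / M = γ) (hlam : 0 < lam) (hlam1 : lam * M ≤ 1)
    {N s₀ r : ℕ} (hr : r ≤ N) {xs : List X} (pe : List (X × Cost K))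
    {v : List (Option (Fin K))} (hv : s₀ + v.length = xs.length) (x : X) {c : Cost K}
    (h0 : ∀ k, 0 ≤ c k) (h1 : ∀ k, c k ≤ 1) :
    hallu M N r [] (fun l => ∑ k, strategy H M γ
        (look M (xs ++ [x]) (v.zipIdx s₀ ++ l)) x k * c k) +
      avgArm M c (fun o => pot H M γ lam N s₀ r (xs ++ [x]) (pe ++ [(x, c)]) (v ++ [o])) ≤
    (r + 1) * (1 + γ + lam * M) + Real.log (expPot H M lam s₀ xs pe v) / lam -
      hallu M N r [] (fun l => avgArm M (fun _ => 1) fun z =>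
        erm H (look M (xs ++ [x]) (v.zipIdx s₀ ++ l ++ [(z, xs.length)]))) := by
  have hE := isExp_hallu (K := K) (l := []) (r := r) (N := N) hM hKM (by simpa using hr)
  have hA := isExp_avgArm hM hKM h0 h1
  have ha : avgArm M c (fun o => pot H M γ lam N s₀ r (xs ++ [x]) (pe ++ [(x, c)]) (v ++ [o])) =
      r * (1 + γ + lam * M) + (1 / lam) * avgArm M c (fun o =>
        Real.log (expPot H M lam s₀ (xs ++ [x]) (pe ++ [(x, c)]) (v ++ [o]))) -
      hallu M N r [] (fun l => avgArm M c fun o =>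
        erm H (look M (xs ++ [x]) (v.zipIdx s₀ ++ l ++ [(o, xs.length)]))) := by
    have e1 : hallu M N r [] (fun l => avgArm M c fun o =>
        erm H (look M (xs ++ [x]) (v.zipIdx s₀ ++ l ++ [(o, xs.length)]))) =
        avgArm M c fun o => dataPot H M N s₀ r (xs ++ [x]) (v ++ [o]) := by
      simp only [avgArm_eq, hE.add, hE.sum, hE.smul]
      have e : ∀ o, hallu M N r [] (fun l =>
          erm H (look M (xs ++ [x]) (v.zipIdx s₀ ++ l ++ [(o, xs.length)]))) =
          dataPot H M N s₀ r (xs ++ [x]) (v ++ [o]) := by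
        intro o
        rw [dataPot, zipIdx_concat hv]
        congr 1; funext l
        -- The new estimate precedes the hallucinated rounds in the potential, but follows them in
        -- the data of the strategy.
        refine erm_look_perm ?_
        rw [List.append_assoc, List.append_assoc]
        exact List.perm_append_comm.append_left _
      have e' : ∀ o o', hallu M N r [] (fun l =>
          erm H (look M (xs ++ [x]) (v.zipIdx s₀ ++ l ++ [(o, xs.length)])) -
          erm H (look M (xs ++ [x]) (v.zipIdx s₀ ++ l ++ [(o', xs.length)]))) =
          dataPot H M N s₀ r (xs ++ [x]) (v ++ [o]) -
          dataPot H M N s₀ r (xs ++ [x]) (v ++ [o']) := by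
        intro o o'
        rw [← e, ← e, sub_eq_add_neg, neg_eq_neg_one_mul, ← hE.smul, ← hE.add]
        congr 1; funext l; ring
      rw [e]
      simp only [e']
    rw [e1]
    have e2 : (fun o => pot H M γ lam N s₀ r (xs ++ [x]) (pe ++ [(x, c)]) (v ++ [o])) = fun o =>
        ((1 / lam) * Real.log (expPot H M lam s₀ (xs ++ [x]) (pe ++ [(x, c)]) (v ++ [o])) +
          (-1) * dataPot H M N s₀ r (xs ++ [x]) (v ++ [o])) + r * (1 + γ + lam * M) := by
      funext o; rw [pot]; ring
    rw [e2, hA.add_const, hA.add, hA.smul, hA.smul]; ring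
  have hb : avgArm M c (fun o =>
      Real.log (expPot H M lam s₀ (xs ++ [x]) (pe ++ [(x, c)]) (v ++ [o]))) ≤
      Real.log (expPot H M lam s₀ xs pe v) + lam ^ 2 * M := by
    refine hA.log_le (fun o => expPot_pos hH _ _ _ _ _ _) ?_
    rw [Real.exp_add, Real.exp_log (expPot_pos hH _ _ _ _ _ _), expPot, Finset.sum_mul]
    simp only [expPot]
    rw [hA.sum]
    refine Finset.sum_le_sum fun h _ => ?_
    have e : ∀ o, Real.exp (lam * (cost h (look M (xs ++ [x]) ((v ++ [o]).zipIdx s₀)) -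
        cost h (pe ++ [(x, c)]))) =
        Real.exp (lam * (cost h (look M xs (v.zipIdx s₀)) - cost h pe)) *
          Real.exp (lam * (vec M o (h x) - c (h x))) := by
      intro o
      rw [← Real.exp_add, zipIdx_concat hv, look_last, cost_append, cost_append,
        look_concat_of_lt M (zipIdx_lt hv)]
      simp only [cost_singleton]
      congr 1; ring
    simp only [e]
    rw [hA.smul]
    exact mul_le_mul_of_nonneg_left (avgArm_exp_le hM hlam.le hlam1 h0 h1 _) (Real.exp_pos _).le
  have hc : hallu M N r [] (fun l => ∑ k, strategy H M γ
        (look M (xs ++ [x]) (v.zipIdx s₀ ++ l)) x k * c k) -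
      hallu M N r [] (fun l => avgArm M c fun o =>
        erm H (look M (xs ++ [x]) (v.zipIdx s₀ ++ l ++ [(o, xs.length)]))) ≤
      1 + γ - hallu M N r [] (fun l => avgArm M (fun _ => 1) fun z =>
        erm H (look M (xs ++ [x]) (v.zipIdx s₀ ++ l ++ [(z, xs.length)]))) := by
    have a := hE.mono (fun l => ∑ k, strategy H M γ
        (look M (xs ++ [x]) (v.zipIdx s₀ ++ l)) x k * c k + (-1) * avgArm M c fun o =>
        erm H (look M (xs ++ [x]) (v.zipIdx s₀ ++ l ++ [(o, xs.length)])))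
      (fun l => (-1) * avgArm M (fun _ => 1) (fun z =>
        erm H (look M (xs ++ [x]) (v.zipIdx s₀ ++ l ++ [(z, xs.length)]))) + (1 + γ)) fun l => by
        have := sum_strategy_mul_le hK hH hM hγ0 hγM
          (look M (xs ++ [x]) (v.zipIdx s₀ ++ l)) x h0 h1
        simp only [look_last]
        linarith
    rw [hE.add, hE.add_const, hE.smul, hE.smul] at a
    linarith
  have hd := mul_le_mul_of_nonneg_left hb (by positivity : 0 ≤ 1 / lam)
  have he : 1 / lam * (Real.log (expPot H M lam s₀ xs pe v) + lam ^ 2 * M) =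
      Real.log (expPot H M lam s₀ xs pe v) / lam + lam * M := by field_simp
  rw [he] at hd
  rw [ha]
  linarith

/-- Deviation of the empirical distribution of the unused pool from the law `w` of the contexts. -/
noncomputable def deviation [Fintype X] (w : X → ℝ) (H : Finset (X → Fin K)) (M : ℝ) (N s₀ : ℕ)
    (xs : List X) (v : List (Option (Fin K))) (l : List (Option (Fin K) × ℕ)) : ℝ :=
  hstep M N l (fun p => erm H (look M xs (v.zipIdx s₀ ++ l ++ [p]))) -
    ∑ x, w x * avgArm M (fun _ => 1) fun z =>
      erm H (look M (xs ++ [x]) (v.zipIdx s₀ ++ l ++ [(z, xs.length)]))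

/-- After averaging over `x`, the bound of `pot_step_le` differs from the previous potential only in
the context of the last hallucinated round: law `w` instead of the unused pool. -/
theorem sum_pot_step [Fintype X] {w : X → ℝ} (hw : ∑ x, w x = 1) (hM : 0 < M) (hKM : K ≤ M)
    {γ lam : ℝ} {N s₀ r : ℕ} (hr : r ≤ N) (xs : List X) (pe : List (X × Cost K))
    (v : List (Option (Fin K))) :
    ∑ x, w x * ((r + 1) * (1 + γ + lam * M) + Real.log (expPot H M lam s₀ xs pe v) / lam -
      hallu M N r [] (fun l => avgArm M (fun _ => 1) fun z =>
        erm H (look M (xs ++ [x]) (v.zipIdx s₀ ++ l ++ [(z, xs.length)])))) =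
    pot H M γ lam N s₀ (r + 1) xs pe v + hallu M N r [] (deviation w H M N s₀ xs v) := by
  have hE := isExp_hallu (K := K) (l := []) (r := r) (N := N) hM hKM (by simpa using hr)
  simp only [mul_sub, Finset.sum_sub_distrib, ← Finset.sum_mul, hw]
  simp only [← hE.smul]
  rw [← hE.sum, pot, dataPot, hallu_succ_right]
  have e : hallu M N r [] (deviation w H M N s₀ xs v) =
      hallu M N r [] (fun l => hstep M N l fun p => erm H (look M xs (v.zipIdx s₀ ++ l ++ [p]))) -
        hallu M N r [] (fun l => ∑ x, w x * avgArm M (fun _ => 1) fun z =>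
          erm H (look M (xs ++ [x]) (v.zipIdx s₀ ++ l ++ [(z, xs.length)]))) := by
    rw [sub_eq_add_neg, neg_eq_neg_one_mul, ← hE.smul, ← hE.add]
    congr 1; funext l; rw [deviation]; ring
  rw [e]
  simp only [List.append_assoc]
  push_cast
  ring

/-- The soft minimum over the policies shows that the expected hallucinated oracle value is at least
`r - log |H| / lam - r * lam * M`, which cancels the term `r` of the potential. `hN` guarantees that
every context drawn from the pool exists. -/
theorem pot_nil_le (hH : H.Nonempty) (hM : 0 < M) (hKM : K ≤ M) {γ lam : ℝ}
    (hlam : 0 < lam) (hlam1 : lam * M ≤ 1) {N s₀ r : ℕ} (hr : r ≤ N) {xs : List X}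
    (hN : N ≤ xs.length) : pot H M γ lam N s₀ r xs [] [] ≤
      r * γ + 2 * (Real.log H.card / lam + r * (lam * M)) := by
  have hE := isExp_hallu (K := K) (l := []) (r := r) (N := N) hM hKM (by simpa using hr)
  have hA := isExp_avgOne (K := K) hM hKM
  have h1 : expPot H M lam s₀ xs [] [] = H.card := by simp [expPot, look]
  have hcard : (0 : ℝ) < H.card := by exact_mod_cast hH.card_pos
  set Y : List (Option (Fin K) × ℕ) → ℝ := fun l =>
    ∑ h ∈ H, Real.exp (-(lam * cost h (look M xs l))) with hY
  have hYpos : ∀ l, 0 < Y l := fun l => Finset.sum_pos (fun _ _ => Real.exp_pos _) hH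
  have h2 : ∀ (r : ℕ) (l : List (Option (Fin K) × ℕ)), l.length + r ≤ N →
      hallu M N r l Y ≤ Y l * Real.exp (r * (-lam + lam ^ 2 * M)) := by
    intro r
    induction r with
    | zero => intro l _; simp [hallu]
    | succ r ih =>
      intro l hl
      rw [hallu_succ]
      refine ((isExp_hstep hM hKM (by omega)).mono _ _ fun p =>
        ih (l ++ [p]) (by simp; omega)).trans ?_
      have hpos : (0 : ℝ) < (free N l).card := by
        have := card_free_ge N l
        exact_mod_cast (by omega : 0 < (free N l).card)
      rw [hstep, div_le_iff₀' hpos, ← nsmul_eq_mul (free N l).card]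
      refine Finset.sum_le_card_nsmul (free N l) _ _ fun i hi => ?_
      have hi : i < xs.length := (Finset.mem_range.1 (Finset.mem_filter.1 hi).1).trans_le hN
      have e : (fun z => Y (l ++ [(z, i)]) * Real.exp (r * (-lam + lam ^ 2 * M))) = fun z =>
          Real.exp (r * (-lam + lam ^ 2 * M)) * ∑ h ∈ H,
            Real.exp (-(lam * cost h (look M xs l))) *
              Real.exp (-(lam * vec M z (h xs[i]))) := by
        funext z
        rw [mul_comm, hY]
        congr 1
        refine Finset.sum_congr rfl fun h _ => ?_
        rw [← Real.exp_add, cost_look_concat, List.getElem?_eq_getElem hi, Option.elim_some]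
        congr 1; ring
      rw [e, hA.smul, hA.sum]
      have b : ∑ h ∈ H, avgArm M (fun _ => 1) (fun z =>
          Real.exp (-(lam * cost h (look M xs l))) * Real.exp (-(lam * vec M z (h xs[i])))) ≤
          Y l * Real.exp (-lam + lam ^ 2 * M) := by
        simp only [hY, Finset.sum_mul]
        refine Finset.sum_le_sum fun h _ => ?_
        rw [hA.smul]
        exact mul_le_mul_of_nonneg_left (avgArm_exp_neg_le hM hlam.le hlam1 _)
          (Real.exp_pos _).le
      refine (mul_le_mul_of_nonneg_left b (Real.exp_pos _).le).trans (le_of_eq ?_)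
      rw [mul_left_comm, ← Real.exp_add]
      congr 2; push_cast; ring
  have h3 : hallu M N r [] (fun l => Real.log (Y l)) ≤
      Real.log H.card + r * (-lam + lam ^ 2 * M) := by
    refine hE.log_le hYpos ((h2 r [] (by simpa using hr)).trans (le_of_eq ?_))
    rw [Real.exp_add, Real.exp_log hcard]
    simp [hY, look]
  have h4 : ∀ l, -erm H (look M xs l) ≤ Real.log (Y l) / lam := by
    intro l
    obtain ⟨h, hh, e⟩ := exists_erm_eq hH (look M xs l)
    rw [le_div_iff₀ hlam, Real.le_log_iff_exp_le (hYpos l), e]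
    refine le_trans (le_of_eq ?_) (Finset.single_le_sum
      (f := fun h => Real.exp (-(lam * cost h (look M xs l))))
      (fun _ _ => (Real.exp_pos _).le) hh)
    congr 1; ring
  have h5 := hE.mono (fun l => (-1) * erm H (look M xs l)) (fun l => (1 / lam) * Real.log (Y l))
    fun l => by have := h4 l; rw [neg_one_mul, one_div_mul_eq_div]; exact this
  rw [hE.smul, hE.smul] at h5
  have h6 := mul_le_mul_of_nonneg_left h3 (by positivity : 0 ≤ 1 / lam)
  have e6 : 1 / lam * (Real.log H.card + r * (-lam + lam ^ 2 * M)) =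
      Real.log H.card / lam - r + r * (lam * M) := by field_simp; ring
  rw [e6] at h6
  rw [pot, h1, dataPot]
  simp only [List.zipIdx_nil, List.nil_append]
  linarith

end Potential

/-! ### The price of the unknown distribution -/

section Excess

variable {X : Type*} {K : ℕ} {w : X → ℝ} {H : Finset (X → Fin K)} {M : ℝ}

theorem avgArm_erm_eq (M : ℝ) (D : List (X × Cost K)) (y : X) :
    avgArm M (fun _ => 1) (fun z => erm H (D ++ [(y, vec M z)])) =
      erm H D + ∑ k, diff H M D y k := by
  rw [avgArm_eq, erm_append_none]
  congr 1
  refine Finset.sum_congr rfl fun k _ => ?_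
  rw [diff]; ring

theorem look_ofFn_update {s : ℕ} (u : Fin s → X) (i : Fin s) (y : X)
    {l : List (Option (Fin K) × ℕ)} (hl : ∀ p ∈ l, p.2 ≠ i) :
    look M (List.ofFn (Function.update u i y)) l = look M (List.ofFn u) l := by
  refine List.filterMap_congr fun p hp => ?_
  rw [List.getElem?_ofFn, List.getElem?_ofFn]
  split_ifs with h
  · rw [Function.update_of_ne (fun e => hl p hp (by rw [← e]))]
  · rfl

variable [Fintype X]

/-- A smooth upper bound for the deviations at all sequences of `p` estimates. -/
noncomputable def excess (w : X → ℝ) (H : Finset (X → Fin K)) (M : ℝ) (N s₀ r p : ℕ) (L : ℝ)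
    (xs : List X) : ℝ :=
  Real.log (∑ v : Fin p → Option (Fin K),
    Real.exp (L * hallu M N r [] (deviation w H M N s₀ xs (List.ofFn v)))) / L

theorem hallu_deviation_le_excess {N s₀ r p : ℕ} {L : ℝ} (hL : 0 < L) (xs : List X)
    {v : List (Option (Fin K))} (hv : v.length = p) :
    hallu M N r [] (deviation w H M N s₀ xs v) ≤ excess w H M N s₀ r p L xs := by
  subst hv
  have h := Finset.single_le_sum (f := fun u : Fin v.length → Option (Fin K) =>
    Real.exp (L * hallu M N r [] (deviation w H M N s₀ xs (List.ofFn u))))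
    (fun _ _ => (Real.exp_pos _).le) (Finset.mem_univ v.get)
  simp only [List.ofFn_get] at h
  rw [excess, le_div_iff₀ hL, mul_comm, Real.le_log_iff_exp_le]
  · exact h
  · exact (Real.exp_pos _).trans_le h

/-- With `v` and `l` fixed, the function averaged over the unused pool does not depend on the
contexts there, and it oscillates by at most one. At least `N - r` pool members are unused. -/
theorem sum_exp_scaled_deviation_le (h0 : ∀ x, 0 ≤ w x) (h1 : ∑ x, w x = 1) (hH : H.Nonempty)
    (hM : 0 < M) {N s₀ r s : ℕ} (hrN : r < N) (hN : N ≤ s₀) (L : ℝ)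
    {v : List (Option (Fin K))} (hv : s₀ + v.length = s) {l : List (Option (Fin K) × ℕ)}
    (hl : ∀ p ∈ l, p.2 < N) (hr : l.length = r) :
    ∑ u : Fin s → X, (∏ j, w (u j)) *
      Real.exp (L * deviation w H M N s₀ (List.ofFn u) v l) ≤
    Real.exp (L ^ 2 / (2 * (N - r : ℕ))) := by
  set f : (Fin s → X) → X → ℝ := fun u y => avgArm M (fun _ => 1) fun z =>
    erm H (look M (List.ofFn u) (v.zipIdx s₀ ++ l) ++ [(y, vec M z)]) with hf
  set J : Finset (Fin s) := Finset.univ.filter fun i => (i : ℕ) ∈ free N l with hJ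
  have hfree : free N l = J.map Fin.valEmbedding := by
    ext i
    simp only [hJ, Finset.mem_map, Finset.mem_filter, Finset.mem_univ, true_and,
      Fin.valEmbedding_apply]
    refine ⟨fun h => ?_, fun ⟨j, h, e⟩ => e ▸ h⟩
    have : i < N := Finset.mem_range.1 (Finset.mem_filter.1 h).1
    exact ⟨⟨i, by omega⟩, h, rfl⟩
  have hcard : (free N l).card = J.card := by rw [hfree, Finset.card_map]
  have hge : N - r ≤ J.card := by
    rw [← hcard, ← hr]; exact card_free_ge N l
  have hposn : 0 < J.card := by omega
  have hpos : (0 : ℝ) < J.card := by exact_mod_cast hposn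
  have hlt : ∀ p ∈ v.zipIdx s₀ ++ l, p.2 < s := by
    intro p hp
    rcases List.mem_append.1 hp with hp | hp
    · exact zipIdx_lt hv p hp
    · have := hl p hp; omega
  have hosc : ∀ u x y, |f u x - f u y| ≤ 1 := by
    intro u x y
    simp only [hf, avgArm_erm_eq]
    have a := sum_diff_le_one hH hM (look M (List.ofFn u) (v.zipIdx s₀ ++ l)) x
    have b := sum_diff_le_one hH hM (look M (List.ofFn u) (v.zipIdx s₀ ++ l)) y
    have c := Finset.sum_nonneg fun k (_ : k ∈ Finset.univ) =>
      diff_nonneg hH hM (look M (List.ofFn u) (v.zipIdx s₀ ++ l)) x k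
    have d := Finset.sum_nonneg fun k (_ : k ∈ Finset.univ) =>
      diff_nonneg hH hM (look M (List.ofFn u) (v.zipIdx s₀ ++ l)) y k
    rw [abs_le]; constructor <;> linarith
  -- The estimates `v` belong to rounds from `s₀ ≥ N` on, hence outside the pool, and the contexts
  -- in `l` are not free.
  have hinv : ∀ i ∈ J, ∀ u y, f (Function.update u i y) = f u := by
    intro i hi u y
    have hi' := Finset.mem_filter.1 (Finset.mem_filter.1 hi).2
    simp only [hf]
    rw [look_ofFn_update]
    intro p hp
    rcases List.mem_append.1 hp with hp | hp
    · have := List.le_snd_of_mem_zipIdx hp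
      have := Finset.mem_range.1 hi'.1
      omega
    · exact fun e => hi'.2 (e ▸ List.mem_map_of_mem hp)
  have hdev : ∀ u : Fin s → X, L * deviation w H M N s₀ (List.ofFn u) v l =
      L / J.card * ∑ i ∈ J, (f u (u i) - ∑ y, w y * f u y) := by
    intro u
    have e1 : hstep M N l (fun p => erm H (look M (List.ofFn u) (v.zipIdx s₀ ++ l ++ [p]))) =
        (∑ i ∈ J, f u (u i)) / J.card := by
      rw [hstep, hcard, hfree, Finset.sum_map]
      congr 1
      refine Finset.sum_congr rfl fun i _ => ?_
      simp only [hf]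
      congr 1; funext z
      rw [look_append _ _ _ [_]]
      congr 2
      simp [look]
    have e2 : ∑ x, w x * avgArm M (fun _ => 1) (fun z => erm H (look M (List.ofFn u ++ [x])
        (v.zipIdx s₀ ++ l ++ [(z, (List.ofFn u).length)]))) = ∑ y, w y * f u y := by
      refine Finset.sum_congr rfl fun x _ => ?_
      simp only [look_last, hf]
      rw [look_concat_of_lt M (by simpa using hlt)]
    rw [deviation, e1, e2, Finset.sum_sub_distrib, Finset.sum_const, nsmul_eq_mul, mul_sub,
      mul_sub, div_mul_eq_mul_div, mul_div_assoc, ← mul_assoc, div_mul_cancel₀ _ hpos.ne']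
  simp only [hdev]
  refine (sum_exp_deviation_le h0 h1 J f hosc hinv _).trans (Real.exp_le_exp.2 ?_)
  have hNr : (0 : ℝ) < (N - r : ℕ) := by exact_mod_cast (by omega : 0 < N - r)
  have e : (L / J.card) ^ 2 / 2 * J.card = L ^ 2 / (2 * J.card) := by
    rw [div_pow, sq (J.card : ℝ), div_div, div_mul_eq_mul_div, mul_right_comm,
      mul_div_mul_right _ _ hpos.ne', mul_comm (J.card : ℝ)]
  rw [e]
  have : ((N - r : ℕ) : ℝ) ≤ J.card := by exact_mod_cast hge
  gcongr

theorem isExp_prod (h0 : ∀ x, 0 ≤ w x) (h1 : ∑ x, w x = 1) (s : ℕ) :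
    IsExp fun F : (Fin s → X) → ℝ => ∑ u : Fin s → X, (∏ j, w (u j)) * F u :=
  isExp_weight (fun u => prod_weight_nonneg h0 u) (sum_prod_weight h1 _)

/-- The actual estimates depend on the pool through the adversary, so all `(K + 1) ^ p` sequences
are summed under the logarithm. Jensen moves the mean over hallucinated rounds outside `exp` and the
mean over contexts inside `log`. -/
theorem sum_excess_le (h0 : ∀ x, 0 ≤ w x) (h1 : ∑ x, w x = 1) (hH : H.Nonempty) (hM : 0 < M)
    (hKM : K ≤ M) {N s₀ r p s : ℕ} (hrN : r < N) (hN : N ≤ s₀) (hp : s₀ + p = s) {L : ℝ}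
    (hL : 0 < L) : ∑ u : Fin s → X, (∏ j, w (u j)) * excess w H M N s₀ r p L (List.ofFn u) ≤
      (p * Real.log (K + 1) + L ^ 2 / (2 * (N - r : ℕ))) / L := by
  have hE := isExp_prod h0 h1 s
  have hA := isExp_hallu (K := K) (l := []) (r := r) (N := N) hM hKM (by simp; omega)
  have h2 : ∀ v : List (Option (Fin K)), s₀ + v.length = s →
      ∑ u : Fin s → X, (∏ j, w (u j)) *
        Real.exp (L * hallu M N r [] (deviation w H M N s₀ (List.ofFn u) v)) ≤
      Real.exp (L ^ 2 / (2 * (N - r : ℕ))) := by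
    intro v hv
    have a : ∀ u : Fin s → X,
        Real.exp (L * hallu M N r [] (deviation w H M N s₀ (List.ofFn u) v)) ≤
        hallu M N r [] fun l => Real.exp (L * deviation w H M N s₀ (List.ofFn u) v l) := by
      intro u
      rw [← hA.smul]
      exact hA.exp_le _
    refine (hE.mono _ _ a).trans ?_
    have e : ∑ u : Fin s → X, (∏ j, w (u j)) * hallu M N r []
        (fun l => Real.exp (L * deviation w H M N s₀ (List.ofFn u) v l)) =
        hallu M N r [] fun l => ∑ u : Fin s → X, (∏ j, w (u j)) *
          Real.exp (L * deviation w H M N s₀ (List.ofFn u) v l) := by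
      rw [hA.sum]
      exact Finset.sum_congr rfl fun u _ => (hA.smul _ _).symm
    rw [e]
    refine (hallu_mono hM hKM (by simp) fun l hl hlen =>
      sum_exp_scaled_deviation_le h0 h1 hH hM hrN hN L hv hl (by simpa using hlen)).trans_eq
        (hA.const _)
  have h3 := hE.log_le (f := fun u => ∑ v : Fin p → Option (Fin K),
      Real.exp (L * hallu M N r [] (deviation w H M N s₀ (List.ofFn u) (List.ofFn v))))
    (fun u => Finset.sum_pos (fun _ _ => Real.exp_pos _) Finset.univ_nonempty)
    (c := p * Real.log (K + 1) + L ^ 2 / (2 * (N - r : ℕ))) (by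
      rw [hE.sum]
      refine (Finset.sum_le_sum fun v _ => h2 (List.ofFn v) (by simpa using hp)).trans
        (le_of_eq ?_)
      rw [Finset.sum_const, nsmul_eq_mul, Real.exp_add, Finset.card_univ, Fintype.card_fun,
        Fintype.card_option, Fintype.card_fin, Fintype.card_fin, mul_comm (p : ℝ),
        Real.exp_mul, Real.exp_log (by positivity), Real.rpow_natCast]
      push_cast; rfl)
  have e : ∑ u : Fin s → X, (∏ j, w (u j)) * excess w H M N s₀ r p L (List.ofFn u) =
      (∑ u : Fin s → X, (∏ j, w (u j)) * Real.log (∑ v : Fin p → Option (Fin K),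
        Real.exp (L * hallu M N r [] (deviation w H M N s₀ (List.ofFn u) (List.ofFn v))))) / L := by
    rw [Finset.sum_div]
    exact Finset.sum_congr rfl fun u _ => by rw [excess, mul_div_assoc]
  rw [e]
  exact div_le_div_of_nonneg_right h3 hL.le

/-- Expected sum of `F` along the next `n` contexts. -/
noncomputable def future (w : X → ℝ) (F : List X → ℝ) : ℕ → List X → ℝ
  | 0, _ => 0
  | n + 1, xs => F xs + ∑ x, w x * future w F n (xs ++ [x])

theorem future_eq (F : List X → ℝ) (n : ℕ) (xs : List X) : future w F n xs =
    ∑ s ∈ Finset.range n, ∑ u : Fin s → X, (∏ j, w (u j)) * F (xs ++ List.ofFn u) := by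
  induction n generalizing xs with
  | zero => simp [future]
  | succ n ih =>
    rw [future, Finset.sum_range_succ', add_comm]
    congr 1
    · simp only [ih, Finset.mul_sum]
      rw [Finset.sum_comm]
      refine Finset.sum_congr rfl fun s _ => ?_
      rw [← (Fin.consEquiv fun _ : Fin (s + 1) => X).sum_comp, Fintype.sum_prod_type]
      refine Finset.sum_congr rfl fun x _ => Finset.sum_congr rfl fun u _ => ?_
      simp [Fin.prod_univ_succ, List.ofFn_succ, mul_assoc]
    · simp

end Excess

/-! ### The schedule -/

/-- The phase changes only at powers of `32`, which are multiples of the new epoch length, so no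
epoch extends over two phases. -/
theorem phase_succ {s : ℕ} (h : pos (s + 1) ≠ 0) :
    phase (s + 1) = phase s ∧ pos (s + 1) = pos s + 1 := by
  have hp : phase (s + 1) = phase s := by
    by_contra hne
    have hle : phase s ≤ phase (s + 1) := Nat.log_mono_right (Nat.le_succ s)
    have h1 : 32 ^ phase (s + 1) ≤ s + 1 := Nat.pow_log_le_self 32 (Nat.succ_ne_zero s)
    have h2 : s < 32 ^ (phase s + 1) := Nat.lt_pow_succ_log_self (by norm_num) s
    have h3 : 32 ^ (phase s + 1) ≤ 32 ^ phase (s + 1) :=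
      Nat.pow_le_pow_right (by norm_num) (by omega)
    have h4 : s + 1 = 32 ^ phase (s + 1) := by omega
    have h5 : len (s + 1) ∣ s + 1 := by
      conv_rhs => rw [h4]
      exact pow_dvd_pow_of_dvd (by norm_num) _
    exact h (Nat.mod_eq_zero_of_dvd h5)
  refine ⟨hp, ?_⟩
  have hl : len (s + 1) = len s := by rw [len, len, hp]
  rw [pos, hl, ← Nat.mod_add_mod] at h ⊢
  have h1 := pos_lt s
  rw [pos] at h1 ⊢
  rcases Nat.lt_or_ge (s % len s + 1) (len s) with h2 | h2
  · exact Nat.mod_eq_of_lt h2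
  · have : s % len s + 1 = len s := by omega
    rw [this, Nat.mod_self] at h
    exact absurd rfl h

/-- In these rounds the costs are bounded trivially. -/
def Trivial (K c s : ℕ) : Prop := scale s = 1 ∨ scale s ^ 3 < K * Nat.clog 2 c

/-- The pool size is a multiple of the epoch length and at most `s`, hence at most the start of the
epoch. So the pool is disjoint from the contexts of the epoch. -/
theorem pool_le_start {s : ℕ} (h : scale s ≠ 1) : pool s ≤ s - pos s := by
  have hph : phase s ≠ 0 := fun e => h (by simp [scale, e])
  have hs : s ≠ 0 := by rintro rfl; simp [phase] at hph
  have h1 : pool s ≤ s := Nat.pow_log_le_self 32 hs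
  have h2 : s - pos s = len s * (s / len s) := by
    have := Nat.div_add_mod s (len s)
    rw [pos]; omega
  have h3 : pool s = len s * 4 ^ phase s := by
    rw [pool, len, ← mul_pow]; norm_num
  rw [h2, h3]
  refine Nat.mul_le_mul_left _ ((Nat.le_div_iff_mul_le (len_pos s)).2 ?_)
  rwa [mul_comm, ← h3]

/-! ### The bound along the game: potentials of epochs and charges of rounds. -/

section Game

variable {X : Type*} {K : ℕ}

open Classical in
/-- The potential of the epoch of round `s` with `r` remaining rounds. -/
noncomputable def epochPot (H : Finset (X → Fin K)) (s r : ℕ) (xs : List X)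
    (pe : List (X × Cost K)) (v : List (Option (Fin K))) : ℝ :=
  if Trivial K H.card s then r else
    pot H (mag K H.card s) (rate K H.card s) (rate K H.card s / mag K H.card s) (pool s)
      (s - pos s) r xs pe v

open Classical in
/-- Upper bound for the potential at the beginning of an epoch. -/
noncomputable def opening (K c s : ℕ) : ℝ :=
  if Trivial K c s then len s else
    len s * rate K c s +
      2 * (Real.log c / (rate K c s / mag K c s) + len s * (rate K c s / mag K c s * mag K c s))

open Classical in
/-- The increase of the bound in the round with past contexts `xs`. -/
noncomputable def charge [Fintype X] (w : X → ℝ) (H : Finset (X → Fin K)) (xs : List X) : ℝ :=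
  (if pos xs.length = 0 then opening K H.card xs.length else 0) +
    if Trivial K H.card xs.length then 0 else
      excess w H (mag K H.card xs.length) (pool xs.length) (xs.length - pos xs.length)
        (len xs.length - 1 - pos xs.length) (pos xs.length)
        ((scale xs.length : ℝ) ^ 4 * Real.sqrt (Real.log (K + 1))) xs

/-- Upper bound for the regret to come. -/
noncomputable def upper [Fintype X] (w : X → ℝ) (H : Finset (X → Fin K)) (n : ℕ)
    (past : List (X × Cost K)) (v : List (Option (Fin K))) : ℝ :=
  -erm H (past.take (past.length - pos past.length)) +
    (if pos past.length = 0 then 0 else epochPot H past.length (len past.length - pos past.length)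
      (past.map Prod.fst) (past.drop (past.length - pos past.length)) v) +
    future w (charge w H) n (past.map Prod.fst)

variable {H : Finset (X → Fin K)}

theorem epochPot_congr {s s' : ℕ} (hphase : phase s' = phase s) (hstart : s' - pos s' = s - pos s)
    (r : ℕ) (xs : List X) (pe : List (X × Cost K)) (v : List (Option (Fin K))) :
    epochPot H s' r xs pe v = epochPot H s r xs pe v := by
  have e1 : mag K H.card s' = mag K H.card s := by simp only [mag, explore, scale, len, hphase]
  have e2 : rate K H.card s' = rate K H.card s := by simp only [rate, explore, scale, len, hphase]
  have e3 : pool s' = pool s := by simp only [pool, hphase]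
  have e4 : Trivial K H.card s' ↔ Trivial K H.card s := by simp only [Trivial, scale, hphase]
  rw [epochPot, epochPot, e1, e2, e3, hstart]
  by_cases h : Trivial K H.card s
  · rw [if_pos h, if_pos (e4.2 h)]
  · rw [if_neg h, if_neg fun h' => h (e4.1 h')]

theorem rate_div_mag_pos (hK : 1 ≤ K) (c s : ℕ) : 0 < rate K c s / mag K c s :=
  div_pos (rate_pos _ _ _) (mag_pos hK _ _)

theorem rate_div_mag_mul (hK : 1 ≤ K) (c s : ℕ) :
    rate K c s / mag K c s * mag K c s = rate K c s := div_mul_cancel₀ _ (mag_pos hK _ _).ne'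

theorem cost_nonneg {h : X → Fin K} {D : List (X × Cost K)} (hD : ∀ d ∈ D, ∀ k, 0 ≤ d.2 k) :
    0 ≤ cost h D := List.sum_nonneg fun a ha => by
  obtain ⟨d, hd, rfl⟩ := List.mem_map.1 ha
  exact hD d hd _

theorem neg_erm_le_epochPot (hK : 1 ≤ K) (hH : H.Nonempty) {s r : ℕ} (hr : r ≤ len s)
    (xs : List X) {pe : List (X × Cost K)} (hpe : ∀ d ∈ pe, ∀ k, 0 ≤ d.2 k)
    (v : List (Option (Fin K))) : -erm H pe ≤ epochPot H s r xs pe v := by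
  unfold epochPot
  split_ifs with h
  · have : 0 ≤ erm H pe := le_erm hH fun h _ => cost_nonneg hpe
    have : (0 : ℝ) ≤ r := Nat.cast_nonneg r
    linarith
  · exact neg_erm_le_pot hH (mag_pos hK _ _) (le_mag _ _ _) (rate_pos _ _ _).le
      (rate_div_mag_pos hK _ _) (hr.trans (len_le_pool s)) _ _ _

theorem erm_append_ge (hH : H.Nonempty) (D E : List (X × Cost K)) :
    erm H D + erm H E ≤ erm H (D ++ E) := le_erm hH fun h hh => by
  rw [cost_append]; exact add_le_add (erm_le hh D) (erm_le hh E)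

theorem epochPot_nil_le (hK : 1 ≤ K) (hH : H.Nonempty) (xs : List X) :
    epochPot H xs.length (len xs.length) xs [] [] ≤ opening K H.card xs.length := by
  unfold epochPot opening
  split_ifs with h
  · exact le_rfl
  · have h' : scale xs.length ≠ 1 := fun e => h (.inl e)
    exact pot_nil_le hH (mag_pos hK _ _) (le_mag _ _ _) (rate_div_mag_pos hK _ _)
      (by rw [rate_div_mag_mul hK]; exact rate_le_one _ _ _) (len_le_pool _)
      ((pool_le_start h').trans (Nat.sub_le _ _))

variable [Fintype X] {w : X → ℝ}

theorem neg_erm_le_upper_zero (hK : 1 ≤ K) (hH : H.Nonempty) {past : List (X × Cost K)}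
    (hpast : ∀ d ∈ past, ∀ k, 0 ≤ d.2 k) (v : List (Option (Fin K))) :
    -erm H past ≤ upper w H 0 past v := by
  rw [upper, future, add_zero]
  split_ifs with h
  · rw [h, Nat.sub_zero, List.take_length, add_zero]
  · have a := neg_erm_le_epochPot hK hH (s := past.length) (Nat.sub_le _ (pos past.length))
      (past.map Prod.fst) (pe := past.drop (past.length - pos past.length))
      (fun d hd => hpast d (List.mem_of_mem_drop hd)) v
    have b := erm_append_ge hH (past.take (past.length - pos past.length))
      (past.drop (past.length - pos past.length))
    rw [List.take_append_drop] at b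
    linarith

/-- Inside an epoch only the bookkeeping changes. When the epoch ends, its potential dominates minus
its oracle value, and superadditivity of `erm` merges it with the earlier epochs. -/
theorem upper_concat_le (hK : 1 ≤ K) (hH : H.Nonempty) (n : ℕ) {past : List (X × Cost K)}
    (d : X × Cost K) (hpast : ∀ d ∈ past, ∀ k, 0 ≤ d.2 k) (hd : ∀ k, 0 ≤ d.2 k)
    (v : List (Option (Fin K))) : upper w H n (past ++ [d]) v ≤
      -erm H (past.take (past.length - pos past.length)) +
        epochPot H past.length (len past.length - 1 - pos past.length)
          (past.map Prod.fst ++ [d.1]) (past.drop (past.length - pos past.length) ++ [d]) v +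
        future w (charge w H) n (past.map Prod.fst ++ [d.1]) := by
  have hlen : (past ++ [d]).length = past.length + 1 := by simp
  have hmap : (past ++ [d]).map Prod.fst = past.map Prod.fst ++ [d.1] := by simp
  have hps := pos_le past.length
  rw [upper, hlen, hmap]
  refine add_le_add_left ?_ _
  by_cases h : pos (past.length + 1) = 0
  · rw [if_pos h, h, Nat.sub_zero, ← hlen, List.take_length, add_zero]
    have a := neg_erm_le_epochPot hK hH (s := past.length)
      (r := len past.length - 1 - pos past.length) (by omega)
      (past.map Prod.fst ++ [d.1]) (pe := past.drop (past.length - pos past.length) ++ [d])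
      (fun e he => by
        rcases List.mem_append.1 he with he | he
        · exact hpast e (List.mem_of_mem_drop he)
        · rw [List.mem_singleton.1 he]; exact hd) v
    have b := erm_append_ge hH (past.take (past.length - pos past.length))
      (past.drop (past.length - pos past.length) ++ [d])
    rw [← List.append_assoc, List.take_append_drop] at b
    linarith
  · obtain ⟨h1, h2⟩ := phase_succ h
    have e0 : past.length + 1 - pos (past.length + 1) = past.length - pos past.length := by omega
    have e1 : len (past.length + 1) = len past.length := by rw [len, len, h1]
    rw [if_neg h, epochPot_congr h1 e0, e0, e1, h2,
      List.take_append_of_le_length (Nat.sub_le _ _),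
      List.drop_append_of_le_length (Nat.sub_le _ _),
      show len past.length - (pos past.length + 1) = len past.length - 1 - pos past.length by omega]

theorem log_succ_pos (hK : 1 ≤ K) : 0 < Real.log ((K : ℝ) + 1) :=
  Real.log_pos (by have : (1 : ℝ) ≤ K := by exact_mod_cast hK
                   linarith)

theorem excess_scale_pos (hK : 1 ≤ K) (s : ℕ) :
    0 < (scale s : ℝ) ^ 4 * Real.sqrt (Real.log (K + 1)) :=
  mul_pos (pow_pos (by exact_mod_cast scale_pos s) 4) (Real.sqrt_pos.2 (log_succ_pos hK))

/-- In the game the supremum over the costs stands inside the mean over contexts; hence a bound `R`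
that depends on the context alone. -/
theorem exists_step_bound (h1 : ∑ x, w x = 1) (hK : 1 ≤ K)
    (hH : H.Nonempty) (n : ℕ) {past : List (X × Cost K)}
    (hpast : ∀ d ∈ past, ∀ k, 0 ≤ d.2 k) {v : List (Option (Fin K))}
    (hv : v.length = pos past.length) : ∃ R : X → ℝ,
      (∀ (x : X) (c : Cost K), (∀ k, 0 ≤ c k) → (∀ k, c k ≤ 1) →
        hallu (mag K H.card past.length) (pool past.length)
            (len past.length - 1 - pos past.length) []
          (fun l => ∑ k, strategy H (mag K H.card past.length) (rate K H.card past.length)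
            (look (mag K H.card past.length) (past.map Prod.fst ++ [x])
              (v.zipIdx (past.length - pos past.length) ++ l)) x k * c k) +
        avgArm (mag K H.card past.length) c
          (fun o => upper w H n (past ++ [(x, c)]) (v ++ [o])) ≤ R x) ∧
      ∑ x, w x * R x ≤ upper w H (n + 1) past v := by
  set s := past.length with hs
  set xs := past.map Prod.fst with hxs
  have hxl : xs.length = s := by simp [hxs, hs]
  have hM0 := mag_pos hK H.card s
  have hKM := le_mag K H.card s
  have hps := pos_le s
  have hpn := pos_lt s
  have hnN := len_le_pool s
  set r := len s - 1 - pos s with hr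
  have hr1 : len s - pos s = r + 1 := by omega
  have hrN : r < pool s := by omega
  have hv' : s - pos s + v.length = xs.length := by omega
  set A : ℝ := -erm H (past.take (s - pos s)) with hA
  set pe := past.drop (s - pos s) with hpe
  have hEx := fun (x : X) (c : Cost K) (h0 : ∀ k, 0 ≤ c k) (h1 : ∀ k, c k ≤ 1) =>
    isExp_avgArm hM0 hKM h0 h1
  have hopen : epochPot H s (r + 1) xs pe v ≤ (if pos s = 0 then 0 else
      epochPot H s (len s - pos s) xs pe v) + if pos s = 0 then opening K H.card s else 0 := by
    split_ifs with h
    · have hv0 : v = [] := List.length_eq_zero_iff.1 (by rw [hv, h])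
      have hpe0 : pe = [] := by rw [hpe, h, Nat.sub_zero, hs, List.drop_length]
      rw [hv0, hpe0, ← hr1, h, Nat.sub_zero, ← hxl, zero_add]
      exact epochPot_nil_le hK hH xs
    · rw [hr1, add_zero]
  have hU : upper w H (n + 1) past v = A + (if pos s = 0 then 0 else
      epochPot H s (len s - pos s) xs pe v) + (charge w H xs +
        ∑ x, w x * future w (charge w H) n (xs ++ [x])) := rfl
  have step : ∀ (x : X) (c : Cost K), (∀ k, 0 ≤ c k) → (∀ k, c k ≤ 1) →
      avgArm (mag K H.card s) c (fun o => upper w H n (past ++ [(x, c)]) (v ++ [o])) ≤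
      avgArm (mag K H.card s) c (fun o =>
        epochPot H s r (xs ++ [x]) (pe ++ [(x, c)]) (v ++ [o])) +
        (A + future w (charge w H) n (xs ++ [x])) := by
    intro x c h0 h1
    rw [← (hEx x c h0 h1).add_const]
    refine (hEx x c h0 h1).mono _ _ fun o => ?_
    refine (upper_concat_le hK hH n (x, c) hpast h0 (v ++ [o])).trans (le_of_eq ?_)
    ring
  by_cases ht : Trivial K H.card s
  · refine ⟨fun x => (r + 1 : ℕ) + (A + future w (charge w H) n (xs ++ [x])),
      fun x c h0 h1 => ?_, ?_⟩
    · have a := step x c h0 h1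
      have e : (fun o => epochPot H s r (xs ++ [x]) (pe ++ [(x, c)]) (v ++ [o])) =
          fun _ => (r : ℝ) := by funext o; rw [epochPot, if_pos ht]
      rw [e, (hEx x c h0 h1).const] at a
      have hE := isExp_hallu (K := K) (l := []) (r := r) hM0 hKM
        (by simpa using hrN.le)
      have b := hE.mono (fun l => ∑ k, strategy H (mag K H.card s) (rate K H.card s)
            (look (mag K H.card s) (xs ++ [x]) (v.zipIdx (s - pos s) ++ l)) x k * c k)
        (fun _ => 1) fun l => by
          have hS := strategy_mem hK hH hM0 (rate_le_one K H.card s) (div_mag hK _ _)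
            (look (mag K H.card s) (xs ++ [x]) (v.zipIdx (s - pos s) ++ l)) x
          rw [← hS.2]
          exact Finset.sum_le_sum fun k _ => mul_le_of_le_one_right (hS.1 k) (h1 k)
      rw [hE.one] at b
      push_cast
      linarith
    · rw [hU]
      simp only [mul_add, Finset.sum_add_distrib, ← Finset.sum_mul, h1, one_mul]
      have hc : charge w H xs = if pos s = 0 then opening K H.card s else 0 := by
        rw [charge, hxl, if_pos ht, add_zero]
      have e : epochPot H s (r + 1) xs pe v = (r + 1 : ℕ) := by rw [epochPot, if_pos ht]
      rw [e] at hopen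
      rw [hc]
      linarith
  · have hsc : scale s ≠ 1 := fun e => ht (.inl e)
    -- The choice `lam = γ / M` makes `lam * M = γ ≤ 1`, so estimation error and exploration cost
    -- the same.
    have hlam := rate_div_mag_pos hK H.card s
    have hlamM := rate_div_mag_mul hK H.card s
    set M := mag K H.card s with hM
    set γ := rate K H.card s with hγ
    refine ⟨fun x => ((r + 1) * (1 + γ + γ / M * M) +
      Real.log (expPot H M (γ / M) (s - pos s) xs pe v) / (γ / M) -
      hallu M (pool s) r [] (fun l => avgArm M (fun _ => 1) fun z =>
        erm H (look M (xs ++ [x]) (v.zipIdx (s - pos s) ++ l ++ [(z, xs.length)])))) +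
        (A + future w (charge w H) n (xs ++ [x])), fun x c h0 h1 => ?_, ?_⟩
    · have a := step x c h0 h1
      have e : (fun o => epochPot H s r (xs ++ [x]) (pe ++ [(x, c)]) (v ++ [o])) =
          fun o => pot H M γ (γ / M) (pool s) (s - pos s) r (xs ++ [x]) (pe ++ [(x, c)])
            (v ++ [o]) := by funext o; rw [epochPot, if_neg ht]
      rw [e] at a
      have b := pot_step_le hK hH hM0 hKM (rate_pos K H.card s).le (div_mag hK _ _) hlam
        (by rw [hlamM]; exact rate_le_one _ _ _) hrN.le pe hv' x h0 h1
      linarith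
    · rw [hU]
      have a := sum_pot_step (H := H) (γ := γ) (lam := γ / M) h1 hM0 hKM hrN.le xs pe v
        (s₀ := s - pos s)
      have b := hallu_deviation_le_excess (w := w) (H := H) (M := M) (N := pool s)
        (s₀ := s - pos s) (r := r) (excess_scale_pos hK s) xs hv
      have hc : charge w H xs = (if pos s = 0 then opening K H.card s else 0) +
          excess w H M (pool s) (s - pos s) r (pos s)
            ((scale s : ℝ) ^ 4 * Real.sqrt (Real.log (K + 1))) xs := by
        rw [charge, hxl, if_neg ht]
      have e : epochPot H s (r + 1) xs pe v =
          pot H M γ (γ / M) (pool s) (s - pos s) (r + 1) xs pe v := by rw [epochPot, if_neg ht]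
      rw [e] at hopen
      have d : ∑ x, w x * (((r + 1) * (1 + γ + γ / M * M) +
          Real.log (expPot H M (γ / M) (s - pos s) xs pe v) / (γ / M) -
          hallu M (pool s) r [] (fun l => avgArm M (fun _ => 1) fun z =>
            erm H (look M (xs ++ [x]) (v.zipIdx (s - pos s) ++ l ++ [(z, xs.length)])))) +
            (A + future w (charge w H) n (xs ++ [x]))) =
          ∑ x, w x * ((r + 1) * (1 + γ + γ / M * M) +
          Real.log (expPot H M (γ / M) (s - pos s) xs pe v) / (γ / M) -
          hallu M (pool s) r [] (fun l => avgArm M (fun _ => 1) fun z =>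
            erm H (look M (xs ++ [x]) (v.zipIdx (s - pos s) ++ l ++ [(z, xs.length)])))) +
            (A + ∑ x, w x * future w (charge w H) n (xs ++ [x])) := by
        have key : ∀ f g : X → ℝ, ∑ x, w x * (f x + (A + g x)) =
            ∑ x, w x * f x + (A + ∑ x, w x * g x) := fun f g => by
          simp only [mul_add, Finset.sum_add_distrib, ← Finset.sum_mul, h1, one_mul]
        exact key _ _
      rw [d, a, hc]
      linarith

end Game

/-! ### The regret against a distribution on a finite space -/

section Finite

variable {X : Type*} {K : ℕ} {H : Finset (X → Fin K)}

theorem Stores.pending_mono {s : ℕ} {m : Mem} {v : List (Option (Fin K))} {k : Fin K} {π : ℝ}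
    (hm : Stores s m v k π) {F G : List (Option (Fin K)) → ℝ}
    (h : ∀ v', v'.length = pos s → F v' ≤ G v') : pending s v k π F ≤ pending s v k π G := by
  unfold pending
  split_ifs with hp
  · exact h [] (by rw [hp, List.length_nil])
  · have hl : v.length = pos s - 1 := by
      simpa using (congrArg List.length (hm.history hp).1).symm
    have hl' : ∀ o, (v ++ [o]).length = pos s := fun o => by
      rw [List.length_append, List.length_singleton]; omega
    exact add_le_add (mul_le_mul_of_nonneg_left (h _ (hl' _)) hm.prob_nonneg)
      (mul_le_mul_of_nonneg_left (h _ (hl' _)) (sub_nonneg.2 hm.prob_le_one))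

theorem pending_const (s : ℕ) (v : List (Option (Fin K))) (k : Fin K) (π c : ℝ) :
    pending s v k π (fun _ => c) = c := by
  unfold pending; split_ifs <;> ring

theorem pending_const_add (s : ℕ) (v : List (Option (Fin K))) (k : Fin K) (π c : ℝ)
    (F : List (Option (Fin K)) → ℝ) :
    pending s v k π (fun v' => c + F v') = c + pending s v k π F := by
  unfold pending; split_ifs <;> ring

theorem sum_mul_pending [Fintype X] (w : X → ℝ) (s : ℕ) (v : List (Option (Fin K))) (k : Fin K)
    (π : ℝ) (F : X → List (Option (Fin K)) → ℝ) :
    ∑ x, w x * pending s v k π (F x) = pending s v k π fun v' => ∑ x, w x * F x v' := by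
  unfold pending
  split_ifs
  · rfl
  · rw [Finset.mul_sum, Finset.mul_sum, ← Finset.sum_add_distrib]
    exact Finset.sum_congr rfl fun x _ => by ring

/-- Exploration gives `q k * M ≥ 1`, so the bias of the pending coin is at most one. -/
theorem Played.stores {xs : List X} {x : X} {m : Mem} {v : List (Option (Fin K))}
    {l : List (Option (Fin K) × ℕ)} (hH : H.Nonempty) (h : Played H xs x m v l) (k : Fin K) {c : ℝ}
    (h0 : 0 ≤ c) (h1 : c ≤ 1) :
    Stores (xs.length + 1) (m.observe k c) v k
      (c * (1 / (m.act K k * mag K H.card xs.length))) := by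
  have hM := mag_pos k.pos H.card xs.length
  have hact : 1 ≤ m.act K k * mag K H.card xs.length := by
    rw [← div_le_iff₀ hM, h.act]
    exact strategy_ge hH hM (rate_le_one _ _ _) _ _ _
  refine ⟨fun i => ?_, ?_, mul_nonneg h0 (by positivity), ?_, fun hp => ⟨?_, ?_⟩⟩
  · simpa [Mem.observe] using h.marks i
  · simp [Mem.observe, h.coeff k]
  · exact mul_le_one₀ h1 (by positivity) (div_le_one_of_le₀ hact (by linarith))
  · obtain ⟨-, h2⟩ := phase_succ hp
    rw [h2, Nat.add_sub_cancel, Nat.add_sub_add_right, ← h.history]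
    exact rows_congr fun i _ _ => by simp [Mem.observe]
  · simp [Mem.observe]

/-- Importance weighting: playing arm `k` and then accepting the coin has probability `q k * (c k /
(q k * M)) = c k / M`. At the start of an epoch the estimate is discarded, which is harmless by
`hF`. -/
theorem sum_act_mul_pending {s : ℕ} {M : ℝ} (hM : 0 < M) {q : Fin K → ℝ}
    (hq : ∀ k, 0 < q k) (hq1 : ∑ k, q k = 1) (c : Cost K) (v : List (Option (Fin K)))
    {F : List (Option (Fin K)) → ℝ} (hF : pos s = 0 → ∀ v', F v' = F []) :
    ∑ k, q k * pending s v k (c k * (1 / (q k * M))) F = avgArm M c fun o => F (v ++ [o]) := by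
  by_cases hp : pos s = 0
  · simp only [pending, if_pos hp, avgArm, hF hp (v ++ [_])]
    rw [← Finset.sum_mul, ← Finset.sum_mul, hq1]; ring
  · simp only [pending, if_neg hp, avgArm]
    rw [← hq1, ← Finset.sum_sub_distrib, Finset.sum_mul, ← Finset.sum_add_distrib]
    refine Finset.sum_congr rfl fun k _ => ?_
    have := (hq k).ne'
    field_simp
    rw [hq1, one_mul]

theorem upper_eq_of_pos_eq_zero [Fintype X] {w : X → ℝ} {n : ℕ} {past : List (X × Cost K)}
    (h : pos past.length = 0) (v : List (Option (Fin K))) :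
    upper w H n past v = upper w H n past [] := by
  rw [upper, upper, if_pos h, if_pos h]

variable [Fintype X] [MeasurableSpace X] [MeasurableSingletonClass X]

-- Induction over the remaining rounds. The bound is averaged over the pending estimate because its
-- coin is flipped only during the next round.
open MeasureTheory in
theorem gameValue_le_pending (μ : Measure X) [IsProbabilityMeasure μ] (hH : H.Nonempty) (n : ℕ)
    {past : List (X × Cost K)} (hpast : ∀ d ∈ past, ∀ k, 0 ≤ d.2 k) {m : Mem} (L : ℝ)
    {v : List (Option (Fin K))} {k : Fin K} {π : ℝ} (hm : Stores past.length m v k π) :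
    gameValue H learner μ n past m L ≤
      L + pending past.length v k π (upper (fun x => μ.real {x}) H n past) := by
  have hK : 1 ≤ K := k.pos
  set w : X → ℝ := fun x => μ.real {x} with hw
  have hw1 : ∑ x, w x = 1 := by
    rw [hw, sum_measureReal_singleton]; simp
  induction n generalizing past m L v k π with
  | zero =>
    rw [gameValue, sub_eq_add_neg]
    refine add_le_add_right ?_ _
    rw [← pending_const past.length v k π (-erm H past)]
    exact hm.pending_mono fun v' _ => neg_erm_le_upper_zero hK hH hpast v'
  | succ n ih =>
    have hxl : (past.map Prod.fst).length = past.length := List.length_map _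
    set s := past.length with hs
    have hM0 := mag_pos hK H.card s
    have hKM := le_mag K H.card s
    have hrN : len s - 1 - pos s ≤ pool s := by have := len_le_pool s; omega
    -- Lists of the wrong length never occur and receive the value `0`.
    have ex : ∀ v' : List (Option (Fin K)), ∃ R : X → ℝ, v'.length = pos s → _ := fun v' => by
      by_cases hv : v'.length = pos s
      · obtain ⟨R, hR⟩ := exists_step_bound hw1 hK hH n hpast hv
        exact ⟨R, fun _ => hR⟩
      · exact ⟨0, fun h => absurd h hv⟩
    choose R hR using ex
    have hround : ∀ x, (⨆ c : Fin K → unitInterval,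
        expect (learner.round H (past.map Prod.fst ++ [x]) m) (fun m' =>
          ∑ k, m'.act K k *
            gameValue H learner μ n (past ++ [(x, fun i => (c i : ℝ))]) (m'.observe k (c k))
              (L + ∑ i, m'.act K i * (c i : ℝ)))) ≤
        pending s v k π fun v' => L + R v' x := by
      intro x
      refine ciSup_le fun c => ?_
      have hc0 : ∀ i, (0 : ℝ) ≤ c i := fun i => (c i).2.1
      have hc1 : ∀ i, (c i : ℝ) ≤ 1 := fun i => (c i).2.2
      set past' := past ++ [(x, fun i => (c i : ℝ))] with hpast'
      have hlen' : past'.length = s + 1 := by simp [hpast', hs]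
      have hpos' : ∀ d ∈ past', ∀ k, 0 ≤ d.2 k := fun d hd => by
        rcases List.mem_append.1 hd with hd | hd
        · exact hpast d hd
        · rw [List.mem_singleton.1 hd]; exact hc0
      refine (expect_round_le hH (x := x) (G := fun v' l =>
        (∑ k, strategy H (mag K H.card s) (rate K H.card s)
            (look (mag K H.card s) (past.map Prod.fst ++ [x])
              (v'.zipIdx (s - pos s) ++ l)) x k * (c k : ℝ)) +
        (L + avgArm (mag K H.card s) (fun i => (c i : ℝ))
          (fun o => upper w H n past' (v' ++ [o])))) (hxl.symm ▸ hm) ?_).trans ?_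
      · intro m' v' l hp
        have hst := fun k => hp.stores hH k (hc0 k) (hc1 k)
        have hact := hp.act
        rw [hxl] at hst hact
        have hmem := strategy_mem hK hH hM0 (rate_le_one K H.card s) (div_mag hK _ _)
          (look (mag K H.card s) (past.map Prod.fst ++ [x]) (v'.zipIdx (s - pos s) ++ l)) x
        rw [← hact] at hmem
        have hq : ∀ k, 0 < m'.act K k := fun k => by
          rw [hact]
          exact (by positivity : 0 < 1 / mag K H.card s).trans_le
            (strategy_ge hH hM0 (rate_le_one _ _ _) _ _ _)
        have a : ∀ k, m'.act K k * gameValue H learner μ n past' (m'.observe k (c k))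
            (L + ∑ i, m'.act K i * (c i : ℝ)) ≤ m'.act K k * (L + ∑ i, m'.act K i * (c i : ℝ)) +
            m'.act K k * pending (s + 1) v' k (c k * (1 / (m'.act K k * mag K H.card s)))
              (upper w H n past') := fun k => by
          rw [← mul_add]
          refine mul_le_mul_of_nonneg_left ?_ (hq k).le
          have := ih hpos' (L + ∑ i, m'.act K i * (c i : ℝ)) (hlen'.symm ▸ hst k)
          rwa [hlen'] at this
        refine (Finset.sum_le_sum fun k _ => a k).trans (le_of_eq ?_)
        rw [Finset.sum_add_distrib, ← Finset.sum_mul, hmem.2, one_mul,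
          sum_act_mul_pending hM0 hq hmem.2 _ _
            (fun h0 v' => upper_eq_of_pos_eq_zero (hlen'.symm ▸ h0) v'), ← hact]
        ring
      · rw [hxl]
        refine hm.pending_mono fun v' hv' => ?_
        rw [(isExp_hallu (l := []) hM0 hKM (by simpa using hrN)).add_const]
        have := (hR v' hv').1 x (fun i => (c i : ℝ)) hc0 hc1
        linarith
    rw [gameValue]
    refine (integral_mono (Integrable.of_finite) (Integrable.of_finite) hround).trans ?_
    rw [integral_fintype .of_finite]
    simp only [smul_eq_mul]
    rw [sum_mul_pending, ← pending_const_add]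
    refine hm.pending_mono fun v' hv' => ?_
    have := (hR v' hv').2
    simp only [mul_add, Finset.sum_add_distrib, ← Finset.sum_mul]
    rw [hw1, one_mul]
    exact add_le_add_right this L

open MeasureTheory in
theorem gameValue_le_future (μ : Measure X) [IsProbabilityMeasure μ] (hK : 1 ≤ K)
    (hH : H.Nonempty) (T : ℕ) : gameValue H learner μ T [] Mem.empty 0 ≤
      future (fun x => μ.real {x}) (charge (fun x => μ.real {x}) H) T [] := by
  have h0 : pos 0 = 0 := Nat.zero_mod _
  have := gameValue_le_pending μ hH T (past := []) (by simp) 0 (m := Mem.empty) (v := [])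
    (k := ⟨0, hK⟩) (π := 0)
    ⟨fun i => le_rfl, by simp [Mem.empty], le_rfl, zero_le_one, fun h => absurd h0 h⟩
  rw [pending, List.length_nil, if_pos h0, upper, List.length_nil, if_pos h0] at this
  simpa [hH] using this

end Finite

/-! ### The size of the bound -/

theorem cubeRoot_eq_or (B j : ℕ) : cubeRoot B j = j + 1 ∨ B ≤ cubeRoot B j ^ 3 := by
  induction j with
  | zero => exact .inl rfl
  | succ j ih =>
    rw [cubeRoot]
    split_ifs with h
    · exact .inl (by rw [ih.resolve_right (by omega)])
    · exact .inr (by omega)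

theorem cubeRoot_le_of_le_pow {B g : ℕ} (h1 : 1 ≤ g) (hg : B ≤ g ^ 3) (j : ℕ) :
    cubeRoot B j ≤ g := by
  induction j with
  | zero => exact h1
  | succ j ih =>
    rw [cubeRoot]
    split_ifs with h
    · exact lt_of_pow_lt_pow_left₀ 3 (Nat.zero_le _) (h.trans_le hg)
    · exact ih

theorem len_eq (s : ℕ) : len s = scale s ^ 3 := by
  rw [len, scale, ← pow_mul, mul_comm, pow_mul]; norm_num

theorem pool_eq (s : ℕ) : pool s = scale s ^ 5 := by
  rw [pool, scale, ← pow_mul, mul_comm, pow_mul]; norm_num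

theorem explore_eq_or (K c s : ℕ) :
    explore K c s = scale s ∨ K * min (len s) (Nat.clog 2 c) ≤ explore K c s ^ 3 := by
  refine (cubeRoot_eq_or _ _).imp_left fun h => ?_
  have := scale_pos s
  rw [explore, h]; omega

theorem log_le_clog (c : ℕ) : Real.log c ≤ Nat.clog 2 c := by
  rcases Nat.eq_zero_or_pos c with rfl | hc
  · simp
  · have h : (c : ℝ) ≤ 2 ^ Nat.clog 2 c := by exact_mod_cast Nat.le_pow_clog one_lt_two c
    refine (Real.log_le_log (by exact_mod_cast hc) h).trans ?_
    rw [Real.log_pow]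
    exact mul_le_of_le_one_right (Nat.cast_nonneg _) (by linarith [Real.log_two_lt_d9])

/-- With `γ = e / a`, the terms `3 a ^ 3 γ = 3 e a ^ 2` and `2 K log c / γ ^ 2` balance as soon as
`e ^ 3 ≥ K log c`; the sum is at most `5 e a ^ 2`. -/
theorem opening_le {K c g : ℕ} (hK : 1 ≤ K) (h1 : 1 ≤ g) (hg : K * Nat.clog 2 c ≤ g ^ 3) (s : ℕ) :
    opening K c s ≤ 5 * g * (scale s : ℝ) ^ 2 := by
  have ha : (0 : ℝ) < scale s := by exact_mod_cast scale_pos s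
  have he : (0 : ℝ) < explore K c s := by exact_mod_cast one_le_explore K c s
  have hle : explore K c s ≤ g :=
    cubeRoot_le_of_le_pow h1 ((Nat.mul_le_mul_left K (min_le_right _ _)).trans hg) _
  have hle' : (explore K c s : ℝ) ≤ g := by exact_mod_cast hle
  suffices h : opening K c s ≤ 5 * explore K c s * (scale s : ℝ) ^ 2 from
    h.trans (by gcongr)
  have hlen : (len s : ℝ) = (scale s : ℝ) ^ 3 := by rw [len_eq]; push_cast; rfl
  unfold opening
  split_ifs with ht
  -- In a trivial round the capped search reaches the scale, so the length `a ^ 3` of the epoch is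
  -- at most `e a ^ 2`.
  · have : scale s ≤ explore K c s := by
      rcases ht with h | h
      · rw [h]; exact one_le_explore K c s
      · rcases explore_eq_or K c s with e | e
        · exact e.ge
        · refine le_of_not_gt fun hlt => ?_
          have h2 := Nat.pow_lt_pow_left hlt (n := 3) (by norm_num)
          have h3 : scale s ^ 3 ≤ K * min (len s) (Nat.clog 2 c) := by
            rw [← Nat.mul_min_mul_left]
            exact le_min (by rw [len_eq]; exact Nat.le_mul_of_pos_left _ hK) h.le
          omega
    have h' : (scale s : ℝ) ≤ explore K c s := by exact_mod_cast this
    rw [hlen]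
    have := mul_le_mul_of_nonneg_right h' (sq_nonneg (scale s : ℝ))
    nlinarith [mul_pos he (pow_pos ha 2)]
  · have h3 : K * Nat.clog 2 c ≤ scale s ^ 3 := not_lt.1 fun h => ht (.inr h)
    have h4 : K * Nat.clog 2 c ≤ explore K c s ^ 3 := by
      rcases explore_eq_or K c s with e | e
      · rwa [e]
      · rwa [min_eq_right] at e
        rw [len_eq]
        exact (Nat.le_mul_of_pos_left _ hK).trans h3
    have h5 : (K : ℝ) * Real.log c ≤ (explore K c s : ℝ) ^ 3 :=
      (mul_le_mul_of_nonneg_left (log_le_clog c) (Nat.cast_nonneg K)).trans (by exact_mod_cast h4)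
    have hK0 : (0 : ℝ) < K := by exact_mod_cast hK
    rw [rate_div_mag_mul hK, hlen, mag_eq, rate]
    set a : ℝ := (scale s : ℝ)
    set e : ℝ := (explore K c s : ℝ)
    have e1 : Real.log c / (e / a / (K / (e / a))) = K * Real.log c * (a ^ 2 / e ^ 2) := by
      field_simp
    have e2 : a ^ 3 * (e / a) = e * a ^ 2 := by field_simp
    have e3 : e ^ 3 * (a ^ 2 / e ^ 2) = e * a ^ 2 := by field_simp
    have := mul_le_mul_of_nonneg_right h5 (by positivity : 0 ≤ a ^ 2 / e ^ 2)
    rw [e1, e2]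
    linarith

section Charge

variable {X : Type*} {K : ℕ} {H : Finset (X → Fin K)} [Fintype X] {w : X → ℝ}

theorem charge_of_trivial {xs : List X} {s : ℕ} (hs : xs.length = s) (ht : Trivial K H.card s) :
    charge w H xs = if pos s = 0 then opening K H.card s else 0 := by
  subst hs; rw [charge, if_pos ht, add_zero]

theorem charge_of_not_trivial {xs : List X} {s : ℕ} (hs : xs.length = s)
    (ht : ¬ Trivial K H.card s) :
    charge w H xs = (if pos s = 0 then opening K H.card s else 0) +
      excess w H (mag K H.card s) (pool s) (s - pos s) (len s - 1 - pos s) (pos s)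
        ((scale s : ℝ) ^ 4 * Real.sqrt (Real.log (K + 1))) xs := by
  subst hs; rw [charge, if_neg ht]

theorem sum_charge_le (h0 : ∀ x, 0 ≤ w x) (h1 : ∑ x, w x = 1) (hK : 1 ≤ K) (hH : H.Nonempty) {g : ℕ}
    (hg1 : 1 ≤ g) (hg : K * Nat.clog 2 H.card ≤ g ^ 3) (s : ℕ) :
    ∑ u : Fin s → X, (∏ j, w (u j)) * charge w H (List.ofFn u) ≤
      5 * g * (if pos s = 0 then (scale s : ℝ) ^ 2 else 0) +
        2 * Real.sqrt (Real.log (K + 1)) * (1 / scale s) := by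
  have hE := isExp_prod h0 h1 s
  have ha : (0 : ℝ) < scale s := by exact_mod_cast scale_pos s
  have hl := log_succ_pos hK
  have hop : (if pos s = 0 then opening K H.card s else 0) ≤
      5 * g * (if pos s = 0 then (scale s : ℝ) ^ 2 else 0) := by
    split_ifs
    · exact opening_le hK hg1 hg s
    · rw [mul_zero]
  by_cases ht : Trivial K H.card s
  · simp only [charge_of_trivial List.length_ofFn ht]
    rw [hE.const]
    exact hop.trans (le_add_of_nonneg_right (by positivity))
  · have hsc : scale s ≠ 1 := fun e => ht (.inl e)
    have hN := pool_le_start hsc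
    have hpl := len_le_pool s
    have hps := pos_lt s
    simp only [charge_of_not_trivial List.length_ofFn ht, mul_add, Finset.sum_add_distrib]
    rw [hE.const]
    refine add_le_add hop ((sum_excess_le h0 h1 hH (mag_pos hK _ _) (le_mag _ _ _)
      (show len s - 1 - pos s < pool s by omega) hN (Nat.sub_add_cancel (pos_le s)) (excess_scale_pos hK s)).trans ?_)
    have h2 : 2 ≤ scale s := by have := scale_pos s; omega
    have hlen : (len s : ℝ) = (scale s : ℝ) ^ 3 := by rw [len_eq]; push_cast; rfl
    -- Fewer than `len s ≤ pool s / 4` members are used, so at least half of the pool remains. The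
    -- parameter `a ^ 4 √ℓ` of the soft maximum balances the entropy `a ^ 3 ℓ` with the variance
    -- term.
    have hd : (scale s : ℝ) ^ 5 ≤ 2 * ((pool s - (len s - 1 - pos s) : ℕ) : ℝ) := by
      have h3 : 4 * len s ≤ pool s := by
        rw [len_eq, pool_eq, pow_add _ 2 3]
        exact Nat.mul_le_mul_right _ (Nat.pow_le_pow_left h2 2)
      have h4 : scale s ^ 5 ≤ 2 * (pool s - (len s - 1 - pos s)) := by
        rw [← pool_eq]; omega
      exact_mod_cast h4
    have hpos : (pos s : ℝ) ≤ (scale s : ℝ) ^ 3 := by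
      rw [← hlen]; exact_mod_cast hps.le
    set a : ℝ := (scale s : ℝ)
    set ℓ := Real.log ((K : ℝ) + 1)
    have hsq : Real.sqrt ℓ ^ 2 = ℓ := Real.sq_sqrt hl.le
    have hs0 : 0 < Real.sqrt ℓ := Real.sqrt_pos.2 hl
    have hfrac : (a ^ 4 * Real.sqrt ℓ) ^ 2 / (2 * ((pool s - (len s - 1 - pos s) : ℕ) : ℝ)) ≤
        a ^ 3 * ℓ := by
      refine (div_le_div_of_nonneg_left (by positivity) (by positivity) hd).trans (le_of_eq ?_)
      rw [mul_pow, hsq]; field_simp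
    rw [div_le_iff₀ (by positivity)]
    have e : 2 * Real.sqrt ℓ * (1 / a) * (a ^ 4 * Real.sqrt ℓ) = 2 * (a ^ 3 * Real.sqrt ℓ ^ 2) := by
      field_simp
    rw [e, hsq]
    have := mul_le_mul_of_nonneg_right hpos hl.le
    linarith

end Charge

theorem pos_eq_of_succ {s : ℕ} (h : pos (s + 1) = 0) : len s = pos s + 1 := by
  have h1 : len s ∣ len (s + 1) :=
    pow_dvd_pow 8 (Nat.log_mono_right (Nat.le_succ s))
  have h2 : len s ∣ s + 1 := h1.trans (Nat.dvd_of_mod_eq_zero h)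
  have h3 := pos_lt s
  by_contra hne
  have h4 : (s + 1) % len s = pos s + 1 := by
    rw [← Nat.mod_add_mod]
    exact Nat.mod_eq_of_lt (by rw [pos] at *; omega)
  rw [Nat.mod_eq_zero_of_dvd h2] at h4
  omega

/-- Amortization: the cost `a ^ 2` of an epoch is spread as `1 / a` over its `a ^ 3` rounds. The
last term is the share of the unplayed rounds of the current epoch. -/
theorem sum_starts_le (T : ℕ) :
    ∑ s ∈ Finset.range T, (if pos s = 0 then (scale s : ℝ) ^ 2 else 0) ≤
      ∑ s ∈ Finset.range T, 1 / (scale s : ℝ) +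
        if pos T = 0 then 0 else ((len T : ℝ) - pos T) / scale T := by
  induction T with
  | zero => simp [show pos 0 = 0 from Nat.zero_mod _]
  | succ T ih =>
    rw [Finset.sum_range_succ, Finset.sum_range_succ]
    have ha : (0 : ℝ) < scale T := by exact_mod_cast scale_pos T
    have hlen : (len T : ℝ) = (scale T : ℝ) ^ 3 := by rw [len_eq]; push_cast; rfl
    have h : ∑ s ∈ Finset.range T, (if pos s = 0 then (scale s : ℝ) ^ 2 else 0) +
        (if pos T = 0 then (scale T : ℝ) ^ 2 else 0) ≤
        ∑ s ∈ Finset.range T, 1 / (scale s : ℝ) + ((len T : ℝ) - pos T) / scale T := by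
      split_ifs at ih ⊢ with hp
      · rw [hp, Nat.cast_zero, sub_zero, hlen]
        have : (scale T : ℝ) ^ 3 / scale T = (scale T : ℝ) ^ 2 := by field_simp
        linarith
      · linarith
    refine h.trans ?_
    rw [add_assoc]
    refine add_le_add_right ?_ _
    split_ifs with hp
    · rw [pos_eq_of_succ hp]; push_cast
      rw [add_sub_cancel_left, add_zero]
    · obtain ⟨h1, h2⟩ := phase_succ hp
      have e1 : len (T + 1) = len T := by rw [len, len, h1]
      have e2 : scale (T + 1) = scale T := by rw [scale, scale, h1]
      rw [h2, e1, e2]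
      push_cast
      rw [← add_div]
      exact le_of_eq (by ring)

/-- By `s + 1 ≤ (2 a) ^ 5`, `1 / a` is at most `2 (s + 1) ^ (-1/5)`, while Bernoulli's inequality
bounds the increment of `s ^ (4/5)` below by `4/5` of that power; the ratio is `5 / 2`. -/
theorem sum_inv_scale_le (T : ℕ) :
    ∑ s ∈ Finset.range T, 1 / (scale s : ℝ) ≤ 5 / 2 * (T : ℝ) ^ (4 / 5 : ℝ) := by
  induction T with
  | zero => simp
  | succ s ih =>
    rw [Finset.sum_range_succ]
    have ha : (0 : ℝ) < scale s := by exact_mod_cast scale_pos s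
    have hy : (0 : ℝ) < (s : ℝ) + 1 := by positivity
    set y : ℝ := (s : ℝ) + 1 with hyd
    have h1 : y ^ (1 / 5 : ℝ) ≤ 2 * scale s := by
      have h2 : s + 1 ≤ (2 * scale s) ^ 5 := by
        have : s < 32 ^ (phase s + 1) := Nat.lt_pow_succ_log_self (by norm_num) s
        rw [mul_pow, ← pool_eq, pool]
        rw [pow_succ] at this
        omega
      have h3 : y ≤ ((2 * scale s : ℝ)) ^ 5 := by rw [hyd]; exact_mod_cast h2
      refine (Real.rpow_le_rpow hy.le h3 (by norm_num)).trans (le_of_eq ?_)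
      rw [← Real.rpow_natCast, ← Real.rpow_mul (by positivity)]
      norm_num
    have hq : 0 < y ^ (1 / 5 : ℝ) := Real.rpow_pos_of_pos hy _
    have hz : 0 < y ^ (4 / 5 : ℝ) := Real.rpow_pos_of_pos hy _
    have hyz : y ^ (4 / 5 : ℝ) * y ^ (1 / 5 : ℝ) = y := by
      rw [← Real.rpow_add hy]; norm_num
    have h4 : (s : ℝ) ^ (4 / 5 : ℝ) ≤ y ^ (4 / 5 : ℝ) * (1 - 4 / 5 * (1 / y)) := by
      have e : (s : ℝ) = y * (1 + -(1 / y)) := by rw [hyd]; field_simp; ring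
      have hle : 1 / y ≤ 1 := by rw [div_le_one hy, hyd]; linarith [Nat.cast_nonneg (α := ℝ) s]
      rw [e, Real.mul_rpow hy.le (by linarith)]
      refine mul_le_mul_of_nonneg_left ?_ hz.le
      refine (rpow_one_add_le_one_add_mul_self (by linarith) (by norm_num)
        (by norm_num)).trans (le_of_eq (by ring))
    have h5 : y ^ (4 / 5 : ℝ) * (1 / y) = 1 / y ^ (1 / 5 : ℝ) := by
      field_simp; linarith
    have h6 : 1 / (scale s : ℝ) ≤ 2 * (1 / y ^ (1 / 5 : ℝ)) := by
      rw [mul_one_div, div_le_div_iff₀ ha hq]; linarith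
    push_cast
    nlinarith

theorem sum_starts_le_rpow (T : ℕ) :
    ∑ s ∈ Finset.range T, (if pos s = 0 then (scale s : ℝ) ^ 2 else 0) ≤
      7 / 2 * (T : ℝ) ^ (4 / 5 : ℝ) := by
  rcases Nat.eq_zero_or_pos T with rfl | hT
  · simp
  have h := sum_starts_le T
  have h2 := sum_inv_scale_le T
  have ha1 : (1 : ℝ) ≤ scale T := by exact_mod_cast scale_pos T
  have ha : (0 : ℝ) < scale T := by linarith
  have hlen : (len T : ℝ) = (scale T : ℝ) ^ 3 := by rw [len_eq]; push_cast; rfl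
  have h3 : (scale T : ℝ) ^ 4 ≤ (T : ℝ) ^ (4 / 5 : ℝ) := by
    have h4 : scale T ^ 5 ≤ T := by
      rw [← pool_eq]; exact Nat.pow_log_le_self 32 (by omega)
    have h5 : (scale T : ℝ) ^ 5 ≤ T := by exact_mod_cast h4
    refine le_trans (le_of_eq ?_) (Real.rpow_le_rpow (by positivity) h5 (by norm_num))
    rw [← Real.rpow_natCast (_ : ℝ) 5, ← Real.rpow_mul ha.le, ← Real.rpow_natCast (_ : ℝ) 4]
    norm_num
  have h4 : (if pos T = 0 then 0 else ((len T : ℝ) - pos T) / scale T) ≤ (scale T : ℝ) ^ 4 := by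
    split_ifs
    · positivity
    · rw [div_le_iff₀ ha, hlen]
      have : (scale T : ℝ) ^ 3 * 1 ≤ (scale T : ℝ) ^ 3 * (scale T : ℝ) ^ 2 :=
        mul_le_mul_of_nonneg_left (one_le_pow₀ ha1) (by positivity)
      have := Nat.cast_nonneg (α := ℝ) (pos T)
      nlinarith
  linarith

/-- For `c ≥ 2` take `g` the ceiling of the cube root, at most twice the root, which is itself at
most three times the first term. For `c = 1` the first term vanishes and `g = 1` is covered by the
second. -/
theorem exists_cube_bound {K c : ℕ} (hK : 2 ≤ K) (hc : 1 ≤ c) : ∃ g : ℕ, 1 ≤ g ∧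
    K * Nat.clog 2 c ≤ g ^ 3 ∧ (g : ℝ) ≤ 6 * ((K : ℝ) ^ (2 / 3 : ℝ) * Real.log c ^ (1 / 3 : ℝ)) +
      K * Real.sqrt (Real.log K) := by
  have hK' : (2 : ℝ) ≤ K := by exact_mod_cast hK
  rcases Nat.eq_or_lt_of_le hc with rfl | hc
  · refine ⟨1, le_rfl, by simp, ?_⟩
    have h1 : (1 / 2 : ℝ) ≤ Real.sqrt (Real.log K) := by
      refine Real.le_sqrt_of_sq_le ?_
      have := Real.log_le_log (by norm_num) hK'
      linarith [Real.log_two_gt_d9]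
    have : (0 : ℝ) ≤ 6 * ((K : ℝ) ^ (2 / 3 : ℝ) * Real.log (1 : ℕ) ^ (1 / 3 : ℝ)) := by simp
    rw [Nat.cast_one] at *
    nlinarith
  · have hlog : 1 ≤ Nat.clog 2 c := Nat.clog_pos one_lt_two hc
    set B : ℕ := K * Nat.clog 2 c with hB
    have hB1 : 1 ≤ B := Nat.mul_pos (by omega) hlog
    set z : ℝ := (B : ℝ) ^ (1 / 3 : ℝ) with hz
    have hz1 : 1 ≤ z := Real.one_le_rpow (by exact_mod_cast hB1) (by norm_num)
    have hz3 : z ^ 3 = B := by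
      rw [hz, ← Real.rpow_natCast, ← Real.rpow_mul (by positivity)]; norm_num
    have hl0 : 0 < Real.log c := Real.log_pos (by exact_mod_cast hc)
    refine ⟨⌈z⌉₊, Nat.one_le_iff_ne_zero.2 (Nat.ceil_pos.2 (by linarith)).ne', ?_, ?_⟩
    · have : (B : ℝ) ≤ (⌈z⌉₊ : ℝ) ^ 3 := by
        rw [← hz3]; exact pow_le_pow_left₀ (by linarith) (Nat.le_ceil z) 3
      exact_mod_cast this
    -- Rounding up at most doubles the binary logarithm for `c ≥ 2`, and `2 / log 2 < 3`.
    · have h1 : (Nat.clog 2 c : ℝ) ≤ 3 * Real.log c := by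
        have h2 : 2 ^ (Nat.clog 2 c - 1) < c := Nat.pow_pred_clog_lt_self one_lt_two hc
        have h3 : ((Nat.clog 2 c - 1 : ℕ) : ℝ) * Real.log 2 ≤ Real.log c := by
          rw [← Real.log_pow]
          exact Real.log_le_log (by positivity) (by exact_mod_cast h2.le)
        have h4 : Real.log 2 ≤ Real.log c := Real.log_le_log (by norm_num) (by exact_mod_cast hc)
        rw [Nat.cast_sub hlog] at h3
        push_cast at h3
        nlinarith [Real.log_two_gt_d9]
      have h2 : z ≤ 3 * ((K : ℝ) ^ (2 / 3 : ℝ) * Real.log c ^ (1 / 3 : ℝ)) := by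
        have h3 : (B : ℝ) ≤ 3 * (K * Real.log c) := by
          rw [hB]; push_cast
          nlinarith
        refine (Real.rpow_le_rpow (by positivity) h3 (by norm_num)).trans ?_
        rw [Real.mul_rpow (by norm_num) (by positivity), Real.mul_rpow (by positivity) hl0.le]
        have a : (3 : ℝ) ^ (1 / 3 : ℝ) ≤ 3 := by
          conv_rhs => rw [← Real.rpow_one 3]
          exact Real.rpow_le_rpow_of_exponent_le (by norm_num) (by norm_num)
        have b : (K : ℝ) ^ (1 / 3 : ℝ) ≤ (K : ℝ) ^ (2 / 3 : ℝ) :=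
          Real.rpow_le_rpow_of_exponent_le (by linarith) (by norm_num)
        gcongr
      have h3 := (Nat.ceil_lt_add_one (by linarith : 0 ≤ z)).le
      have h4 : 0 ≤ (K : ℝ) * Real.sqrt (Real.log K) := by positivity
      linarith

theorem sqrt_log_succ_le {K : ℕ} (hK : 2 ≤ K) :
    Real.sqrt (Real.log (K + 1)) ≤ K * Real.sqrt (Real.log K) := by
  have hK' : (2 : ℝ) ≤ K := by exact_mod_cast hK
  refine Real.sqrt_le_iff.2 ⟨by positivity, ?_⟩
  have hl : 0 ≤ Real.log K := Real.log_nonneg (by linarith)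
  rw [mul_pow, Real.sq_sqrt hl]
  have h : Real.log (K + 1) ≤ 2 * Real.log K := by
    rw [← Nat.cast_ofNat, ← Real.log_pow]
    exact Real.log_le_log (by linarith) (by nlinarith)
  have : 2 * Real.log K ≤ (K : ℝ) ^ 2 * Real.log K :=
    mul_le_mul_of_nonneg_right (by nlinarith) hl
  linarith

open MeasureTheory in
theorem gameValue_le {X : Type*} [Fintype X] [MeasurableSpace X] [MeasurableSingletonClass X]
    {K : ℕ} {H : Finset (X → Fin K)} (μ : Measure X) [IsProbabilityMeasure μ] (hK : 2 ≤ K)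
    (hH : H.Nonempty) (T : ℕ) : gameValue H learner μ T [] Mem.empty 0 ≤
      105 * (((K : ℝ) ^ (2 / 3 : ℝ) * (Real.log (H.card : ℝ)) ^ (1 / 3 : ℝ)
        + (K : ℝ) * Real.sqrt (Real.log (K : ℝ))) * (T : ℝ) ^ (4 / 5 : ℝ)) := by
  have hK1 : 1 ≤ K := by omega
  have hw1 : ∑ x, μ.real {x} = 1 := by rw [sum_measureReal_singleton]; simp
  obtain ⟨g, hg1, hg, hgle⟩ := exists_cube_bound hK hH.card_pos
  refine (gameValue_le_future μ hK1 hH T).trans ?_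
  rw [future_eq]
  refine (Finset.sum_le_sum fun s _ => by
    simp only [List.nil_append]
    exact sum_charge_le (fun x => measureReal_nonneg) hw1 hK1 hH hg1 hg s).trans ?_
  rw [Finset.sum_add_distrib, ← Finset.mul_sum, ← Finset.mul_sum]
  have a := sum_starts_le_rpow T
  have b := sum_inv_scale_le T
  have c := sqrt_log_succ_le hK
  have hg0 : (0 : ℝ) ≤ g := Nat.cast_nonneg g
  have hT : 0 ≤ (T : ℝ) ^ (4 / 5 : ℝ) := by positivity
  have hA : 0 ≤ (K : ℝ) ^ (2 / 3 : ℝ) * (Real.log (H.card : ℝ)) ^ (1 / 3 : ℝ) := by positivity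
  have hB : 0 ≤ (K : ℝ) * Real.sqrt (Real.log (K : ℝ)) := by positivity
  set A := (K : ℝ) ^ (2 / 3 : ℝ) * (Real.log (H.card : ℝ)) ^ (1 / 3 : ℝ)
  set B := (K : ℝ) * Real.sqrt (Real.log (K : ℝ))
  set t := (T : ℝ) ^ (4 / 5 : ℝ)
  have a' := mul_le_mul_of_nonneg_left a (by positivity : (0 : ℝ) ≤ 5 * g)
  have b' := mul_le_mul_of_nonneg_left b (by positivity :
    (0 : ℝ) ≤ 2 * Real.sqrt (Real.log (K + 1)))
  have g' := mul_le_mul_of_nonneg_right hgle hT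
  have c' := mul_le_mul_of_nonneg_right c hT
  have := mul_nonneg hB hT
  simp only [one_div] at *
  -- The total is at most `(35/2) g + 5 √(log (K + 1))` times `t`; with `g ≤ 6 A + B` the
  -- coefficient of `A` is `105`, that of `B` is smaller.
  nlinarith

/-! ### Reduction to a finite space of contexts -/

section Transfer

variable {X X' : Type*} {K : ℕ} {H : Finset (X → Fin K)} {H' : Finset (X' → Fin K)} {f : X → X'}

theorem query_map (xs : List X) (m : Mem) (len hs cs : ℕ) :
    m.query K (xs.map f) len hs cs = (m.query K xs len hs cs).map (Prod.map f id) := by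
  rw [Mem.query, Mem.query, List.map_filterMap]
  refine List.filterMap_congr fun i _ => ?_
  rw [List.getElem?_map]
  cases xs[m.nat hs i]? <;> rfl

/-- A program sees contexts only through oracle answers, so equal answers give equal laws. -/
theorem exec_map (herm : ∀ D : List (X × Cost K), erm H' (D.map (Prod.map f id)) = erm H D)
    (xs : List X) (P : Prog) (m : Mem) : P.exec H' (xs.map f) m = P.exec H xs m := by
  induction P generalizing m with
  | skip => rfl
  | setNat => rfl
  | setReal => rfl
  | flip => rfl
  | ask => rw [Prog.exec, Prog.exec, query_map, herm]
  | seq P Q hP hQ =>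
    rw [Prog.exec, Prog.exec, hP]
    exact congrArg _ (funext hQ)
  | ite b P Q hP hQ => rw [Prog.exec, Prog.exec, hP, hQ]
  | loop v n P hP => rw [Prog.exec, Prog.exec]; simp only [hP]

theorem round_map (hcard : H'.card = H.card)
    (herm : ∀ D : List (X × Cost K), erm H' (D.map (Prod.map f id)) = erm H D)
    (xs : List X) (P : Prog) (m : Mem) : P.round H' (xs.map f) m = P.round H xs m := by
  rw [Prog.round, Prog.round, exec_map herm, Mem.present, Mem.present, List.length_map, hcard]

open MeasureTheory in
theorem gameValue_map [MeasurableSpace X] [MeasurableSpace X'] [DiscreteMeasurableSpace X']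
    [Countable X'] (hf : Measurable f) (hcard : H'.card = H.card)
    (herm : ∀ D : List (X × Cost K), erm H' (D.map (Prod.map f id)) = erm H D)
    (P : Prog) (μ : Measure X) (n : ℕ) (past : List (X × Cost K)) (m : Mem) (L : ℝ) :
    gameValue H' P (μ.map f) n (past.map (Prod.map f id)) m L = gameValue H P μ n past m L := by
  induction n generalizing past m L with
  | zero => rw [gameValue, gameValue, herm]
  | succ n ih =>
    rw [gameValue, gameValue,
      integral_map hf.aemeasurable (StronglyMeasurable.of_discrete).aestronglyMeasurable]
    refine integral_congr_ae (.of_forall fun x => ?_)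
    simp only
    have e : (past.map (Prod.map f id)).map Prod.fst ++ [f x] =
        (past.map Prod.fst ++ [x]).map f := by simp
    rw [e, round_map hcard herm]
    simp only [← ih, List.map_append, List.map_cons, List.map_nil, Prod.map_apply, id]

end Transfer

section Patterns

variable {X : Type*} {K : ℕ}

/-- The values of the policies at a context. -/
def pattern (H : Finset (X → Fin K)) (x : X) : {h // h ∈ H} → Fin K := fun h => h.1 x

/-- Two arms are needed to keep different policies distinct on patterns; the program reads `|H|`,
which therefore must be preserved. -/
theorem eval_injective {J : Type*} (hK : 2 ≤ K) :
    Function.Injective fun (j : J) (p : J → Fin K) => p j := by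
  classical
  intro i j hij
  by_contra hne
  have := congrFun hij fun l => if l = i then ⟨0, by omega⟩ else ⟨1, by omega⟩
  simp [Ne.symm hne] at this

/-- The policies as functions of the patterns. -/
def evaluations (H : Finset (X → Fin K)) (hK : 2 ≤ K) :
    Finset (({h // h ∈ H} → Fin K) → Fin K) :=
  Finset.univ.map ⟨fun j p => p j, eval_injective hK⟩

theorem card_evaluations (H : Finset (X → Fin K)) (hK : 2 ≤ K) :
    (evaluations H hK).card = H.card := by simp [evaluations]

theorem evaluations_nonempty {H : Finset (X → Fin K)} (hK : 2 ≤ K) (hH : H.Nonempty) :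
    (evaluations H hK).Nonempty := by
  rw [← Finset.card_pos, card_evaluations]; exact hH.card_pos

theorem erm_evaluations {H : Finset (X → Fin K)} (hK : 2 ≤ K) (hH : H.Nonempty)
    (D : List (X × Cost K)) :
    erm (evaluations H hK) (D.map (Prod.map (pattern H) id)) = erm H D := by
  have e : ∀ h : {h // h ∈ H}, cost (fun p : {h // h ∈ H} → Fin K => p h)
      (D.map (Prod.map (pattern H) id)) = cost h.1 D := fun h => by
    rw [cost, cost, List.map_map]; rfl
  refine le_antisymm (le_erm hH fun h hh => ?_) (le_erm (evaluations_nonempty hK hH) fun g hg => ?_)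
  · rw [← e ⟨h, hh⟩]
    exact erm_le (Finset.mem_map_of_mem _ (Finset.mem_univ (⟨h, hh⟩ : {h // h ∈ H}))) _
  · obtain ⟨h, -, rfl⟩ := Finset.mem_map.1 hg
    exact (erm_le h.2 D).trans_eq (e h).symm

-- The space of patterns is finite and discrete, so integrability is automatic there and only
-- measurability of the policies is needed on `X`.
open MeasureTheory in
theorem gameValue_le_of_two_le [MeasurableSpace X] {H : Finset (X → Fin K)} (μ : Measure X)
    [IsProbabilityMeasure μ] (hK : 2 ≤ K) (hH : H.Nonempty) (hmeas : ∀ h ∈ H, Measurable h)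
    (T : ℕ) : gameValue H learner μ T [] Mem.empty 0 ≤
      105 * (((K : ℝ) ^ (2 / 3 : ℝ) * (Real.log (H.card : ℝ)) ^ (1 / 3 : ℝ)
        + (K : ℝ) * Real.sqrt (Real.log (K : ℝ))) * (T : ℝ) ^ (4 / 5 : ℝ)) := by
  classical
  have hf : Measurable (pattern H) := measurable_pi_lambda _ fun h => hmeas h.1 h.2
  have : IsProbabilityMeasure (μ.map (pattern H)) := Measure.isProbabilityMeasure_map hf.aemeasurable
  have h := gameValue_le (μ.map (pattern H)) hK (evaluations_nonempty hK hH) T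
  rw [card_evaluations] at h
  rwa [← gameValue_map hf (card_evaluations H hK) (erm_evaluations hK hH)]

end Patterns

/-! ### A single arm -/

theorem act_one (m : Mem) : m.act 1 = fun _ => 1 := by
  funext k
  have : k = 0 := Subsingleton.elim _ _
  rw [this, Mem.act]
  split_ifs with h
  · simpa using h.2
  · simp

-- With a single arm learner and policies pay the same. This case is separate because the bound is
-- zero there, while evaluations at patterns may coincide.
open MeasureTheory in
theorem gameValue_one {X : Type*} [MeasurableSpace X] {H : Finset (X → Fin 1)} (hH : H.Nonempty)
    (P : Prog) (μ : Measure X) [IsProbabilityMeasure μ] (n : ℕ) (past : List (X × Cost 1))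
    (m : Mem) (L : ℝ) : gameValue H P μ n past m L = L - (past.map fun d => d.2 0).sum := by
  induction n generalizing past m L with
  | zero =>
    obtain ⟨h, -, e⟩ := exists_erm_eq hH past
    have : ∀ x, h x = 0 := fun x => Subsingleton.elim _ _
    rw [gameValue, e, cost]
    simp only [this]
  | succ n ih =>
    rw [gameValue]
    simp only [ih, act_one]
    simp [expect_const (exec_support_finite H _ P _), Prog.round]

end Bandit

theorem mainTheorem6 :
    ∃ (P : Bandit.Prog) (C : ℝ) (p : Polynomial ℕ),
      ∀ (X : Type*) [MeasurableSpace X] (K : ℕ) (H : Finset (X → Fin K)),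
        1 ≤ K → H.Nonempty → (∀ h ∈ H, Measurable h) →
          Bandit.RunsWithin P H (fun t => p.eval (t + K)) ∧
          ∀ T : ℕ, Bandit.banditRegret H P T ≤
            C * (((K : ℝ) ^ (2 / 3 : ℝ) * (Real.log (H.card : ℝ)) ^ (1 / 3 : ℝ)
                + (K : ℝ) * Real.sqrt (Real.log (K : ℝ))) * (T : ℝ) ^ (4 / 5 : ℝ)) := by
  -- If `X` is empty there is no probability measure and the supremum is `0` by convention;
  -- nonnegativity of the bound covers this.
  refine ⟨Bandit.learner, 105, Bandit.learner.timePoly, fun X _ K H hK hH hmeas =>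
    ⟨Bandit.learner_runsWithin H, fun T => Real.iSup_le (fun μ => ?_) (by positivity)⟩⟩
  rcases Nat.eq_or_lt_of_le hK with rfl | hK
  · rw [Bandit.gameValue_one hH]
    simp only [List.map_nil, List.sum_nil, sub_zero]
    positivity
  · exact Bandit.gameValue_le_of_two_le _ hK hH hmeas T
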